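/- **Setting.** Let $c>0$ and let $\Delta_x,\Delta_y,\Delta_z>0$. Consider the three-dimensional linear acoustic equations $\partial_t\mathbf v+c\nabla p=0$, $\partial_t p+c\nabla\cdot\mathbf v=0$ for $q=(u,v,w,p)$, i.e. $\partial_tq+J_x\partial_xq+J_y\partial_yq+J_z\partial_zq=0$, and write $\mathbf J\cdot\mathbf k=k_xJ_x+k_yJ_y+k_zJ_z$ for $\mathbf k\in\mathbb R^3$. Space is divided into the Cartesian cells $\mathcal C_I$, $I\in\mathbb Z^3$, with edge lengths $\Delta_x,\Delta_y,\Delta_z$ and centre $(I_x\Delta_x,I_y\Delta_y,I_z\Delta_z)$. *Degrees of freedom.* To each cell belong $8$ degrees of freedom $q_I^X\in\mathbb C^4$, $X\in\{A,E_x,E_y,E_z,F_x,F_y,F_z,N\}$: the cell average ($A$) and point values at the upper right corner ($N$, relative position $\frac12(\Delta_x,\Delta_y,\Delta_z)$), at the midpoints of the three edges meeting there ($E_a$ on the edge parallel to the axis $a$) and at the midpoints of the three faces meeting there ($F_a$ on the face orthogonal to the axis $a$). With those of the neighbouring cells, each cell has access to $27$ values: its average and $26$ point values at the corners, edge midpoints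 and face midpoints. The triparabolic reconstruction in a cell is the polynomial of degree at most $2$ in each variable, in coordinates relative to the cell centre, that has the given average and the given $26$ point values (componentwise). *Semi-discrete Active Flux.* With $e_a$ the unit vector of $\mathbb Z^3$ in direction $a$, the averages evolve by $$\frac{d}{dt}q_I^A+\sum_{a\in\{x,y,z\}}\frac{\hat f^a_{I}-\hat f^a_{I-e_a}}{\Delta_a}=0,$$ where $\hat f^a_I$ is the value of the tensor-product Simpson rule (weights $\frac16,\frac46,\frac16$ in each tangential direction) for the mean of $J_aq$ over the face between $\mathcal C_I$ and $\mathcal C_{I+e_a}$, using the nine point values on it. The point values evolve by $$\frac{d}{dt}q_I^P=-\sum_{a}\big(J_a^+D_a|_I^P q+J_a^-D_a^*|_I^Pq\big),\qquad P\ne A,$$ where $J_a^\pm=R\,\mathrm{diag}(\lambda_i^\pm)R^{-1}$ are the positive and negative parts of $J_a=R\,\mathrm{diag}(\lambda_i)R^{-1}$ (with $\lambda^+=\max(\lambda,0)$, $\lambda^-=\min(\lambda,0)$), $D_a|_I^Pq$ is the derivative in direction $a$, at the location of $P$, of the reconstruction in $\mathcal C_I$, and $D_a^*|_I^Pq$ is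 the same derivative of the reconstruction in $\mathcal C_{I+e_a}$ if $P$ lies on the common face of $\mathcal C_I$ and $\mathcal C_{I+e_a}$, and $D_a|_I^Pq$ otherwise. *Fourier transform.* For $\mathbf k\in\mathbb R^3$ let $t_a=\exp(\mathrm i k_a\Delta_a)$. Inserting $q^X_I=\hat q^X\,t_x^{I_x}t_y^{I_y}t_z^{I_z}$ with $\hat q=(\hat q^X)_X\in\mathbb C^{32}$ turns the method into $\frac{d}{dt}\hat q+\mathcal E(\mathbf k)\hat q=0$ with the $32\times32$ evolution matrix $\mathcal E(\mathbf k)$. The Fourier transform $\hat q_{\rm recon}=(\hat u_{\rm recon},\hat v_{\rm recon},\hat w_{\rm recon},\hat p_{\rm recon})$ of the reconstruction is the reconstruction in the cell $I=0$ from these data. The method is called *stationarity preserving* if $$S\le\min_{\mathbf k\in\mathbb R^3}\dim\ker\mathcal E(\mathbf k)\le 8S,\qquad S=\min_{\mathbf k\in\mathbb R^3}\dim\ker(\mathbf J\cdot\mathbf k).$$ **Theorem.** (i) The semi-discrete Active Flux method for three-dimensional linear acoustics is stationarity preserving. For every $\mathbf k$ with $t_x,t_y,t_z\ne1$ the kernel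 of $\mathcal E(\mathbf k)$ is $5$-dimensional. It is spanned by the vectors $\hat Q_1,\dots,\hat Q_5$ below for every $\mathbf k$ with $t_x,t_y,t_z\notin\{1,-1\}$ and $$t_z^2+4t_xt_z^2+t_x^2\big(2+t_z(8+3t_z)\big)\ne0,$$ hence for general $\mathbf k$: these conditions hold for almost every $\mathbf k\in\mathbb R^3$. (ii) For every $\mathbf k$ with $t_x,t_y,t_z\neq1$ and every $\hat q\in\mathbb C^{32}$: $\hat q\in\ker\mathcal E(\mathbf k)$ if and only if the pressure components of $\hat q$ vanish and the divergence $\partial_x\hat u_{\rm recon}+\partial_y\hat v_{\rm recon}+\partial_z\hat w_{\rm recon}$ of the velocity reconstruction is the zero polynomial. In other words, the divergence of the reconstruction of velocity data vanishes if and only if the data, completed by zero pressure, lie in the kernel, and all elements of the kernel have zero pressure. The vectors are as follows (components $(u,v,w,p)$ for each degree of freedom, $\Delta x=\Delta_x$ etc.). $\hat Q_1$: - $A$: $\Big(-\frac{\Delta x (1+t_x (4+t_x)) (t_y-1) (t_z^2+4 t_x t_z^2+t_x^2 (2+t_z (8+3 t_z)))}{54 \Delta y t_x^2 (t_x^2-1)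 t_y t_z^2},\; \frac{(1+t_y (4+t_y)) (t_z^2+4 t_x t_z^2+t_x^2 (2+t_z (8+3 t_z)))}{54 t_x^2 t_y (1+t_y) t_z^2},\; 0,\; 0\Big)$ - $E_x$: $\Big(-\frac{\Delta x (1+t_x (6+t_x)) (t_y-1)}{4 \Delta y (t_x-1) t_x (1+t_y)},\; 0,\; \frac{\Delta z (1+t_x) (t_y-1) (1+t_z)}{2 \Delta y t_x (1+t_y) (t_z-1)},\; 0\Big)$ - $E_y$: $\Big(0,\; \frac14+\frac{1}{4 t_y}+\frac{1}{1+t_y},\; -\frac{\Delta z (t_y-1) (1+t_z)}{2 \Delta y t_y (t_z-1)},\; 0\Big)$ - $E_z$: $\Big(-\frac{\Delta x (t_y-1) (4 t_x^2+t_x (3+19 t_x) t_z+(1+t_x) (2+9 t_x) t_z^2)}{12 \Delta y (t_x-1) t_x (1+t_y) t_z^2},\; \frac{4 t_x^2+t_x (3+19 t_x) t_z+(1+t_x) (2+9 t_x) t_z^2}{12 t_x (1+t_x) t_z^2},\; 0,\; 0\Big)$ - $F_x$: $\Big(-\frac{\Delta x (t_y-1) (2 t_z^2+t_x^2 (4+t_z)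 (1+3 t_z)+t_x t_z (-3+5 t_z))}{24 \Delta y (t_x-1) t_x t_y t_z^2},\; \frac{(1+t_y (6+t_y)) (4 t_x^2+t_x (3+19 t_x) t_z+(1+t_x) (2+9 t_x) t_z^2)}{48 t_x (1+t_x) t_y (1+t_y) t_z^2},\; -\frac{\Delta z (t_y-1) (1+t_z (6+t_z))}{8 \Delta y t_y (t_z-1) t_z},\; 0\Big)$ - $F_y$: $\Big(-\frac{\Delta x (1+t_x (6+t_x)) (t_y-1) (4 t_x^2+t_x (3+19 t_x) t_z+(1+t_x) (2+9 t_x) t_z^2)}{48 \Delta y t_x^2 (t_x^2-1) (1+t_y) t_z^2},\; \frac{2 t_z^2+t_x^2 (4+t_z) (1+3 t_z)+t_x t_z (-3+5 t_z)}{24 t_x^2 t_z^2},\; \frac{\Delta z (1+t_x) (t_y-1) (1+t_z (6+t_z))}{8 \Delta y t_x (1+t_y) (t_z-1) t_z},\; 0\Big)$ - $N$: $\Big(-\frac{\Delta x (1+t_x) (t_y-1)}{\Delta y (t_x-1) (1+t_y)},\; 1,\; 0,\; 0\Big)$ - $F_z$: $(0,0,0,0)$ $\hat Q_2$: - $A$: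 $\Big(-\frac{\Delta x (1+t_x (4+t_x)) (1+t_y) (t_z-1) (2 t_z^2+t_x^2 (t_z-2) (1+3 t_z)+t_x t_z (3+11 t_z))}{108 \Delta z t_x^2 (t_x^2-1) t_y t_z^2 (1+t_z)},\; -\frac{\Delta y (1+t_y (4+t_y)) (t_x-t_z) (t_z-1) (t_x+t_z+4 t_x t_z)}{54 \Delta z t_x^2 (t_y-1) t_y t_z^2 (1+t_z)},\; \frac{(1+t_x) (1+t_y) (1+t_z (4+t_z))}{36 t_x t_y t_z (1+t_z)},\; 0\Big)$ - $E_x$: $\Big(-\frac{\Delta x (1+t_x (6+t_x)) (t_z-1)}{4 \Delta z (t_x-1) t_x (1+t_z)},\; 0,\; \frac{1+t_x}{2 t_x},\; 0\Big)$ - $E_z$: $\Big(-\frac{\Delta x (t_z-1) (t_z^2+t_x t_z (3+7 t_z)+t_x^2 (-1+t_z (-1+3 t_z)))}{6 \Delta z (t_x-1) t_x t_z^2 (1+t_z)},\; -\frac{\Delta y (1+t_y) (t_x-t_z) (t_z-1) (t_x+t_z+4 t_x t_z)}{6 \Delta z t_x (1+t_x) (t_y-1) t_z^2 (1+t_z)},\;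 \frac14+\frac{1}{4 t_z}+\frac{1}{1+t_z},\; 0\Big)$ - $F_x$: $\Big(\frac{\Delta x (1+t_y) (t_x-t_z) (t_z-1) (t_x+t_z+4 t_x t_z)}{12 \Delta z (t_x-1) t_x t_y t_z^2 (1+t_z)},\; -\frac{\Delta y (1+t_y (6+t_y)) (t_x-t_z) (t_z-1) (t_x+t_z+4 t_x t_z)}{24 \Delta z t_x (1+t_x) (t_y-1) t_y t_z^2 (1+t_z)},\; 0,\; 0\Big)$ - $F_y$: $\Big(-\frac{\Delta x (1+t_x (6+t_x)) (t_z-1) (t_z^2+t_x t_z (3+7 t_z)+t_x^2 (-1+t_z (-1+3 t_z)))}{24 \Delta z t_x^2 (t_x^2-1) t_z^2 (1+t_z)},\; -\frac{\Delta y (1+t_y) (t_x-t_z) (t_z-1) (t_x+t_z+4 t_x t_z)}{12 \Delta z t_x^2 (t_y-1) t_z^2 (1+t_z)},\; \frac{(1+t_x) (1+t_z (6+t_z))}{8 t_x t_z (1+t_z)},\; 0\Big)$ - $N$: $\Big(-\frac{\Delta x (1+t_x) (t_z-1)}{\Delta z (t_x-1) (1+t_z)},\; 0,\; 1,\; 0\Big)$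 - $E_y$, $F_z$: $(0,0,0,0)$ $\hat Q_3$: - $A$: $\Big(-\frac{2 \Delta x (1+t_x (4+t_x)) (t_z-1) }{9 \Delta z (t_x^2-1) t_z},\; 0,\; \frac{2 (1+t_z (4+t_z)) }{9 t_z (1+t_z)},\; 0\Big)$ - $E_x$: $\Big(0,\; -\frac{2 \Delta y t_y (t_z-1) }{\Delta z (t_y-1) (1+t_z)},\; \frac{2 t_y }{1+t_y},\; 0\Big)$ - $E_z$: $\Big(-\frac{2 \Delta x t_x t_y (t_z-1) }{\Delta z (t_x-1) (1+t_y) t_z},\; \frac{2 \Delta y t_x t_y (t_z-1) }{\Delta z (1+t_x) (t_y-1) t_z},\; 0,\; 0\Big)$ - $F_x$: $\Big(-\frac{\Delta x t_x (t_z-1) }{\Delta z (t_x-1) t_z},\; \frac{\Delta y t_x (1+t_y (6+t_y)) (t_z-1) }{2 \Delta z (1+t_x) (t_y^2-1) t_z},\; 0,\; 0\Big)$ - $F_y$: $\Big(-\frac{\Delta x (1+t_x (6+t_x)) t_y (t_z-1) }{2 \Delta z (t_x^2-1) (1+t_y) t_z},\; 0,\; \frac{t_y (1+t_z (6+t_z))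 }{2 (1+t_y) t_z (1+t_z)},\; 0\Big)$ - $F_z$: $\Big(0,\; -\frac{\Delta y (1+t_y (6+t_y)) (t_z-1) }{2 \Delta z (t_y^2-1) (1+t_z)},\; 1,\; 0\Big)$ - $E_y$, $N$: $(0,0,0,0)$ $\hat Q_4$: - $A$: $\Big(\frac{8 \Delta x (1+t_x (4+t_x)) (t_y^2-1) (t_x-t_z) (t_x+t_z+4 t_x t_z) }{27 \Delta y (t_x-1) t_x (1+t_x)^2 (1+t_y (6+t_y)) t_z^2},\; -\frac{8 (1+t_y (4+t_y)) (t_x-t_z) (t_x+t_z+4 t_x t_z) }{27 t_x (1+t_x) (1+t_y (6+t_y)) t_z^2},\; 0,\; 0\Big)$ - $E_x$: $\Big(0,\; \frac{4 t_y (1+t_y) }{1+t_y (6+t_y)},\; -\frac{4 \Delta z (t_y-1) t_y (1+t_z)}{\Delta y (1+t_y (6+t_y)) (t_z-1)},\; 0\Big)$ - $E_y$: $\Big(-\frac{4 \Delta x t_x (t_y^2-1) }{\Delta y (t_x-1) (1+t_y (6+t_y))},\; 0,\; \frac{4 \Delta z t_x (t_y^2-1) (1+t_z) }{\Delta y (1+t_x)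 (1+t_y (6+t_y)) (t_z-1)},\; 0\Big)$ - $E_z$: $\Big(\frac{4 \Delta x (t_y-1) t_y (2 t_x^2+t_x (3+11 t_x) t_z+(-2+t_x) (1+3 t_x) t_z^2) }{3 \Delta y (t_x^2-1) (1+t_y (6+t_y)) t_z^2},\; -\frac{4 t_y (1+t_y) (2 t_x^2+t_x (3+11 t_x) t_z+(-2+t_x) (1+3 t_x) t_z^2) }{3 (1+t_x)^2 (1+t_y (6+t_y)) t_z^2},\; 0,\; 0\Big)$ - $F_x$: $\Big(\frac{4 \Delta x (t_y^2-1) (t_x-t_z) (t_x+t_z+4 t_x t_z) }{3 \Delta y (t_x^2-1) (1+t_y (6+t_y)) t_z^2},\; -\frac{(2 t_x^2+t_x (3+11 t_x) t_z+(-2+t_x) (1+3 t_x) t_z^2) }{3 (1+t_x)^2 t_z^2},\; \frac{\Delta z t_x (t_y^2-1) (1+t_z (6+t_z)) }{\Delta y (1+t_x) (1+t_y (6+t_y)) (t_z-1) t_z},\; 0\Big)$ - $F_y$: $\Big(\frac{\Delta x (1+t_x (6+t_x)) (t_y-1) t_y (2 t_x^2+t_x (3+11 t_x) t_z+(-2+t_x)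 (1+3 t_x) t_z^2) }{3 \Delta y (t_x-1) t_x (1+t_x)^2 (1+t_y (6+t_y)) t_z^2},\; -\frac{4 t_y (1+t_y) (t_x-t_z) (t_x+t_z+4 t_x t_z) }{3 t_x (1+t_x) (1+t_y (6+t_y)) t_z^2},\; -\frac{\Delta z (t_y-1) t_y (1+t_z (6+t_z)) }{\Delta y (1+t_y (6+t_y)) (t_z-1) t_z},\; 0\Big)$ - $F_z$: $\Big(-\frac{\Delta x (1+t_x (6+t_x)) (t_y^2-1) }{\Delta y (t_x^2-1) (1+t_y (6+t_y))},\; 1,\; 0,\; 0\Big)$ - $N$: $(0,0,0,0)$ $\hat Q_5$: - $E_y$: $\Big(\frac{4 t_x (1+t_x)}{1+t_x (6+t_x)},\; -\frac{4 \Delta y t_x (t_x^2-1) (1+t_y (6+t_y))}{\Delta x (1+t_x) (1+t_x (6+t_x)) (t_y^2-1)},\; \frac{4 \Delta z t_x (t_x^2-1) (1+t_z)}{\Delta x (1+t_x) (1+t_x (6+t_x)) (t_z-1)},\; 0\Big)$ - $E_z$: $\Big(-\frac{4 t_x (1+t_x) (t_y-1) t_y (1+t_z)}{(1+t_x (6+t_x))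 (t_y^2-1) t_z},\; -\frac{4 \Delta y t_x (t_x^2-1) t_y (1+t_y) (1+t_z)}{\Delta x (1+t_x) (1+t_x (6+t_x)) (t_y^2-1) t_z},\; \frac{4 \Delta z t_x (t_x^2-1) (t_y-1) t_y (1+t_z (6+t_z))}{\Delta x (1+t_x) (1+t_x (6+t_x)) (t_y^2-1) (t_z-1) t_z},\; 0\Big)$ - $F_x$: $\Big(0,\; -\frac{\Delta y t_x (t_x^2-1) (1+t_y (6+t_y)) (1+t_z)}{\Delta x (1+t_x) (1+t_x (6+t_x)) (t_y^2-1) t_z},\; \frac{\Delta z t_x (t_x^2-1) (1+t_z (6+t_z))}{\Delta x (1+t_x) (1+t_x (6+t_x)) (t_z-1) t_z},\; 0\Big)$ - $F_y$: $\Big(-\frac{(t_y-1) t_y (1+t_z)}{(t_y^2-1) t_z},\; \frac{2 \Delta y (t_x-1) (1+t_x) t_y (1+t_y) (1+t_z)}{\Delta x (1+t_x (6+t_x)) (t_y^2-1) t_z},\; 0,\; 0\Big)$ - $F_z$: $\Big(1,\; 0,\; -\frac{2 \Delta z (t_x-1) (1+t_x) (1+t_z)}{\Delta x (1+t_x (6+t_x))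 (t_z-1)},\; 0\Big)$ - $N$: $\Big(0,\; -\frac{16 \Delta y t_x (t_x^2-1) t_y (1+t_y)}{\Delta x (1+t_x) (1+t_x (6+t_x)) (t_y^2-1)},\; \frac{16 \Delta z t_x (t_x^2-1) (t_y-1) t_y (1+t_z)}{\Delta x (1+t_x) (1+t_x (6+t_x)) (t_y^2-1) (t_z-1)},\; 0\Big)$ - $A$, $E_x$: $(0,0,0,0)$ -/

import Mathlib

namespace ActiveFlux

noncomputable section

/-! ### Linear acoustics in three dimensions; state `(u, v, w, p)`, speed of sound `c` -/

/-- The Jacobian `J_a` of the flux in direction `a` of `∂ₜ𝐯 + c ∇p = 0`, `∂ₜp + c ∇·𝐯 = 0`. -/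
def jac (c : ℝ) (a : Fin 3) : Matrix (Fin 4) (Fin 4) ℝ :=
  Matrix.of fun l m => if (l = a.castSucc ∧ m = 3) ∨ (l = 3 ∧ m = a.castSucc) then c else 0

/-- The matrix `|J_a|`. -/
def jacAbs (c : ℝ) (a : Fin 3) : Matrix (Fin 4) (Fin 4) ℝ :=
  Matrix.diagonal fun l => if l = a.castSucc ∨ l = 3 then c else 0

/-- The positive part `J_a⁺` of the Jacobian. -/
def jacPos (c : ℝ) (a : Fin 3) : Matrix (Fin 4) (Fin 4) ℝ :=
  (1 / 2 : ℝ) • (jac c a + jacAbs c a)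

/-- The negative part `J_a⁻` of the Jacobian. -/
def jacNeg (c : ℝ) (a : Fin 3) : Matrix (Fin 4) (Fin 4) ℝ :=
  (1 / 2 : ℝ) • (jac c a - jacAbs c a)

/-- An eigenvector matrix of `J_a`, with integer entries. -/
def eigMat (a : Fin 3) : Matrix (Fin 4) (Fin 4) ℤ :=
  Matrix.of fun l m => if l = 3 ∧ m = 3 then -1 else
    if l = m ∨ (l = a.castSucc ∧ m = 3) ∨ (l = 3 ∧ m = a.castSucc) then 1 else 0

/-- The corresponding eigenvalues, divided by `c`. -/
def eigVal (a : Fin 3) : Fin 4 → ℤ :=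
  fun l => if l = a.castSucc then 1 else if l = 3 then -1 else 0

theorem eigMat_spec : ∀ a : Fin 3,
    (eigMat a * eigMat a = Matrix.diagonal fun l => if l = a.castSucc ∨ l = 3 then 2 else 1) ∧
    (Matrix.of fun l m => if (l = a.castSucc ∧ m = 3) ∨ (l = 3 ∧ m = a.castSucc)
      then (1 : ℤ) else 0) * eigMat a = eigMat a * Matrix.diagonal (eigVal a) ∧
    (Matrix.diagonal fun l => if l = a.castSucc ∨ l = 3 then (1 : ℤ) else 0) * eigMat a =
      eigMat a * Matrix.diagonal (fun l => |eigVal a l|) := by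
  decide

/-- `jacPos` and `jacNeg` are the parts `R diag(λ^±) R⁻¹` of `J_a = R diag(λ) R⁻¹`. -/
theorem jac_splitting (c : ℝ) (hc : 0 < c) (a : Fin 3) :
    ∃ (R : Matrix (Fin 4) (Fin 4) ℝ) (ev : Fin 4 → ℝ), IsUnit R.det ∧
      jac c a = R * Matrix.diagonal ev * R⁻¹ ∧
      jacPos c a = R * Matrix.diagonal (fun l => max (ev l) 0) * R⁻¹ ∧
      jacNeg c a = R * Matrix.diagonal (fun l => min (ev l) 0) * R⁻¹ := by
  obtain ⟨z1, z2, z3⟩ := eigMat_spec a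
  set R : Matrix (Fin 4) (Fin 4) ℝ := (eigMat a).map (Int.castRingHom ℝ) with hR
  have r1 := congrArg (fun M => M.map (Int.castRingHom ℝ)) z1
  have r2 := congrArg (fun M => c • M.map (Int.castRingHom ℝ)) z2
  have r3 := congrArg (fun M => c • M.map (Int.castRingHom ℝ)) z3
  simp only [Matrix.map_mul, ← hR] at r1 r2 r3
  have hJ : jac c a * R = R * Matrix.diagonal fun l => c * (eigVal a l : ℝ) := by
    convert r2 using 1
    · rw [← Matrix.smul_mul]
      congr 1
      ext i j
      simp [jac]
    · rw [← Matrix.mul_smul]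
      congr 1
      ext i j
      simp [Matrix.diagonal_apply]
  have hA : jacAbs c a * R = R * Matrix.diagonal fun l => |c * (eigVal a l : ℝ)| := by
    convert r3 using 1
    · rw [← Matrix.smul_mul]
      congr 1
      ext i j
      simp [jacAbs, Matrix.diagonal_apply]
    · rw [← Matrix.mul_smul]
      congr 1
      ext i j
      simp [Matrix.diagonal_apply, abs_mul, abs_of_pos hc]
  have hu : IsUnit R.det := by
    rw [isUnit_iff_ne_zero]
    intro h0
    have h1 := congrArg Matrix.det r1
    rw [Matrix.det_mul, h0, Matrix.diagonal_map (map_zero _), Matrix.det_diagonal, zero_mul] at h1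
    refine Finset.prod_ne_zero_iff.mpr (fun l _ => ?_) h1.symm
    split_ifs <;> norm_num
  have key : ∀ M N : Matrix (Fin 4) (Fin 4) ℝ, M * R = R * N → M = R * N * R⁻¹ := by
    intro M N h
    rw [← h, Matrix.mul_assoc, Matrix.mul_nonsing_inv _ hu, Matrix.mul_one]
  refine ⟨R, fun l => c * (eigVal a l : ℝ), hu, key _ _ hJ, key _ _ ?_, key _ _ ?_⟩
  · rw [jacPos, Matrix.smul_mul, Matrix.add_mul, hJ, hA, ← Matrix.mul_add, ← Matrix.mul_smul]
    congr 1
    ext i j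
    by_cases h : i = j
    · subst h
      simp only [Matrix.smul_apply, Matrix.add_apply, Matrix.diagonal_apply_eq, smul_eq_mul]
      generalize c * (eigVal a i : ℝ) = y
      rcases le_total y 0 with h0 | h0
      · rw [abs_of_nonpos h0, max_eq_right h0]; ring
      · rw [abs_of_nonneg h0, max_eq_left h0]; ring
    · simp [h]
  · rw [jacNeg, Matrix.smul_mul, Matrix.sub_mul, hJ, hA, ← Matrix.mul_sub, ← Matrix.mul_smul]
    congr 1
    ext i j
    by_cases h : i = j
    · subst h
      simp only [Matrix.smul_apply, Matrix.sub_apply, Matrix.diagonal_apply_eq, smul_eq_mul]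
      generalize c * (eigVal a i : ℝ) = y
      rcases le_total y 0 with h0 | h0
      · rw [abs_of_nonpos h0, min_eq_left h0]; ring
      · rw [abs_of_nonneg h0, min_eq_right h0]; ring
    · simp [h]

/-- The symbol `𝐉·𝐤`. -/
def acousticSymbol (c : ℝ) (k : Fin 3 → ℝ) : Matrix (Fin 4) (Fin 4) ℂ :=
  (∑ a, k a • jac c a).map Complex.ofReal

/-! ### Degrees of freedom -/

/-- The degrees of freedom belonging to a cell: the average `A`, the midpoints `E_a` of edges
parallel to the axis `a`, the midpoints `F_a` of faces orthogonal to the axis `a`, the node `N`. -/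
inductive Dof
  | A | Ex | Ey | Ez | Fx | Fy | Fz | N
  deriving DecidableEq

instance : Fintype Dof where
  elems := {.A, .Ex, .Ey, .Ez, .Fx, .Fy, .Fz, .N}
  complete X := by cases X <;> decide

/-- The `27` degrees of freedom accessible to a cell. In each direction `0, 1, 2` stand for the
left end, the midpoint and the right end; `(1, 1, 1)` stands for the cell average, the others for
the point values. -/
abbrev Loc := Fin 3 → Fin 3

/-- The index of the cell average. -/
def centre : Loc := fun _ => 1

/-- The place of the degrees of freedom that belong to the cell. -/
def Dof.loc : Dof → Loc
  | .A => ![1, 1, 1]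
  | .Ex => ![1, 2, 2]
  | .Ey => ![2, 1, 2]
  | .Ez => ![2, 2, 1]
  | .Fx => ![2, 1, 1]
  | .Fy => ![1, 2, 1]
  | .Fz => ![1, 1, 2]
  | .N => ![2, 2, 2]

/-- The kind of an accessible degree of freedom. -/
def kind (r : Loc) : Dof :=
  match decide (r 0 = 1), decide (r 1 = 1), decide (r 2 = 1) with
  | true, true, true => .A
  | true, false, false => .Ex
  | false, true, false => .Ey
  | false, false, true => .Ez
  | false, true, true => .Fx
  | true, false, true => .Fy
  | true, true, false => .Fz
  | false, false, false => .N

/-- The index shift to the cell that an accessible degree of freedom belongs to. -/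
def shift (r : Loc) : Fin 3 → ℤ := fun a => if r a = 0 then -1 else 0

theorem kind_loc (X : Dof) : kind X.loc = X := by cases X <;> decide

theorem shift_loc (X : Dof) : shift X.loc = 0 := by cases X <;> decide

/-- The data of a semi-discrete Active Flux method at one instant: the degrees of freedom
belonging to each cell, each with `4` components. -/
abbrev Data := (Fin 3 → ℤ) → Dof → Fin 4 → ℂ

/-- The value of the degree of freedom `r` accessible to the cell `I`. -/
def accessible (q : Data) (I : Fin 3 → ℤ) (r : Loc) : Fin 4 → ℂ := q (I + shift r) (kind r)

/-- The coordinates of `r` relative to the cell centre. -/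
def relPos (Δ : Fin 3 → ℝ) (r : Loc) : Fin 3 → ℝ :=
  fun a => (![-1 / 2, 0, 1 / 2] : Fin 3 → ℝ) (r a) * Δ a

/-! ### The triparabolic reconstruction -/

/-- The quadratic Lagrange polynomials to the nodes `-Δ_a / 2, 0, Δ_a / 2` in the variable `a`. -/
def lagrange (Δ : Fin 3 → ℝ) (a : Fin 3) : Fin 3 → MvPolynomial (Fin 3) ℂ :=
  let ξ : MvPolynomial (Fin 3) ℂ := MvPolynomial.C ((Δ a : ℂ)⁻¹) * MvPolynomial.X a
  ![ξ * (2 * ξ - 1), 1 - 4 * ξ ^ 2, ξ * (2 * ξ + 1)]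

/-- The weights of Simpson's rule on an interval of length one. -/
def simpson : Fin 3 → ℝ := ![1 / 6, 4 / 6, 1 / 6]

/-- The shape functions `B_r` in `P^{2,2,2}`. -/
def shape (Δ : Fin 3 → ℝ) (r : Loc) : MvPolynomial (Fin 3) ℂ :=
  if r = centre then MvPolynomial.C (27 / 8) * ∏ a, lagrange Δ a 1
  else (∏ a, lagrange Δ a (r a)) -
    MvPolynomial.C (27 / 8 * ((∏ a, simpson (r a) : ℝ) : ℂ)) * ∏ a, lagrange Δ a 1

/-- The reconstruction in a cell (in coordinates relative to its centre) from the values of the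
accessible degrees of freedom. -/
def recon (Δ : Fin 3 → ℝ) (d : Loc → ℂ) : MvPolynomial (Fin 3) ℂ :=
  ∑ r, MvPolynomial.C (d r) * shape Δ r

/-- Evaluation of a polynomial at a real point. -/
def evalAt (x : Fin 3 → ℝ) (f : MvPolynomial (Fin 3) ℂ) : ℂ :=
  MvPolynomial.eval (fun a => (x a : ℂ)) f

theorem lagrange_degreeOf (Δ : Fin 3 → ℝ) (a b : Fin 3) (i : Fin 3) :
    (lagrange Δ b i).degreeOf a ≤ if a = b then 2 else 0 := by
  have hξ : (MvPolynomial.C ((Δ b : ℂ)⁻¹) * MvPolynomial.X b :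
      MvPolynomial (Fin 3) ℂ).degreeOf a ≤ if a = b then 1 else 0 := by
    refine (MvPolynomial.degreeOf_C_mul_le _ _ _).trans ?_
    rw [MvPolynomial.degreeOf_X]
  have hn : ∀ m : ℕ, ((m : MvPolynomial (Fin 3) ℂ)).degreeOf a = 0 := fun m => by
    rw [← map_natCast (MvPolynomial.C : ℂ →+* MvPolynomial (Fin 3) ℂ)]
    exact MvPolynomial.degreeOf_C _ _
  have h2 := hn 2
  have h4 := hn 4
  have h1 := hn 1
  push_cast at h1 h2 h4
  set ξ : MvPolynomial (Fin 3) ℂ := MvPolynomial.C ((Δ b : ℂ)⁻¹) * MvPolynomial.X b with hdef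
  have h2ξ : (2 * ξ).degreeOf a ≤ if a = b then 1 else 0 :=
    (MvPolynomial.degreeOf_mul_le _ _ _).trans (by rw [h2]; simpa using hξ)
  have hm : (2 * ξ - 1).degreeOf a ≤ if a = b then 1 else 0 :=
    (MvPolynomial.degreeOf_sub_le _ _ _).trans (by rw [h1]; simpa using h2ξ)
  have hp : (2 * ξ + 1).degreeOf a ≤ if a = b then 1 else 0 :=
    (MvPolynomial.degreeOf_add_le _ _ _).trans (by rw [h1]; simpa using h2ξ)
  have hsq : (4 * ξ ^ 2).degreeOf a ≤ if a = b then 2 else 0 := by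
    refine (MvPolynomial.degreeOf_mul_le _ _ _).trans ?_
    have := MvPolynomial.degreeOf_pow_le a ξ 2
    rw [h4]
    split_ifs at * <;> omega
  fin_cases i
  · refine (MvPolynomial.degreeOf_mul_le a ξ (2 * ξ - 1)).trans ?_
    split_ifs at * <;> omega
  · refine (MvPolynomial.degreeOf_sub_le a 1 (4 * ξ ^ 2)).trans ?_
    rw [h1]
    split_ifs at * <;> omega
  · refine (MvPolynomial.degreeOf_mul_le a ξ (2 * ξ + 1)).trans ?_
    split_ifs at * <;> omega

theorem lagrange_prod_degreeOf (Δ : Fin 3 → ℝ) (a : Fin 3) (r : Loc) :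
    (∏ b, lagrange Δ b (r b)).degreeOf a ≤ 2 := by
  refine (MvPolynomial.degreeOf_prod_le _ _ _).trans ?_
  refine (Finset.sum_le_sum fun b _ => lagrange_degreeOf Δ a b (r b)).trans ?_
  simp

/-- The reconstruction lies in `P^{2,2,2}`. -/
theorem recon_degreeOf (Δ : Fin 3 → ℝ) (d : Loc → ℂ) (a : Fin 3) :
    (recon Δ d).degreeOf a ≤ 2 := by
  refine (MvPolynomial.degreeOf_sum_le _ _ _).trans (Finset.sup_le fun r _ => ?_)
  refine (MvPolynomial.degreeOf_C_mul_le _ _ _).trans ?_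
  unfold shape
  split_ifs
  · exact (MvPolynomial.degreeOf_C_mul_le _ _ _).trans (lagrange_prod_degreeOf Δ a centre)
  · refine (MvPolynomial.degreeOf_sub_le _ _ _).trans (max_le (lagrange_prod_degreeOf Δ a r) ?_)
    exact (MvPolynomial.degreeOf_C_mul_le _ _ _).trans (lagrange_prod_degreeOf Δ a centre)

theorem lagrange_node (Δ : Fin 3 → ℝ) (hΔ : ∀ a, 0 < Δ a) (a i : Fin 3) (r : Loc) :
    evalAt (relPos Δ r) (lagrange Δ a i) = if r a = i then 1 else 0 := by
  have h : (Δ a : ℂ) ≠ 0 := by exact_mod_cast (hΔ a).ne'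
  have h3 : ∀ j : Fin 3, j = 0 ∨ j = 1 ∨ j = 2 := by decide
  rcases h3 (r a) with hr | hr | hr <;> rcases h3 i with hi | hi | hi <;>
    simp [evalAt, lagrange, relPos, hr, hi] <;> field_simp <;> norm_num

theorem lagrange_prod_node (Δ : Fin 3 → ℝ) (hΔ : ∀ a, 0 < Δ a) (r s : Loc) :
    evalAt (relPos Δ r) (∏ a, lagrange Δ a (s a)) = if r = s then 1 else 0 := by
  have h : evalAt (relPos Δ r) (∏ a, lagrange Δ a (s a)) =
      ∏ a, evalAt (relPos Δ r) (lagrange Δ a (s a)) := map_prod _ _ _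
  rw [h]
  simp only [lagrange_node Δ hΔ]
  split_ifs with hrs
  · subst hrs; simp
  · obtain ⟨a, ha⟩ := Function.ne_iff.mp hrs
    exact Finset.prod_eq_zero (Finset.mem_univ a) (if_neg ha)

/-- The reconstruction interpolates the point values. -/
theorem recon_pointValue (Δ : Fin 3 → ℝ) (hΔ : ∀ a, 0 < Δ a) (d : Loc → ℂ) (r : Loc)
    (hr : r ≠ centre) : evalAt (relPos Δ r) (recon Δ d) = d r := by
  have hc := lagrange_prod_node Δ hΔ r centre
  have hs : ∀ s, evalAt (relPos Δ r) (shape Δ s) = if r = s then 1 else 0 := by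
    intro s
    have h1 := lagrange_prod_node Δ hΔ r s
    unfold shape
    by_cases h : s = centre
    · subst h
      rw [if_neg hr] at hc ⊢
      simp only [centre, evalAt, if_true, map_mul] at hc ⊢
      rw [hc, mul_zero]
    · rw [if_neg h]
      rw [if_neg hr] at hc
      simp only [centre, evalAt, map_mul, map_sub] at hc h1 ⊢
      rw [hc, mul_zero, sub_zero, h1]
  have h : evalAt (relPos Δ r) (recon Δ d) = ∑ s, d s * evalAt (relPos Δ r) (shape Δ s) := by
    simp [recon, evalAt]
  rw [h]
  simp [hs]

theorem lagrange_integral (t : ℝ) (ht : 0 < t) (f : Fin 3 → ℝ → ℂ)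
    (h0 : ∀ x : ℝ, f 0 x = (t : ℂ)⁻¹ * x * (2 * ((t : ℂ)⁻¹ * x) - 1))
    (h1 : ∀ x : ℝ, f 1 x = 1 - 4 * ((t : ℂ)⁻¹ * x) ^ 2)
    (h2 : ∀ x : ℝ, f 2 x = (t : ℂ)⁻¹ * x * (2 * ((t : ℂ)⁻¹ * x) + 1)) (i : Fin 3) :
    ∫ x in (-t / 2)..(t / 2), f i x = t * (simpson i : ℂ) := by
  have ht' : t ≠ 0 := ht.ne'
  have e : ∀ p q s : ℝ, ∫ x in (-t / 2)..(t / 2), ((p + q * x + s * x ^ 2 : ℝ) : ℂ) =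
      ((p * t + s * t ^ 3 / 12 : ℝ) : ℂ) := by
    intro p q s
    rw [intervalIntegral.integral_ofReal]
    congr 1
    rw [intervalIntegral.integral_add (by apply Continuous.intervalIntegrable; fun_prop)
      (by apply Continuous.intervalIntegrable; fun_prop),
      intervalIntegral.integral_add (by apply Continuous.intervalIntegrable; fun_prop)
      (by apply Continuous.intervalIntegrable; fun_prop)]
    rw [intervalIntegral.integral_const_mul, intervalIntegral.integral_const_mul, integral_id,
      integral_pow, intervalIntegral.integral_const, smul_eq_mul]
    push_cast
    ring
  have h3 : ∀ j : Fin 3, j = 0 ∨ j = 1 ∨ j = 2 := by decide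
  rcases h3 i with hi | hi | hi <;> subst hi
  · have : f 0 = fun x : ℝ => ((0 + (-t⁻¹) * x + 2 * t⁻¹ ^ 2 * x ^ 2 : ℝ) : ℂ) := by
      funext x; rw [h0]; push_cast; ring
    rw [this, e]; simp only [simpson]; push_cast
    have : (t : ℂ) ≠ 0 := by exact_mod_cast ht'
    simp; field_simp; norm_num
  · have : f 1 = fun x : ℝ => ((1 + 0 * x + (-4 * t⁻¹ ^ 2) * x ^ 2 : ℝ) : ℂ) := by
      funext x; rw [h1]; push_cast; ring
    rw [this, e]; simp only [simpson]; push_cast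
    have : (t : ℂ) ≠ 0 := by exact_mod_cast ht'
    simp; field_simp; norm_num
  · have : f 2 = fun x : ℝ => ((0 + t⁻¹ * x + 2 * t⁻¹ ^ 2 * x ^ 2 : ℝ) : ℂ) := by
      funext x; rw [h2]; push_cast; ring
    rw [this, e]; simp only [simpson]; push_cast
    have : (t : ℂ) ≠ 0 := by exact_mod_cast ht'
    simp; field_simp; norm_num

/-- The reconstruction has the prescribed average. -/
theorem recon_average (Δ : Fin 3 → ℝ) (hΔ : ∀ a, 0 < Δ a) (d : Loc → ℂ) :
    ((Δ 0 * Δ 1 * Δ 2 : ℝ) : ℂ)⁻¹ *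
      ∫ x in (-Δ 0 / 2)..(Δ 0 / 2), ∫ y in (-Δ 1 / 2)..(Δ 1 / 2), ∫ z in (-Δ 2 / 2)..(Δ 2 / 2),
        evalAt ![x, y, z] (recon Δ d) = d centre := by
  set c : Loc → Loc → ℂ := fun r s =>
    if r = centre then (if s = centre then 27 / 8 else 0)
    else (if s = r then 1 else 0) -
      (if s = centre then 27 / 8 * ((∏ a, simpson (r a) : ℝ) : ℂ) else 0) with hc
  set f : Fin 3 → Fin 3 → ℝ → ℂ := fun a => ![
    fun x => (Δ a : ℂ)⁻¹ * x * (2 * ((Δ a : ℂ)⁻¹ * x) - 1),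
    fun x => 1 - 4 * ((Δ a : ℂ)⁻¹ * x) ^ 2,
    fun x => (Δ a : ℂ)⁻¹ * x * (2 * ((Δ a : ℂ)⁻¹ * x) + 1)] with hf
  have h3 : ∀ j : Fin 3, j = 0 ∨ j = 1 ∨ j = 2 := by decide
  have hcont : ∀ a i, Continuous (f a i) := by
    intro a i
    rcases h3 i with hi | hi | hi <;> subst hi <;> simp only [hf] <;>
      simp <;> fun_prop
  have hint : ∀ a i, ∫ x in (-Δ a / 2)..(Δ a / 2), f a i x = Δ a * (simpson i : ℂ) :=
    fun a i => lagrange_integral (Δ a) (hΔ a) (f a) (fun _ => rfl) (fun _ => rfl) (fun _ => rfl) i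
  have hT : ∀ (x y z : ℝ) (s : Loc), evalAt ![x, y, z] (∏ a, lagrange Δ a (s a)) =
      f 0 (s 0) x * f 1 (s 1) y * f 2 (s 2) z := by
    intro x y z s
    have hl : ∀ a i, evalAt ![x, y, z] (lagrange Δ a i) = f a i (![x, y, z] a) := by
      intro a i
      rcases h3 i with hi | hi | hi <;> subst hi <;> simp [evalAt, lagrange, hf]
    have : evalAt ![x, y, z] (∏ a, lagrange Δ a (s a)) =
        ∏ a, evalAt ![x, y, z] (lagrange Δ a (s a)) := map_prod _ _ _
    rw [this, Fin.prod_univ_three, hl, hl, hl]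
    rfl
  have hshape : ∀ (v : Fin 3 → ℝ) (r : Loc), evalAt v (shape Δ r) =
      ∑ s, c r s * evalAt v (∏ a, lagrange Δ a (s a)) := by
    intro v r
    by_cases hr : r = centre
    · simp [hc, shape, hr, evalAt, centre]
    · simp [hc, shape, hr, evalAt, centre, sub_mul, Finset.sum_sub_distrib]
  have hrec : ∀ x y z : ℝ, evalAt ![x, y, z] (recon Δ d) =
      ∑ s : Loc, (∑ r, d r * c r s) * (f 0 (s 0) x * f 1 (s 1) y * f 2 (s 2) z) := by
    intro x y z
    have h : evalAt ![x, y, z] (recon Δ d) =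
        ∑ r, d r * evalAt ![x, y, z] (shape Δ r) := by simp [recon, evalAt]
    rw [h]
    simp only [hshape, hT, Finset.mul_sum, Finset.sum_mul]
    rw [Finset.sum_comm]
    exact Finset.sum_congr rfl fun _ _ => Finset.sum_congr rfl fun _ _ => by ring
  have hw : ∀ r, ∑ s : Loc, c r s * ((∏ a, simpson (s a) : ℝ) : ℂ) =
      if r = centre then 1 else 0 := by
    intro r
    by_cases hr : r = centre
    · simp [hc, hr, centre, simpson]; norm_num
    · simp [hc, hr, sub_mul, Finset.sum_sub_distrib]
      simp [centre, simpson]; ring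
  have hz : ∀ x y : ℝ, ∫ z in (-Δ 2 / 2)..(Δ 2 / 2), evalAt ![x, y, z] (recon Δ d) =
      ∑ s : Loc, (∑ r, d r * c r s) * (f 0 (s 0) x * f 1 (s 1) y * (Δ 2 * (simpson (s 2) : ℂ))) := by
    intro x y
    simp only [hrec]
    rw [intervalIntegral.integral_finsetSum fun s _ => by
      have := hcont 2 (s 2)
      apply Continuous.intervalIntegrable
      fun_prop]
    refine Finset.sum_congr rfl fun s _ => ?_
    rw [intervalIntegral.integral_const_mul, intervalIntegral.integral_const_mul, hint]
  have hy : ∀ x : ℝ, ∫ y in (-Δ 1 / 2)..(Δ 1 / 2), ∫ z in (-Δ 2 / 2)..(Δ 2 / 2),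
      evalAt ![x, y, z] (recon Δ d) = ∑ s : Loc, (∑ r, d r * c r s) *
        (f 0 (s 0) x * (Δ 1 * (simpson (s 1) : ℂ)) * (Δ 2 * (simpson (s 2) : ℂ))) := by
    intro x
    simp only [hz]
    rw [intervalIntegral.integral_finsetSum fun s _ => by
      have := hcont 1 (s 1)
      apply Continuous.intervalIntegrable
      fun_prop]
    refine Finset.sum_congr rfl fun s _ => ?_
    rw [intervalIntegral.integral_const_mul, intervalIntegral.integral_mul_const,
      intervalIntegral.integral_const_mul, hint]
  simp only [hy]
  rw [intervalIntegral.integral_finsetSum fun s _ => by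
    have := hcont 0 (s 0)
    apply Continuous.intervalIntegrable
    fun_prop]
  have hx : ∀ s : Loc, ∫ x in (-Δ 0 / 2)..(Δ 0 / 2), (∑ r, d r * c r s) *
        (f 0 (s 0) x * (Δ 1 * (simpson (s 1) : ℂ)) * (Δ 2 * (simpson (s 2) : ℂ))) =
      ((Δ 0 * Δ 1 * Δ 2 : ℝ) : ℂ) *
        ∑ r, d r * (c r s * ((∏ a, simpson (s a) : ℝ) : ℂ)) := by
    intro s
    rw [intervalIntegral.integral_const_mul, intervalIntegral.integral_mul_const,
      intervalIntegral.integral_mul_const, hint, Fin.prod_univ_three, Finset.sum_mul,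
      Finset.mul_sum]
    push_cast
    exact Finset.sum_congr rfl fun _ _ => by ring
  simp only [hx]
  rw [← Finset.mul_sum, ← mul_assoc, inv_mul_cancel₀, one_mul, Finset.sum_comm]
  · simp only [← Finset.mul_sum, hw]
    simp
  · exact_mod_cast (mul_pos (mul_pos (hΔ 0) (hΔ 1)) (hΔ 2)).ne'

/-! ### The semi-discrete method -/

/-- The component `l` of the reconstruction in the cell `I`. -/
def cellRecon (Δ : Fin 3 → ℝ) (q : Data) (I : Fin 3 → ℤ) (l : Fin 4) : MvPolynomial (Fin 3) ℂ :=
  recon Δ fun r => accessible q I r l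

/-- The difference formula `D_a`: the derivative at the place of `P`, taken in the cell `I`. -/
def diff (Δ : Fin 3 → ℝ) (a : Fin 3) (q : Data) (I : Fin 3 → ℤ) (P : Dof) (l : Fin 4) : ℂ :=
  evalAt (relPos Δ P.loc) (MvPolynomial.pderiv a (cellRecon Δ q I l))

/-- The difference formula `D_a^*`: if `P` lies on the face between `I` and its neighbour in
direction `a`, the derivative at the place of `P` is taken in that neighbour. -/
def diffStar (Δ : Fin 3 → ℝ) (a : Fin 3) (q : Data) (I : Fin 3 → ℤ) (P : Dof) (l : Fin 4) : ℂ :=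
  if P.loc a = 2 then
    evalAt (relPos Δ P.loc - Pi.single a (Δ a))
      (MvPolynomial.pderiv a (cellRecon Δ q (I + Pi.single a 1) l))
  else diff Δ a q I P l

/-- The numerical flux through the face between `I` and its neighbour in direction `a`: Simpson's
rule in both tangential directions, applied to the point values on that face. -/
def numFlux (c : ℝ) (a : Fin 3) (q : Data) (I : Fin 3 → ℤ) : Fin 4 → ℂ :=
  ∑ r : Loc with r a = 2,
    ((∏ b ∈ Finset.univ.erase a, simpson (r b) : ℝ) : ℂ) •
      ((jac c a).map Complex.ofReal).mulVec (accessible q I r)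

/-- The spatial operator `L` of the semi-discrete method `dq/dt + L q = 0` with upwind splitting
of the Jacobians. -/
def spatialOp (c : ℝ) (Δ : Fin 3 → ℝ) (q : Data) : Data := fun I X =>
  if X = .A then
    ∑ a, ((Δ a : ℂ)⁻¹) • (numFlux c a q I - numFlux c a q (I - Pi.single a 1))
  else
    ∑ a, (((jacPos c a).map Complex.ofReal).mulVec (diff Δ a q I X) +
      ((jacNeg c a).map Complex.ofReal).mulVec (diffStar Δ a q I X))

/-! ### Discrete Fourier transform and stationarity preservation -/

/-- The translation factors `t_a = exp(i k_a Δ_a)`. -/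
def transl (Δ : Fin 3 → ℝ) (k : Fin 3 → ℝ) (a : Fin 3) : ℂ :=
  Complex.exp (Complex.I * (k a * Δ a : ℝ))

/-- The discrete Fourier mode with wave vector `k` and amplitude `qhat`. -/
def fourierMode (Δ k : Fin 3 → ℝ) (qhat : Dof × Fin 4 → ℂ) : Data :=
  fun I X l => (∏ a, transl Δ k a ^ I a) * qhat (X, l)

/-- The evolution matrix `𝓔(k)`: its columns are the Fourier transforms of the images under `L`
of the Fourier modes whose amplitudes are the standard basis vectors. -/
def evolutionMatrix (c : ℝ) (Δ k : Fin 3 → ℝ) : Matrix (Dof × Fin 4) (Dof × Fin 4) ℂ :=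
  Matrix.of fun i j => spatialOp c Δ (fourierMode Δ k (Pi.single j 1)) 0 i.1 i.2

theorem recon_add (Δ : Fin 3 → ℝ) (d e : Loc → ℂ) :
    recon Δ (d + e) = recon Δ d + recon Δ e := by
  simp [recon, add_mul, Finset.sum_add_distrib]

theorem recon_smul (Δ : Fin 3 → ℝ) (s : ℂ) (d : Loc → ℂ) :
    recon Δ (s • d) = s • recon Δ d := by
  simp [recon, Finset.smul_sum, MvPolynomial.C_mul']

theorem cellRecon_add (Δ : Fin 3 → ℝ) (q q' : Data) (I : Fin 3 → ℤ) (l : Fin 4) :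
    cellRecon Δ (q + q') I l = cellRecon Δ q I l + cellRecon Δ q' I l :=
  recon_add Δ _ _

theorem cellRecon_smul (Δ : Fin 3 → ℝ) (s : ℂ) (q : Data) (I : Fin 3 → ℤ) (l : Fin 4) :
    cellRecon Δ (s • q) I l = s • cellRecon Δ q I l :=
  recon_smul Δ _ _

theorem evalAt_add (x : Fin 3 → ℝ) (f g : MvPolynomial (Fin 3) ℂ) :
    evalAt x (f + g) = evalAt x f + evalAt x g := map_add _ _ _

theorem evalAt_smul (x : Fin 3 → ℝ) (s : ℂ) (f : MvPolynomial (Fin 3) ℂ) :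
    evalAt x (s • f) = s * evalAt x f := MvPolynomial.smul_eval _ _ _

theorem diff_add (Δ : Fin 3 → ℝ) (a : Fin 3) (q q' : Data) (I : Fin 3 → ℤ) (P : Dof) :
    diff Δ a (q + q') I P = diff Δ a q I P + diff Δ a q' I P := by
  ext l; simp [diff, cellRecon_add, evalAt_add]

theorem diff_smul (Δ : Fin 3 → ℝ) (a : Fin 3) (s : ℂ) (q : Data) (I : Fin 3 → ℤ) (P : Dof) :
    diff Δ a (s • q) I P = s • diff Δ a q I P := by
  ext l; simp [diff, cellRecon_smul, evalAt_smul]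

theorem diffStar_add (Δ : Fin 3 → ℝ) (a : Fin 3) (q q' : Data) (I : Fin 3 → ℤ) (P : Dof) :
    diffStar Δ a (q + q') I P = diffStar Δ a q I P + diffStar Δ a q' I P := by
  ext l
  by_cases h : P.loc a = 2 <;> simp [diffStar, diff_add, h, cellRecon_add, evalAt_add]

theorem diffStar_smul (Δ : Fin 3 → ℝ) (a : Fin 3) (s : ℂ) (q : Data) (I : Fin 3 → ℤ) (P : Dof) :
    diffStar Δ a (s • q) I P = s • diffStar Δ a q I P := by
  ext l
  by_cases h : P.loc a = 2 <;> simp [diffStar, diff_smul, h, cellRecon_smul, evalAt_smul]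

theorem accessible_add (q q' : Data) (I : Fin 3 → ℤ) (r : Loc) :
    accessible (q + q') I r = accessible q I r + accessible q' I r := rfl

theorem accessible_smul (s : ℂ) (q : Data) (I : Fin 3 → ℤ) (r : Loc) :
    accessible (s • q) I r = s • accessible q I r := rfl

theorem numFlux_add (c : ℝ) (a : Fin 3) (q q' : Data) (I : Fin 3 → ℤ) :
    numFlux c a (q + q') I = numFlux c a q I + numFlux c a q' I := by
  simp only [numFlux, accessible_add, Matrix.mulVec_add, smul_add, Finset.sum_add_distrib]

theorem numFlux_smul (c : ℝ) (a : Fin 3) (s : ℂ) (q : Data) (I : Fin 3 → ℤ) :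
    numFlux c a (s • q) I = s • numFlux c a q I := by
  simp only [numFlux, accessible_smul, Matrix.mulVec_smul, Finset.smul_sum]
  exact Finset.sum_congr rfl fun _ _ => smul_comm _ _ _

theorem spatialOp_add (c : ℝ) (Δ : Fin 3 → ℝ) (q q' : Data) :
    spatialOp c Δ (q + q') = spatialOp c Δ q + spatialOp c Δ q' := by
  funext I X
  simp only [spatialOp, Pi.add_apply]
  split_ifs
  · rw [← Finset.sum_add_distrib]
    refine Finset.sum_congr rfl fun _ _ => ?_
    rw [numFlux_add, numFlux_add, ← smul_add]
    congr 1
    abel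
  · rw [← Finset.sum_add_distrib]
    refine Finset.sum_congr rfl fun _ _ => ?_
    rw [diff_add, diffStar_add, Matrix.mulVec_add, Matrix.mulVec_add]
    abel

theorem spatialOp_smul (c : ℝ) (Δ : Fin 3 → ℝ) (s : ℂ) (q : Data) :
    spatialOp c Δ (s • q) = s • spatialOp c Δ q := by
  funext I X
  simp only [spatialOp, Pi.smul_apply]
  split_ifs
  · rw [Finset.smul_sum]
    refine Finset.sum_congr rfl fun _ _ => ?_
    rw [numFlux_smul, numFlux_smul, ← smul_sub, smul_comm]
  · rw [Finset.smul_sum]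
    refine Finset.sum_congr rfl fun _ _ => ?_
    rw [diff_smul, diffStar_smul, Matrix.mulVec_smul, Matrix.mulVec_smul, smul_add]

theorem spatialOp_translate (c : ℝ) (Δ : Fin 3 → ℝ) (q : Data) (I : Fin 3 → ℤ) :
    spatialOp c Δ q I = spatialOp c Δ (fun J => q (I + J)) 0 := by
  have h1 : ∀ J l, cellRecon Δ q (I + J) l = cellRecon Δ (fun J => q (I + J)) J l := by
    intro J l
    simp only [cellRecon, accessible, add_assoc]
  have h2 : ∀ a J, numFlux c a q (I + J) = numFlux c a (fun J => q (I + J)) J := by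
    intro a J
    simp only [numFlux, accessible, add_assoc]
  have h3 : ∀ a X, diff Δ a q I X = diff Δ a (fun J => q (I + J)) 0 X := by
    intro a X
    funext l
    rw [diff, diff, ← h1, add_zero]
  have h4 : ∀ a X, diffStar Δ a q I X = diffStar Δ a (fun J => q (I + J)) 0 X := by
    intro a X
    funext l
    rw [diffStar, diffStar, ← h1, zero_add, h3]
  funext X
  simp only [spatialOp, sub_eq_add_neg, h3, h4, ← h2, add_zero, zero_add]

theorem fourierMode_translate (Δ k : Fin 3 → ℝ) (qhat : Dof × Fin 4 → ℂ) (I : Fin 3 → ℤ) :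
    (fun J => fourierMode Δ k qhat (I + J)) =
      (∏ a, transl Δ k a ^ I a) • fourierMode Δ k qhat := by
  funext J X l
  have h : ∀ a, transl Δ k a ≠ 0 := fun a => Complex.exp_ne_zero _
  simp only [fourierMode, Pi.smul_apply, Pi.add_apply, smul_eq_mul, zpow_add₀ (h _),
    Finset.prod_mul_distrib]
  ring

/-- On Fourier modes the semi-discrete method reads `dq̂/dt + 𝓔(k) q̂ = 0`. -/
theorem spatialOp_fourierMode (c : ℝ) (Δ k : Fin 3 → ℝ) (qhat : Dof × Fin 4 → ℂ) :
    spatialOp c Δ (fourierMode Δ k qhat) =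
      fourierMode Δ k ((evolutionMatrix c Δ k).mulVec qhat) := by
  have h0 : ∀ (v : Dof × Fin 4 → ℂ) (X : Dof) (l : Fin 4),
      spatialOp c Δ (fourierMode Δ k v) 0 X l = (evolutionMatrix c Δ k).mulVec v (X, l) := by
    intro v X l
    let L : (Dof × Fin 4 → ℂ) →ₗ[ℂ] ℂ :=
      { toFun := fun v => spatialOp c Δ (fourierMode Δ k v) 0 X l
        map_add' := fun v w => by
          have : fourierMode Δ k (v + w) = fourierMode Δ k v + fourierMode Δ k w := by
            funext I X l; simp [fourierMode, mul_add]
          rw [this, spatialOp_add]; rfl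
        map_smul' := fun s v => by
          have : fourierMode Δ k (s • v) = s • fourierMode Δ k v := by
            funext I X l; simp [fourierMode]; ring
          rw [this, spatialOp_smul]; rfl }
    have hL : L v = ∑ j, v j * L (Pi.single j 1) := by
      conv_lhs => rw [pi_eq_sum_univ' v, map_sum]
      exact Finset.sum_congr rfl fun j _ => by rw [map_smul, smul_eq_mul]
    change L v = _
    rw [hL]
    simp only [Matrix.mulVec, dotProduct, evolutionMatrix, Matrix.of_apply]
    exact Finset.sum_congr rfl fun j _ => mul_comm _ _
  funext I X l
  rw [spatialOp_translate, fourierMode_translate, spatialOp_smul]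
  simp only [Pi.smul_apply, smul_eq_mul, h0]
  rfl

/-- The dimension of the kernel of a matrix. -/
def kerDim {n : Type} [Fintype n] [DecidableEq n] (M : Matrix n n ℂ) : ℕ :=
  Module.finrank ℂ (LinearMap.ker (Matrix.toLin' M))

/-- A linear method with the degrees of freedom `σ` in each cell for each of the variables `m`,
with evolution matrix `E`, is stationarity preserving for the system with symbol `J` if
`S ≤ min_k dim ker E(k) ≤ S * N`, where `S = min_k dim ker J(k)` and `N` is the number of degrees
of freedom per cell and variable. -/
def StationarityPreserving {d : ℕ} {m σ : Type} [Fintype m] [DecidableEq m] [Fintype σ]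
    [DecidableEq σ] (J : (Fin d → ℝ) → Matrix m m ℂ)
    (E : (Fin d → ℝ) → Matrix (σ × m) (σ × m) ℂ) : Prop :=
  (⨅ k, kerDim (J k)) ≤ ⨅ k, kerDim (E k) ∧
    (⨅ k, kerDim (E k)) ≤ (⨅ k, kerDim (J k)) * Fintype.card σ

/-- The Fourier transform of the component `l` of the reconstruction: the accessible degrees of
freedom are replaced by their Fourier transforms. -/
def reconHat (Δ k : Fin 3 → ℝ) (qhat : Dof × Fin 4 → ℂ) (l : Fin 4) : MvPolynomial (Fin 3) ℂ :=
  recon Δ fun r => (∏ a, transl Δ k a ^ shift r a) * qhat (kind r, l)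

/-- The divergence of the Fourier transform of the velocity reconstruction. -/
def divHat (Δ k : Fin 3 → ℝ) (qhat : Dof × Fin 4 → ℂ) : MvPolynomial (Fin 3) ℂ :=
  ∑ a : Fin 3, MvPolynomial.pderiv a (reconHat Δ k qhat a.castSucc)

/-! ### The explicit vectors -/

/-- The vector `Q̂_1`; `(dx, dy, dz)` are the grid spacings and `(x, y, z)` the translation factors. -/
def kernelVector1 (dx dy dz x y z : ℂ) : Dof → Fin 4 → ℂ
  | .A =>
    ![-((dx * (1 + x * (4 + x)) * (y - 1) * (z^2 + 4 * x * z^2 + x^2 * (2 + z * (8 + 3 * z)))) / (54 * dy * x^2 * (x^2 - 1) * y * z^2)),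
      ((1 + y * (4 + y)) * (z^2 + 4 * x * z^2 + x^2 * (2 + z * (8 + 3 * z)))) / (54 * x^2 * y * (1 + y) * z^2),
      0,
      0]
  | .Ex =>
    ![-((dx * (1 + x * (6 + x)) * (y - 1)) / (4 * dy * (x - 1) * x * (1 + y))),
      0,
      (dz * (1 + x) * (y - 1) * (1 + z)) / (2 * dy * x * (1 + y) * (z - 1)),
      0]
  | .Ey =>
    ![0,
      1 / 4 + 1 / (4 * y) + 1 / (1 + y),
      -((dz * (y - 1) * (1 + z)) / (2 * dy * y * (z - 1))),
      0]
  | .Ez =>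
    ![-((dx * (y - 1) * (4 * x^2 + x * (3 + 19 * x) * z + (1 + x) * (2 + 9 * x) * z^2)) / (12 * dy * (x - 1) * x * (1 + y) * z^2)),
      (4 * x^2 + x * (3 + 19 * x) * z + (1 + x) * (2 + 9 * x) * z^2) / (12 * x * (1 + x) * z^2),
      0,
      0]
  | .Fx =>
    ![-((dx * (y - 1) * (2 * z^2 + x^2 * (4 + z) * (1 + 3 * z) + x * z * (-3 + 5 * z))) / (24 * dy * (x - 1) * x * y * z^2)),
      ((1 + y * (6 + y)) * (4 * x^2 + x * (3 + 19 * x) * z + (1 + x) * (2 + 9 * x) * z^2)) / (48 * x * (1 + x) * y * (1 + y) * z^2),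
      -((dz * (y - 1) * (1 + z * (6 + z))) / (8 * dy * y * (z - 1) * z)),
      0]
  | .Fy =>
    ![-((dx * (1 + x * (6 + x)) * (y - 1) * (4 * x^2 + x * (3 + 19 * x) * z + (1 + x) * (2 + 9 * x) * z^2)) / (48 * dy * x^2 * (x^2 - 1) * (1 + y) * z^2)),
      (2 * z^2 + x^2 * (4 + z) * (1 + 3 * z) + x * z * (-3 + 5 * z)) / (24 * x^2 * z^2),
      (dz * (1 + x) * (y - 1) * (1 + z * (6 + z))) / (8 * dy * x * (1 + y) * (z - 1) * z),
      0]
  | .Fz => ![0, 0, 0, 0]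
  | .N => ![-((dx * (1 + x) * (y - 1)) / (dy * (x - 1) * (1 + y))), 1, 0, 0]

/-- The vector `Q̂_2`; `(dx, dy, dz)` are the grid spacings and `(x, y, z)` the translation factors. -/
def kernelVector2 (dx dy dz x y z : ℂ) : Dof → Fin 4 → ℂ
  | .A =>
    ![-((dx * (1 + x * (4 + x)) * (1 + y) * (z - 1) * (2 * z^2 + x^2 * (z - 2) * (1 + 3 * z) + x * z * (3 + 11 * z))) / (108 * dz * x^2 * (x^2 - 1) * y * z^2 * (1 + z))),
      -((dy * (1 + y * (4 + y)) * (x - z) * (z - 1) * (x + z + 4 * x * z)) / (54 * dz * x^2 * (y - 1) * y * z^2 * (1 + z))),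
      ((1 + x) * (1 + y) * (1 + z * (4 + z))) / (36 * x * y * z * (1 + z)),
      0]
  | .Ex =>
    ![-((dx * (1 + x * (6 + x)) * (z - 1)) / (4 * dz * (x - 1) * x * (1 + z))),
      0,
      (1 + x) / (2 * x),
      0]
  | .Ey => ![0, 0, 0, 0]
  | .Ez =>
    ![-((dx * (z - 1) * (z^2 + x * z * (3 + 7 * z) + x^2 * (-1 + z * (-1 + 3 * z)))) / (6 * dz * (x - 1) * x * z^2 * (1 + z))),
      -((dy * (1 + y) * (x - z) * (z - 1) * (x + z + 4 * x * z)) / (6 * dz * x * (1 + x) * (y - 1) * z^2 * (1 + z))),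
      1 / 4 + 1 / (4 * z) + 1 / (1 + z),
      0]
  | .Fx =>
    ![(dx * (1 + y) * (x - z) * (z - 1) * (x + z + 4 * x * z)) / (12 * dz * (x - 1) * x * y * z^2 * (1 + z)),
      -((dy * (1 + y * (6 + y)) * (x - z) * (z - 1) * (x + z + 4 * x * z)) / (24 * dz * x * (1 + x) * (y - 1) * y * z^2 * (1 + z))),
      0,
      0]
  | .Fy =>
    ![-((dx * (1 + x * (6 + x)) * (z - 1) * (z^2 + x * z * (3 + 7 * z) + x^2 * (-1 + z * (-1 + 3 * z)))) / (24 * dz * x^2 * (x^2 - 1) * z^2 * (1 + z))),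
      -((dy * (1 + y) * (x - z) * (z - 1) * (x + z + 4 * x * z)) / (12 * dz * x^2 * (y - 1) * z^2 * (1 + z))),
      ((1 + x) * (1 + z * (6 + z))) / (8 * x * z * (1 + z)),
      0]
  | .Fz => ![0, 0, 0, 0]
  | .N => ![-((dx * (1 + x) * (z - 1)) / (dz * (x - 1) * (1 + z))), 0, 1, 0]

/-- The vector `Q̂_3`; `(dx, dy, dz)` are the grid spacings and `(x, y, z)` the translation factors. -/
def kernelVector3 (dx dy dz x y z : ℂ) : Dof → Fin 4 → ℂ
  | .A =>
    ![-((2 * dx * (1 + x * (4 + x)) * (z - 1)) / (9 * dz * (x^2 - 1) * z)),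
      0,
      (2 * (1 + z * (4 + z))) / (9 * z * (1 + z)),
      0]
  | .Ex => ![0, -((2 * dy * y * (z - 1)) / (dz * (y - 1) * (1 + z))), (2 * y) / (1 + y), 0]
  | .Ey => ![0, 0, 0, 0]
  | .Ez =>
    ![-((2 * dx * x * y * (z - 1)) / (dz * (x - 1) * (1 + y) * z)),
      (2 * dy * x * y * (z - 1)) / (dz * (1 + x) * (y - 1) * z),
      0,
      0]
  | .Fx =>
    ![-((dx * x * (z - 1)) / (dz * (x - 1) * z)),
      (dy * x * (1 + y * (6 + y)) * (z - 1)) / (2 * dz * (1 + x) * (y^2 - 1) * z),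
      0,
      0]
  | .Fy =>
    ![-((dx * (1 + x * (6 + x)) * y * (z - 1)) / (2 * dz * (x^2 - 1) * (1 + y) * z)),
      0,
      (y * (1 + z * (6 + z))) / (2 * (1 + y) * z * (1 + z)),
      0]
  | .Fz => ![0, -((dy * (1 + y * (6 + y)) * (z - 1)) / (2 * dz * (y^2 - 1) * (1 + z))), 1, 0]
  | .N => ![0, 0, 0, 0]

/-- The vector `Q̂_4`; `(dx, dy, dz)` are the grid spacings and `(x, y, z)` the translation factors. -/
def kernelVector4 (dx dy dz x y z : ℂ) : Dof → Fin 4 → ℂ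
  | .A =>
    ![(8 * dx * (1 + x * (4 + x)) * (y^2 - 1) * (x - z) * (x + z + 4 * x * z)) / (27 * dy * (x - 1) * x * (1 + x)^2 * (1 + y * (6 + y)) * z^2),
      -((8 * (1 + y * (4 + y)) * (x - z) * (x + z + 4 * x * z)) / (27 * x * (1 + x) * (1 + y * (6 + y)) * z^2)),
      0,
      0]
  | .Ex =>
    ![0,
      (4 * y * (1 + y)) / (1 + y * (6 + y)),
      -((4 * dz * (y - 1) * y * (1 + z)) / (dy * (1 + y * (6 + y)) * (z - 1))),
      0]
  | .Ey =>
    ![-((4 * dx * x * (y^2 - 1)) / (dy * (x - 1) * (1 + y * (6 + y)))),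
      0,
      (4 * dz * x * (y^2 - 1) * (1 + z)) / (dy * (1 + x) * (1 + y * (6 + y)) * (z - 1)),
      0]
  | .Ez =>
    ![(4 * dx * (y - 1) * y * (2 * x^2 + x * (3 + 11 * x) * z + (-2 + x) * (1 + 3 * x) * z^2)) / (3 * dy * (x^2 - 1) * (1 + y * (6 + y)) * z^2),
      -((4 * y * (1 + y) * (2 * x^2 + x * (3 + 11 * x) * z + (-2 + x) * (1 + 3 * x) * z^2)) / (3 * (1 + x)^2 * (1 + y * (6 + y)) * z^2)),
      0,
      0]
  | .Fx =>
    ![(4 * dx * (y^2 - 1) * (x - z) * (x + z + 4 * x * z)) / (3 * dy * (x^2 - 1) * (1 + y * (6 + y)) * z^2),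
      -((2 * x^2 + x * (3 + 11 * x) * z + (-2 + x) * (1 + 3 * x) * z^2) / (3 * (1 + x)^2 * z^2)),
      (dz * x * (y^2 - 1) * (1 + z * (6 + z))) / (dy * (1 + x) * (1 + y * (6 + y)) * (z - 1) * z),
      0]
  | .Fy =>
    ![(dx * (1 + x * (6 + x)) * (y - 1) * y * (2 * x^2 + x * (3 + 11 * x) * z + (-2 + x) * (1 + 3 * x) * z^2)) / (3 * dy * (x - 1) * x * (1 + x)^2 * (1 + y * (6 + y)) * z^2),
      -((4 * y * (1 + y) * (x - z) * (x + z + 4 * x * z)) / (3 * x * (1 + x) * (1 + y * (6 + y)) * z^2)),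
      -((dz * (y - 1) * y * (1 + z * (6 + z))) / (dy * (1 + y * (6 + y)) * (z - 1) * z)),
      0]
  | .Fz =>
    ![-((dx * (1 + x * (6 + x)) * (y^2 - 1)) / (dy * (x^2 - 1) * (1 + y * (6 + y)))),
      1,
      0,
      0]
  | .N => ![0, 0, 0, 0]

/-- The vector `Q̂_5`; `(dx, dy, dz)` are the grid spacings and `(x, y, z)` the translation factors. -/
def kernelVector5 (dx dy dz x y z : ℂ) : Dof → Fin 4 → ℂ
  | .A => ![0, 0, 0, 0]
  | .Ex => ![0, 0, 0, 0]
  | .Ey =>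
    ![(4 * x * (1 + x)) / (1 + x * (6 + x)),
      -((4 * dy * x * (x^2 - 1) * (1 + y * (6 + y))) / (dx * (1 + x) * (1 + x * (6 + x)) * (y^2 - 1))),
      (4 * dz * x * (x^2 - 1) * (1 + z)) / (dx * (1 + x) * (1 + x * (6 + x)) * (z - 1)),
      0]
  | .Ez =>
    ![-((4 * x * (1 + x) * (y - 1) * y * (1 + z)) / ((1 + x * (6 + x)) * (y^2 - 1) * z)),
      -((4 * dy * x * (x^2 - 1) * y * (1 + y) * (1 + z)) / (dx * (1 + x) * (1 + x * (6 + x)) * (y^2 - 1) * z)),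
      (4 * dz * x * (x^2 - 1) * (y - 1) * y * (1 + z * (6 + z))) / (dx * (1 + x) * (1 + x * (6 + x)) * (y^2 - 1) * (z - 1) * z),
      0]
  | .Fx =>
    ![0,
      -((dy * x * (x^2 - 1) * (1 + y * (6 + y)) * (1 + z)) / (dx * (1 + x) * (1 + x * (6 + x)) * (y^2 - 1) * z)),
      (dz * x * (x^2 - 1) * (1 + z * (6 + z))) / (dx * (1 + x) * (1 + x * (6 + x)) * (z - 1) * z),
      0]
  | .Fy =>
    ![-(((y - 1) * y * (1 + z)) / ((y^2 - 1) * z)),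
      (2 * dy * (x - 1) * (1 + x) * y * (1 + y) * (1 + z)) / (dx * (1 + x * (6 + x)) * (y^2 - 1) * z),
      0,
      0]
  | .Fz =>
    ![1,
      0,
      -((2 * dz * (x - 1) * (1 + x) * (1 + z)) / (dx * (1 + x * (6 + x)) * (z - 1))),
      0]
  | .N =>
    ![0,
      -((16 * dy * x * (x^2 - 1) * y * (1 + y)) / (dx * (1 + x) * (1 + x * (6 + x)) * (y^2 - 1))),
      (16 * dz * x * (x^2 - 1) * (y - 1) * y * (1 + z)) / (dx * (1 + x) * (1 + x * (6 + x)) * (y^2 - 1) * (z - 1)),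
      0]

/-- The vectors `Q̂_1, …, Q̂_5` at the wave vector `k`. -/
def kernelVector (Δ k : Fin 3 → ℝ) (i : Fin 5) : Dof × Fin 4 → ℂ := fun j =>
  (![kernelVector1, kernelVector2, kernelVector3, kernelVector4, kernelVector5] :
      Fin 5 → ℂ → ℂ → ℂ → ℂ → ℂ → ℂ → Dof → Fin 4 → ℂ) i
    (Δ 0) (Δ 1) (Δ 2) (transl Δ k 0) (transl Δ k 1) (transl Δ k 2) j.1 j.2

/-- General wave vectors: the denominators of `Q̂_1, …, Q̂_5` do not vanish (no translation factor
is `1` or `-1`), and neither does the factor of `t_x` and `t_z` at whose zeros these vectors are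
linearly dependent. -/
def General (Δ k : Fin 3 → ℝ) : Prop :=
  (∀ a, transl Δ k a ≠ 1 ∧ transl Δ k a ≠ -1) ∧
    (transl Δ k 2) ^ 2 + 4 * transl Δ k 0 * (transl Δ k 2) ^ 2 +
      (transl Δ k 0) ^ 2 * (2 + transl Δ k 2 * (8 + 3 * transl Δ k 2)) ≠ 0

end

end ActiveFlux

namespace ActiveFlux

noncomputable section

/-! A triparabolic polynomial is determined by its 27 nodal values. The central one is recovered
from the average by Simpson's rule, and differentiation acts on nodal values by a 3×3 matrix along
each line (`recon_eq_interp`, `pderiv_interp`). On a Fourier mode, values at a left end are `t_a⁻¹`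
times those at the right end. The rows of the evolution matrix then involve only one-sided
derivatives and their jumps across faces: with `J^± = (J ± |J|)/2`, a velocity row contains the mean
of the two pressure derivatives and the jump of the velocity derivative, and the pressure rows have
the roles exchanged.

If the pressure vanishes and the divergence is the zero polynomial, comparing its values on opposite
faces shows that the normal derivatives of the velocity do not jump. Then every row vanishes
(`kernel_of_divergence_free`). Conversely, let the data lie in the kernel with all `t_a ≠ 1`
(`divergence_free_of_kernel`). The velocity rows kill the pressure on the cell boundary, so that
only a central pressure value `m` remains. It fixes the jumps and the divergence at the face
midpoints as multiples of `m`. The divergence has no coefficient of `x²y²z²`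
(`second_difference_nodalDiv`) and has mean zero; these two equations for its central value are
compatible only if `m = 0`. What remains are vanishing jumps and vanishing divergence at seven
points, and by `nodalDiv_eq_zero` these force the divergence to vanish.

The dimension is a count. Eight pressures, seven divergence values and twelve jumps give 27
conditions on 32 amplitudes, hence a kernel of dimension at least 5 for every `k`
(`five_le_kerDim`). For `t_a ≠ 1`, five derivative values determine all the others through the
divergence equations, and the derivatives determine the data (`kerDim_le_five`).

For the explicit vectors, absence of jumps and of divergence becomes the nineteen scalar relations
`DivergenceFreeRelations`, which are checked as rational identities. Independence follows from five
entries of each vector, whose elimination leaves the extra factor of `General`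
(`kernelVector_elimination`). Membership, independence and dimension give the span. -/

/-! ### Nodal calculus for the reconstruction -/

/-- The tensor-product interpolation polynomial to nodal values. -/
def interp (Δ : Fin 3 → ℝ) (f : Loc → ℂ) : MvPolynomial (Fin 3) ℂ :=
  ∑ r, MvPolynomial.C (f r) * ∏ a, lagrange Δ a (r a)

/-- The nodal values of the reconstruction. -/
def nodal (d : Loc → ℂ) (r : Loc) : ℂ :=
  if r = centre then
    27 / 8 * (d centre - ∑ s ∈ Finset.univ.erase centre, ((∏ a, simpson (s a) : ℝ) : ℂ) * d s)
  else d r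

/-- The matrix of differentiation of quadratic polynomials at the nodes of a unit interval. -/
def diffMat : Fin 3 → Fin 3 → ℂ := ![![-3, 4, -1], ![-1, 0, 1], ![1, -4, 3]]

/-- The nodal values of the derivative in direction `a` from the nodal values. -/
def nodalDeriv (Δ : Fin 3 → ℝ) (a : Fin 3) (f : Loc → ℂ) (r : Loc) : ℂ :=
  (Δ a : ℂ)⁻¹ * ∑ i, diffMat (r a) i * f (Function.update r a i)

/-- Each shape function of a point value is a Lagrange product minus the multiple of the central
bubble that cancels its mean. Collecting the bubble terms gives the central nodal value; `27 / 8` is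
the inverse of the central Simpson weight `(4 / 6)³`. -/
theorem recon_eq_interp (Δ : Fin 3 → ℝ) (d : Loc → ℂ) : recon Δ d = interp Δ (nodal d) := by
  unfold recon interp
  rw [← Finset.add_sum_erase _ _ (Finset.mem_univ centre),
    ← Finset.add_sum_erase (f := fun r => MvPolynomial.C (nodal d r) * _) _
      (Finset.mem_univ centre)]
  have h1 : ∀ r ∈ Finset.univ.erase centre, MvPolynomial.C (d r) * shape Δ r =
      MvPolynomial.C (nodal d r) * ∏ a, lagrange Δ a (r a) -
        MvPolynomial.C (27 / 8) * (MvPolynomial.C (((∏ a, simpson (r a) : ℝ) : ℂ) * d r) *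
          ∏ a, lagrange Δ a 1) := by
    intro r hr
    rw [shape, nodal, if_neg (Finset.ne_of_mem_erase hr), if_neg (Finset.ne_of_mem_erase hr)]
    simp only [map_mul]
    ring
  rw [Finset.sum_congr rfl h1, Finset.sum_sub_distrib, ← Finset.mul_sum, ← Finset.sum_mul,
    ← map_sum, shape, if_pos rfl, nodal, if_pos rfl]
  simp only [map_mul, map_sub, centre]
  ring

theorem evalAt_interp (Δ : Fin 3 → ℝ) (hΔ : ∀ a, 0 < Δ a) (f : Loc → ℂ) (r : Loc) :
    evalAt (relPos Δ r) (interp Δ f) = f r := by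
  have h : evalAt (relPos Δ r) (interp Δ f) =
      ∑ s, f s * evalAt (relPos Δ r) (∏ a, lagrange Δ a (s a)) := by
    simp only [interp, evalAt, map_sum, map_mul, MvPolynomial.eval_C]
  rw [h]
  simp [lagrange_prod_node Δ hΔ]

theorem interp_eq_zero_iff (Δ : Fin 3 → ℝ) (hΔ : ∀ a, 0 < Δ a) (f : Loc → ℂ) :
    interp Δ f = 0 ↔ ∀ r, f r = 0 := by
  constructor
  · intro h r
    rw [← evalAt_interp Δ hΔ f r, h]
    simp [evalAt]
  · intro h
    simp [interp, h]

theorem pderiv_lagrange (Δ : Fin 3 → ℝ) (a b i : Fin 3) :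
    MvPolynomial.pderiv b (lagrange Δ a i) = if a = b then
      MvPolynomial.C ((Δ a : ℂ)⁻¹) * ∑ j, MvPolynomial.C (diffMat j i) * lagrange Δ a j else 0 := by
  have hX : MvPolynomial.pderiv b (MvPolynomial.X a : MvPolynomial (Fin 3) ℂ) =
      if a = b then 1 else 0 := by
    rw [MvPolynomial.pderiv_X, Pi.single_apply]
  have h3 : ∀ j : Fin 3, j = 0 ∨ j = 1 ∨ j = 2 := by decide
  have c3 : (MvPolynomial.C 3 : MvPolynomial (Fin 3) ℂ) = 3 := map_ofNat _ 3
  have c4 : (MvPolynomial.C 4 : MvPolynomial (Fin 3) ℂ) = 4 := map_ofNat _ 4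
  have d2 : MvPolynomial.pderiv b (2 : MvPolynomial (Fin 3) ℂ) = 0 :=
    (MvPolynomial.pderiv b).map_natCast 2
  have d4 : MvPolynomial.pderiv b (4 : MvPolynomial (Fin 3) ℂ) = 0 :=
    (MvPolynomial.pderiv b).map_natCast 4
  rcases h3 i with rfl | rfl | rfl <;> by_cases hab : a = b <;>
    simp [lagrange, diffMat, Fin.sum_univ_three, hX, hab, c3, c4, d2, d4, Derivation.leibniz,
      Derivation.leibniz_pow] <;> ring

theorem pderiv_lagrange_prod (Δ : Fin 3 → ℝ) (a : Fin 3) (r : Loc) :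
    MvPolynomial.pderiv a (∏ b, lagrange Δ b (r b)) = MvPolynomial.C ((Δ a : ℂ)⁻¹) *
      ∑ j, MvPolynomial.C (diffMat j (r a)) * ∏ b, lagrange Δ b (Function.update r a j b) := by
  have h3 : ∀ j : Fin 3, j = 0 ∨ j = 1 ∨ j = 2 := by decide
  simp only [Fin.prod_univ_three, Fin.sum_univ_three, Derivation.leibniz, pderiv_lagrange,
    smul_eq_mul]
  rcases h3 a with rfl | rfl | rfl <;> simp <;> ring

/-- The map `(r, j) ↦ (update r a j, r a)` is an involution. It transfers the differentiation matrix
from the basis polynomials to the nodal values in `pderiv_interp`. -/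
theorem sum_update_swap {M : Type*} [AddCommMonoid M] (a : Fin 3) (F : Loc → Fin 3 → M) :
    ∑ r, ∑ j, F r j = ∑ r : Loc, ∑ j, F (Function.update r a j) (r a) := by
  rw [← Fintype.sum_prod_type', ← Fintype.sum_prod_type']
  refine Fintype.sum_equiv
    { toFun := fun p => (Function.update p.1 a p.2, p.1 a)
      invFun := fun p => (Function.update p.1 a p.2, p.1 a)
      left_inv := fun p => by simp
      right_inv := fun p => by simp } _ _ fun p => by simp

theorem pderiv_interp (Δ : Fin 3 → ℝ) (a : Fin 3) (f : Loc → ℂ) :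
    MvPolynomial.pderiv a (interp Δ f) = interp Δ (nodalDeriv Δ a f) := by
  unfold interp nodalDeriv
  simp only [map_sum, Derivation.leibniz, MvPolynomial.pderiv_C, mul_zero, add_zero, smul_eq_mul,
    pderiv_lagrange_prod, map_mul, Finset.mul_sum, Finset.sum_mul]
  rw [sum_update_swap a]
  simp only [Function.update_self, Function.update_idem, Function.update_eq_self]
  exact Finset.sum_congr rfl fun _ _ => Finset.sum_congr rfl fun _ _ => by ring

/-- The Fourier transforms of the accessible degrees of freedom. -/
def hat (Δ k : Fin 3 → ℝ) (qhat : Dof × Fin 4 → ℂ) (l : Fin 4) (r : Loc) : ℂ :=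
  (∏ a, transl Δ k a ^ shift r a) * qhat (kind r, l)

/-- The nodal values of the Fourier transform of the reconstruction. -/
def nodalHat (Δ k : Fin 3 → ℝ) (qhat : Dof × Fin 4 → ℂ) (l : Fin 4) : Loc → ℂ :=
  nodal (hat Δ k qhat l)

/-- The nodal values of the divergence of three fields given by nodal values. -/
def nodalDiv (Δ : Fin 3 → ℝ) (g : Fin 4 → Loc → ℂ) (r : Loc) : ℂ :=
  ∑ a : Fin 3, nodalDeriv Δ a (g a.castSucc) r

theorem divHat_eq_zero_iff (Δ k : Fin 3 → ℝ) (hΔ : ∀ a, 0 < Δ a) (qhat : Dof × Fin 4 → ℂ) :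
    divHat Δ k qhat = 0 ↔ ∀ r, nodalDiv Δ (nodalHat Δ k qhat) r = 0 := by
  rw [← interp_eq_zero_iff Δ hΔ]
  have : divHat Δ k qhat = interp Δ (nodalDiv Δ (nodalHat Δ k qhat)) := by
    have h : ∀ l, reconHat Δ k qhat l = interp Δ (nodalHat Δ k qhat l) :=
      fun l => recon_eq_interp Δ _
    simp only [divHat, h, pderiv_interp]
    simp only [nodalDiv, interp, map_sum, Finset.sum_mul]
    rw [Finset.sum_comm]
  rw [this]

theorem transl_ne_zero (Δ k : Fin 3 → ℝ) (a : Fin 3) : transl Δ k a ≠ 0 := Complex.exp_ne_zero _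

/-- `kind` records only which coordinates are midpoints, so opposite ends carry the same degree of
freedom and differ by one cell shift. -/
theorem hat_update (Δ k : Fin 3 → ℝ) (qhat : Dof × Fin 4 → ℂ) (l : Fin 4) (a : Fin 3) (r : Loc) :
    hat Δ k qhat l (Function.update r a 0) =
      (transl Δ k a)⁻¹ * hat Δ k qhat l (Function.update r a 2) := by
  have h3 : ∀ j : Fin 3, j = 0 ∨ j = 1 ∨ j = 2 := by decide
  have hk : kind (Function.update r a 0) = kind (Function.update r a 2) := by
    rcases h3 a with rfl | rfl | rfl <;> simp [kind]
  rw [hat, hat, hk, ← mul_assoc]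
  congr 1
  rw [← Finset.mul_prod_erase _ _ (Finset.mem_univ a),
    ← Finset.mul_prod_erase (f := fun b => transl Δ k b ^ shift (Function.update r a 2) b) _
      (Finset.mem_univ a)]
  simp only [shift, Function.update_self, if_true, zpow_neg, zpow_one]
  rw [if_neg (by decide), zpow_zero, one_mul]
  congr 1
  refine Finset.prod_congr rfl fun b hb => ?_
  rw [Function.update_of_ne (Finset.ne_of_mem_erase hb),
    Function.update_of_ne (Finset.ne_of_mem_erase hb)]

theorem update_ne_centre (r : Loc) (a j : Fin 3) (hj : j ≠ 1) :
    Function.update r a j ≠ centre := fun h => hj (by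
  have := congrFun h a
  simpa [centre] using this)

theorem nodalHat_update (Δ k : Fin 3 → ℝ) (qhat : Dof × Fin 4 → ℂ) (l : Fin 4) (a : Fin 3)
    (r : Loc) : nodalHat Δ k qhat l (Function.update r a 0) =
      (transl Δ k a)⁻¹ * nodalHat Δ k qhat l (Function.update r a 2) := by
  rw [nodalHat, nodal, nodal, if_neg (update_ne_centre r a 0 (by decide)),
    if_neg (update_ne_centre r a 2 (by decide)), hat_update]

/-! ### The rows of the evolution matrix -/

theorem accessible_fourierMode (Δ k : Fin 3 → ℝ) (qhat : Dof × Fin 4 → ℂ) (I : Fin 3 → ℤ) (r : Loc)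
    (l : Fin 4) : accessible (fourierMode Δ k qhat) I r l =
      (∏ a, transl Δ k a ^ I a) * hat Δ k qhat l r := by
  simp only [accessible, fourierMode, hat, Pi.add_apply, zpow_add₀ (transl_ne_zero Δ k _),
    Finset.prod_mul_distrib, mul_assoc]

theorem cellRecon_fourierMode (Δ k : Fin 3 → ℝ) (qhat : Dof × Fin 4 → ℂ) (I : Fin 3 → ℤ)
    (l : Fin 4) : cellRecon Δ (fourierMode Δ k qhat) I l =
      (∏ a, transl Δ k a ^ I a) • interp Δ (nodalHat Δ k qhat l) := by
  rw [nodalHat, ← recon_eq_interp, ← recon_smul, cellRecon]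
  congr 1
  funext r
  exact accessible_fourierMode Δ k qhat I r l

theorem prod_transl_single (Δ k : Fin 3 → ℝ) (a : Fin 3) (m : ℤ) :
    ∏ b, transl Δ k b ^ (Pi.single a m : Fin 3 → ℤ) b = transl Δ k a ^ m := by
  rw [Finset.prod_eq_single a]
  · simp
  · intro b _ hb; simp [Pi.single_eq_of_ne hb]
  · simp

/-- The derivative on the right of a node, in terms of nodal values in the reference cell. -/
def rightDeriv (Δ k : Fin 3 → ℝ) (a : Fin 3) (f : Loc → ℂ) (r : Loc) : ℂ :=
  if r a = 2 then transl Δ k a * nodalDeriv Δ a f (Function.update r a 0) else nodalDeriv Δ a f r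

theorem diff_fourierMode (Δ k : Fin 3 → ℝ) (hΔ : ∀ a, 0 < Δ a) (qhat : Dof × Fin 4 → ℂ) (a : Fin 3)
    (X : Dof) (l : Fin 4) : diff Δ a (fourierMode Δ k qhat) 0 X l =
      nodalDeriv Δ a (nodalHat Δ k qhat l) X.loc := by
  rw [diff, cellRecon_fourierMode]
  simp only [Pi.zero_apply, zpow_zero, Finset.prod_const_one, one_smul]
  rw [pderiv_interp, evalAt_interp Δ hΔ]

theorem diffStar_fourierMode (Δ k : Fin 3 → ℝ) (hΔ : ∀ a, 0 < Δ a) (qhat : Dof × Fin 4 → ℂ)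
    (a : Fin 3) (X : Dof) (l : Fin 4) : diffStar Δ a (fourierMode Δ k qhat) 0 X l =
      rightDeriv Δ k a (nodalHat Δ k qhat l) X.loc := by
  rw [diffStar, rightDeriv]
  split_ifs with h
  -- The right end of the reference cell is the left end of its neighbour, where the mode carries
  -- one more factor `t_a`.
  · have hp : relPos Δ X.loc - Pi.single a (Δ a) = relPos Δ (Function.update X.loc a 0) := by
      funext b
      by_cases hb : b = a
      · subst hb
        simp [relPos, h]
        ring
      · simp [relPos, hb]
    rw [hp, zero_add, cellRecon_fourierMode, prod_transl_single, zpow_one, Derivation.map_smul,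
      evalAt_smul, pderiv_interp, evalAt_interp Δ hΔ]
  · exact diff_fourierMode Δ k hΔ qhat a X l

theorem evolution_mulVec (c : ℝ) (Δ k : Fin 3 → ℝ) (qhat : Dof × Fin 4 → ℂ) (X : Dof) (l : Fin 4) :
    (evolutionMatrix c Δ k).mulVec qhat (X, l) = spatialOp c Δ (fourierMode Δ k qhat) 0 X l := by
  rw [spatialOp_fourierMode]
  simp [fourierMode]

/-- The state of the numerical flux through the face `r a = 2`. -/
def faceMean (Δ k : Fin 3 → ℝ) (qhat : Dof × Fin 4 → ℂ) (a : Fin 3) (l : Fin 4) : ℂ :=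
  ∑ r : Loc with r a = 2, ((∏ b ∈ Finset.univ.erase a, simpson (r b) : ℝ) : ℂ) *
    nodalHat Δ k qhat l r

/-- The centre lies on no face, so the flux sees only point values, and these coincide with the
nodal values. -/
theorem numFlux_fourierMode (c : ℝ) (Δ k : Fin 3 → ℝ) (qhat : Dof × Fin 4 → ℂ) (a : Fin 3)
    (I : Fin 3 → ℤ) (l : Fin 4) : numFlux c a (fourierMode Δ k qhat) I l =
      (∏ b, transl Δ k b ^ I b) * ∑ m, (jac c a l m : ℂ) * faceMean Δ k qhat a m := by
  have h : ∀ r : Loc, r a = 2 → ∀ m, hat Δ k qhat m r = nodalHat Δ k qhat m r := by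
    intro r hr m
    rw [nodalHat, nodal, if_neg]
    rintro rfl
    revert hr
    simp [centre]
  simp only [numFlux, Finset.sum_apply, Pi.smul_apply, Matrix.mulVec, dotProduct, Matrix.map_apply,
    accessible_fourierMode, faceMean, smul_eq_mul, Finset.mul_sum]
  rw [Finset.sum_comm]
  refine Finset.sum_congr rfl fun m _ => Finset.sum_congr rfl fun r hr => ?_
  rw [h r (by simpa using hr)]
  ring

theorem jac_sum (c : ℝ) (a : Fin 3) (f : Fin 4 → ℂ) (b : Fin 3) :
    ∑ m, (jac c a b.castSucc m : ℂ) * f m = if b = a then c * f 3 else 0 := by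
  have h3 : ∀ j : Fin 3, j = 0 ∨ j = 1 ∨ j = 2 := by decide
  rcases h3 a with rfl | rfl | rfl <;> rcases h3 b with rfl | rfl | rfl <;>
    simp [jac, Fin.sum_univ_four]

theorem jac_sum_last (c : ℝ) (a : Fin 3) (f : Fin 4 → ℂ) :
    ∑ m, (jac c a 3 m : ℂ) * f m = c * f a.castSucc := by
  have h3 : ∀ j : Fin 3, j = 0 ∨ j = 1 ∨ j = 2 := by decide
  rcases h3 a with rfl | rfl | rfl <;> simp [jac, Fin.sum_univ_four]

theorem jacAbs_sum (c : ℝ) (a : Fin 3) (f : Fin 4 → ℂ) (b : Fin 3) :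
    ∑ m, (jacAbs c a b.castSucc m : ℂ) * f m = if b = a then c * f b.castSucc else 0 := by
  have h3 : ∀ j : Fin 3, j = 0 ∨ j = 1 ∨ j = 2 := by decide
  rcases h3 a with rfl | rfl | rfl <;> rcases h3 b with rfl | rfl | rfl <;>
    simp [jacAbs, Fin.sum_univ_four, Matrix.diagonal]

theorem jacAbs_sum_last (c : ℝ) (a : Fin 3) (f : Fin 4 → ℂ) :
    ∑ m, (jacAbs c a 3 m : ℂ) * f m = c * f 3 := by
  have h3 : ∀ j : Fin 3, j = 0 ∨ j = 1 ∨ j = 2 := by decide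
  rcases h3 a with rfl | rfl | rfl <;> simp [jacAbs, Fin.sum_univ_four, Matrix.diagonal]

theorem jacPos_sum (c : ℝ) (a : Fin 3) (l : Fin 4) (f : Fin 4 → ℂ) :
    ∑ m, (jacPos c a l m : ℂ) * f m = 1 / 2 * (∑ m, (jac c a l m : ℂ) * f m +
      ∑ m, (jacAbs c a l m : ℂ) * f m) := by
  rw [← Finset.sum_add_distrib, Finset.mul_sum]
  refine Finset.sum_congr rfl fun m _ => ?_
  simp only [jacPos, Matrix.smul_apply, Matrix.add_apply, smul_eq_mul]
  push_cast
  ring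

theorem jacNeg_sum (c : ℝ) (a : Fin 3) (l : Fin 4) (f : Fin 4 → ℂ) :
    ∑ m, (jacNeg c a l m : ℂ) * f m = 1 / 2 * (∑ m, (jac c a l m : ℂ) * f m -
      ∑ m, (jacAbs c a l m : ℂ) * f m) := by
  rw [← Finset.sum_sub_distrib, Finset.mul_sum]
  refine Finset.sum_congr rfl fun m _ => ?_
  simp only [jacNeg, Matrix.smul_apply, Matrix.sub_apply, smul_eq_mul]
  push_cast
  ring

theorem evolution_average_velocity (c : ℝ) (Δ k : Fin 3 → ℝ) (qhat : Dof × Fin 4 → ℂ)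
    (b : Fin 3) : (evolutionMatrix c Δ k).mulVec qhat (.A, b.castSucc) =
      c * ((Δ b : ℂ)⁻¹ * (1 - (transl Δ k b)⁻¹) * faceMean Δ k qhat b 3) := by
  rw [evolution_mulVec, spatialOp, if_pos rfl, Finset.sum_apply, Finset.sum_eq_single b]
  · simp only [Pi.smul_apply, Pi.sub_apply, numFlux_fourierMode, zero_sub, jac_sum, if_true,
      smul_eq_mul]
    rw [← Pi.single_neg, prod_transl_single]
    simp
    ring
  · intro a _ ha
    simp only [Pi.smul_apply, Pi.sub_apply, numFlux_fourierMode, jac_sum, if_neg ha.symm]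
    simp
  · simp

theorem evolution_average_pressure (c : ℝ) (Δ k : Fin 3 → ℝ) (qhat : Dof × Fin 4 → ℂ) :
    (evolutionMatrix c Δ k).mulVec qhat (.A, 3) =
      c * ∑ a, (Δ a : ℂ)⁻¹ * (1 - (transl Δ k a)⁻¹) * faceMean Δ k qhat a a.castSucc := by
  rw [evolution_mulVec, spatialOp, if_pos rfl, Finset.sum_apply, Finset.mul_sum]
  refine Finset.sum_congr rfl fun a _ => ?_
  simp only [Pi.smul_apply, Pi.sub_apply, numFlux_fourierMode, zero_sub, jac_sum_last, smul_eq_mul]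
  rw [← Pi.single_neg, prod_transl_single]
  simp
  ring

/-- For a velocity component, `J_b` picks out the pressure and `|J_b|` the component itself, and
only the direction `b` contributes. The sum of the one-sided derivatives of the pressure and the
difference of those of the velocity remain. -/
theorem evolution_point_velocity (c : ℝ) (Δ k : Fin 3 → ℝ) (hΔ : ∀ a, 0 < Δ a)
    (qhat : Dof × Fin 4 → ℂ) (X : Dof) (hX : X ≠ .A) (b : Fin 3) :
    (evolutionMatrix c Δ k).mulVec qhat (X, b.castSucc) = c / 2 *
      (nodalDeriv Δ b (nodalHat Δ k qhat 3) X.loc +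
        nodalDeriv Δ b (nodalHat Δ k qhat b.castSucc) X.loc +
        (rightDeriv Δ k b (nodalHat Δ k qhat 3) X.loc -
          rightDeriv Δ k b (nodalHat Δ k qhat b.castSucc) X.loc)) := by
  rw [evolution_mulVec, spatialOp, if_neg hX, Finset.sum_apply]
  simp only [Pi.add_apply, Matrix.mulVec, dotProduct, Matrix.map_apply, jacPos_sum, jacNeg_sum,
    jac_sum, jacAbs_sum, diff_fourierMode Δ k hΔ, diffStar_fourierMode Δ k hΔ]
  rw [Finset.sum_eq_single b]
  · simp only [if_true]
    ring
  · intro a _ ha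
    simp [ha.symm]
  · simp

theorem evolution_point_pressure (c : ℝ) (Δ k : Fin 3 → ℝ) (hΔ : ∀ a, 0 < Δ a)
    (qhat : Dof × Fin 4 → ℂ) (X : Dof) (hX : X ≠ .A) :
    (evolutionMatrix c Δ k).mulVec qhat (X, 3) = c / 2 * ∑ a : Fin 3,
      (nodalDeriv Δ a (nodalHat Δ k qhat a.castSucc) X.loc +
        nodalDeriv Δ a (nodalHat Δ k qhat 3) X.loc +
        (rightDeriv Δ k a (nodalHat Δ k qhat a.castSucc) X.loc -
          rightDeriv Δ k a (nodalHat Δ k qhat 3) X.loc)) := by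
  rw [evolution_mulVec, spatialOp, if_neg hX, Finset.sum_apply]
  simp only [Pi.add_apply, Matrix.mulVec, dotProduct, Matrix.map_apply, jacPos_sum, jacNeg_sum,
    jac_sum_last, jacAbs_sum_last, diff_fourierMode Δ k hΔ, diffStar_fourierMode Δ k hΔ]
  rw [Finset.mul_sum]
  exact Finset.sum_congr rfl fun a _ => by ring

/-! ### Quasi-periodic nodal values -/

/-- The values on the left are those on the right divided by the translation factor. -/
def QuasiPeriodic (t : Fin 3 → ℂ) (f : Loc → ℂ) : Prop :=
  ∀ a r, f (Function.update r a 0) = (t a)⁻¹ * f (Function.update r a 2)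

theorem quasiPeriodic_nodalHat (Δ k : Fin 3 → ℝ) (qhat : Dof × Fin 4 → ℂ) (l : Fin 4) :
    QuasiPeriodic (transl Δ k) (nodalHat Δ k qhat l) := fun a r => nodalHat_update Δ k qhat l a r

theorem update_vec_zero (i j k m : Fin 3) :
    Function.update (![i, j, k] : Loc) 0 m = ![m, j, k] := by
  ext b; fin_cases b <;> rfl

theorem update_vec_one (i j k m : Fin 3) :
    Function.update (![i, j, k] : Loc) 1 m = ![i, m, k] := by
  ext b; fin_cases b <;> rfl

theorem update_vec_two (i j k m : Fin 3) :
    Function.update (![i, j, k] : Loc) 2 m = ![i, j, m] := by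
  ext b; fin_cases b <;> rfl

theorem loc_eta (r : Loc) : r = ![r 0, r 1, r 2] := by
  ext b; fin_cases b <;> rfl

theorem sum_loc {M : Type*} [AddCommMonoid M] (f : Loc → M) :
    ∑ r, f r = ∑ i, ∑ j, ∑ k, f ![i, j, k] := by
  simp only [← Fintype.sum_prod_type']
  exact Fintype.sum_equiv
    { toFun := fun r : Loc => ((r 0, r 1), r 2)
      invFun := fun p => ![p.1.1, p.1.2, p.2]
      left_inv := fun r => (loc_eta r).symm
      right_inv := fun p => rfl } _ (fun p => f ![p.1.1, p.1.2, p.2])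
    fun r => congrArg f (loc_eta r)

section QP

variable {t : Fin 3 → ℂ} {f : Loc → ℂ}

theorem QuasiPeriodic.left_zero (h : QuasiPeriodic t f) (j k : Fin 3) :
    f ![0, j, k] = (t 0)⁻¹ * f ![2, j, k] := by
  simpa only [update_vec_zero] using h 0 ![0, j, k]

theorem QuasiPeriodic.left_one (h : QuasiPeriodic t f) (i k : Fin 3) :
    f ![i, 0, k] = (t 1)⁻¹ * f ![i, 2, k] := by
  simpa only [update_vec_one] using h 1 ![i, 0, k]

theorem QuasiPeriodic.left_two (h : QuasiPeriodic t f) (i j : Fin 3) :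
    f ![i, j, 0] = (t 2)⁻¹ * f ![i, j, 2] := by
  simpa only [update_vec_two] using h 2 ![i, j, 0]

theorem nodalDeriv_left (Δ : Fin 3 → ℝ) (h : QuasiPeriodic t f) {a b : Fin 3} (hab : b ≠ a)
    (r : Loc) : nodalDeriv Δ b f (Function.update r a 0) =
      (t a)⁻¹ * nodalDeriv Δ b f (Function.update r a 2) := by
  simp only [nodalDeriv, Function.update_of_ne hab, Finset.mul_sum]
  refine Finset.sum_congr rfl fun i _ => ?_
  rw [Function.update_comm hab.symm, h, Function.update_comm hab.symm]
  ring

/-- The derivative of a quadratic at the midpoint is the central difference of its end values, so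
the middle value drops out. For `t_a ≠ 1` the derivative therefore determines the right value. -/
theorem nodalDeriv_middle (Δ : Fin 3 → ℝ) (h : QuasiPeriodic t f) (a : Fin 3) (r : Loc)
    (hr : r a = 1) : nodalDeriv Δ a f r =
      (Δ a : ℂ)⁻¹ * ((1 - (t a)⁻¹) * f (Function.update r a 2)) := by
  simp only [nodalDeriv, hr, diffMat, Fin.sum_univ_three, h a r, Matrix.cons_val_zero,
    Matrix.cons_val_one, Matrix.cons_val]
  ring

/-- The jump of the derivative in direction `a` across the face on the right. -/
def jump (Δ : Fin 3 → ℝ) (t : Fin 3 → ℂ) (a : Fin 3) (f : Loc → ℂ) (r : Loc) : ℂ :=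
  nodalDeriv Δ a f (Function.update r a 2) - t a * nodalDeriv Δ a f (Function.update r a 0)

theorem quasiPeriodic_jump_of_ne (Δ : Fin 3 → ℝ) (h : QuasiPeriodic t f) {a b : Fin 3} (hab : b ≠ a)
    (r : Loc) : jump Δ t b f (Function.update r a 0) =
      (t a)⁻¹ * jump Δ t b f (Function.update r a 2) := by
  have e : ∀ m i, Function.update (Function.update r a m) b i =
      Function.update (Function.update r b i) a m := fun m i => Function.update_comm hab.symm _ _ _
  simp only [jump, e, nodalDeriv_left Δ h hab]
  ring

/-- Tangential derivatives inherit quasi-periodicity; only the normal derivative can fail to, and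
its defect is the jump by definition. -/
theorem nodalDiv_left (Δ : Fin 3 → ℝ) {g : Fin 4 → Loc → ℂ} (h : ∀ l, QuasiPeriodic t (g l))
    (ht : ∀ a, t a ≠ 0) (a : Fin 3) (r : Loc) : nodalDiv Δ g (Function.update r a 0) =
      (t a)⁻¹ * (nodalDiv Δ g (Function.update r a 2) - jump Δ t a (g a.castSucc) r) := by
  have e : ∀ m, nodalDiv Δ g (Function.update r a m) =
      nodalDeriv Δ a (g a.castSucc) (Function.update r a m) +
        ∑ b ∈ Finset.univ.erase a, nodalDeriv Δ b (g b.castSucc) (Function.update r a m) :=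
    fun m => (Finset.add_sum_erase _ _ (Finset.mem_univ a)).symm
  have e2 : ∑ b ∈ Finset.univ.erase a, nodalDeriv Δ b (g b.castSucc) (Function.update r a 0) =
      (t a)⁻¹ *
        ∑ b ∈ Finset.univ.erase a, nodalDeriv Δ b (g b.castSucc) (Function.update r a 2) := by
    rw [Finset.mul_sum]
    exact Finset.sum_congr rfl fun b hb => nodalDeriv_left Δ (h _) (Finset.ne_of_mem_erase hb) r
  rw [e, e, e2, jump]
  have := ht a
  field_simp
  ring

/-- Simpson's rule is exact for the derivative. -/
theorem sum_simpson_nodalDeriv (Δ : Fin 3 → ℝ) (h : QuasiPeriodic t f) (a : Fin 3) :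
    ∑ r : Loc, ((∏ b, simpson (r b) : ℝ) : ℂ) * nodalDeriv Δ a f r =
      (Δ a : ℂ)⁻¹ * (1 - (t a)⁻¹) *
        ∑ r : Loc with r a = 2, ((∏ b ∈ Finset.univ.erase a, simpson (r b) : ℝ) : ℂ) * f r := by
  have h3 : ∀ j : Fin 3, j = 0 ∨ j = 1 ∨ j = 2 := by decide
  have e0 : Finset.univ.erase (0 : Fin 3) = {1, 2} := by decide
  have e1 : Finset.univ.erase (1 : Fin 3) = {0, 2} := by decide
  have e2 : Finset.univ.erase (2 : Fin 3) = {0, 1} := by decide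
  rw [Finset.sum_filter, sum_loc, sum_loc]
  rcases h3 a with rfl | rfl | rfl <;>
    simp [e0, e1, e2, Fin.sum_univ_three, Fin.prod_univ_three, nodalDeriv, diffMat, simpson,
      update_vec_zero, update_vec_one, update_vec_two, h.left_zero, h.left_one, h.left_two] <;> ring

/-- The second differences in all three directions annihilate divergences. -/
theorem second_difference_nodalDiv (Δ : Fin 3 → ℝ) (g : Fin 4 → Loc → ℂ) :
    ∑ r : Loc, (∏ b, (![1, -2, 1] : Fin 3 → ℂ) (r b)) * nodalDiv Δ g r = 0 := by
  rw [sum_loc]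
  simp [Fin.sum_univ_three, Fin.prod_univ_three, nodalDeriv, nodalDiv, diffMat,
      update_vec_zero, update_vec_one, update_vec_two]
  ring

theorem nodalDiv_left_zero (Δ : Fin 3 → ℝ) {g : Fin 4 → Loc → ℂ}
    (h : ∀ l, QuasiPeriodic t (g l)) (ht : ∀ a, t a ≠ 0) (j l : Fin 3) :
    nodalDiv Δ g ![0, j, l] = (t 0)⁻¹ * (nodalDiv Δ g ![2, j, l] - jump Δ t 0 (g 0) ![2, j, l]) := by
  have e := nodalDiv_left Δ h ht 0 ![2, j, l]
  simp only [update_vec_zero] at e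
  exact e

theorem nodalDiv_left_one (Δ : Fin 3 → ℝ) {g : Fin 4 → Loc → ℂ}
    (h : ∀ l, QuasiPeriodic t (g l)) (ht : ∀ a, t a ≠ 0) (i l : Fin 3) :
    nodalDiv Δ g ![i, 0, l] = (t 1)⁻¹ * (nodalDiv Δ g ![i, 2, l] - jump Δ t 1 (g 1) ![i, 2, l]) := by
  have e := nodalDiv_left Δ h ht 1 ![i, 2, l]
  simp only [update_vec_one] at e
  exact e

theorem nodalDiv_left_two (Δ : Fin 3 → ℝ) {g : Fin 4 → Loc → ℂ}
    (h : ∀ l, QuasiPeriodic t (g l)) (ht : ∀ a, t a ≠ 0) (i j : Fin 3) :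
    nodalDiv Δ g ![i, j, 0] = (t 2)⁻¹ * (nodalDiv Δ g ![i, j, 2] - jump Δ t 2 (g 2) ![i, j, 2]) := by
  have e := nodalDiv_left Δ h ht 2 ![i, j, 2]
  simp only [update_vec_two] at e
  exact e

theorem QuasiPeriodic.jump_one_zero (Δ : Fin 3 → ℝ) (h : QuasiPeriodic t f) (l : Fin 3) :
    jump Δ t 1 f ![0, 2, l] = (t 0)⁻¹ * jump Δ t 1 f ![2, 2, l] := by
  simpa only [update_vec_zero] using
    quasiPeriodic_jump_of_ne Δ h (a := 0) (b := 1) (by decide) ![2, 2, l]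

theorem QuasiPeriodic.jump_two_zero (Δ : Fin 3 → ℝ) (h : QuasiPeriodic t f) (j : Fin 3) :
    jump Δ t 2 f ![0, j, 2] = (t 0)⁻¹ * jump Δ t 2 f ![2, j, 2] := by
  simpa only [update_vec_zero] using
    quasiPeriodic_jump_of_ne Δ h (a := 0) (b := 2) (by decide) ![2, j, 2]

theorem QuasiPeriodic.jump_two_one (Δ : Fin 3 → ℝ) (h : QuasiPeriodic t f) (i : Fin 3) :
    jump Δ t 2 f ![i, 0, 2] = (t 1)⁻¹ * jump Δ t 2 f ![i, 2, 2] := by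
  simpa only [update_vec_one] using
    quasiPeriodic_jump_of_ne Δ h (a := 1) (b := 2) (by decide) ![i, 2, 2]

/-- The divergence is determined by its point values at the degrees of freedom of the cell and by
the jumps of the derivatives. -/
theorem nodalDiv_eq_zero (Δ : Fin 3 → ℝ) {g : Fin 4 → Loc → ℂ} (hq : ∀ l, QuasiPeriodic t (g l))
    (ht : ∀ a, t a ≠ 0) (hd : ∀ X : Dof, X ≠ .A → nodalDiv Δ g X.loc = 0)
    (hJ : ∀ (X : Dof) (a : Fin 3), X.loc a = 2 → jump Δ t a (g a.castSucc) X.loc = 0) (r : Loc) :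
    nodalDiv Δ g r = 0 := by
  have dl0 := nodalDiv_left_zero Δ hq ht
  have dl1 := nodalDiv_left_one Δ hq ht
  have dl2 := nodalDiv_left_two Δ hq ht
  have jl10 := (hq 1).jump_one_zero Δ
  have jl20 := (hq 2).jump_two_zero Δ
  have jl21 := (hq 2).jump_two_one Δ
  have j0Ey : jump Δ t 0 (g 0) ![2, 1, 2] = 0 := hJ .Ey 0 rfl
  have j0Ez : jump Δ t 0 (g 0) ![2, 2, 1] = 0 := hJ .Ez 0 rfl
  have j0Fx : jump Δ t 0 (g 0) ![2, 1, 1] = 0 := hJ .Fx 0 rfl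
  have j0N : jump Δ t 0 (g 0) ![2, 2, 2] = 0 := hJ .N 0 rfl
  have j1Ex : jump Δ t 1 (g 1) ![1, 2, 2] = 0 := hJ .Ex 1 rfl
  have j1Ez : jump Δ t 1 (g 1) ![2, 2, 1] = 0 := hJ .Ez 1 rfl
  have j1Fy : jump Δ t 1 (g 1) ![1, 2, 1] = 0 := hJ .Fy 1 rfl
  have j1N : jump Δ t 1 (g 1) ![2, 2, 2] = 0 := hJ .N 1 rfl
  have j2Ex : jump Δ t 2 (g 2) ![1, 2, 2] = 0 := hJ .Ex 2 rfl
  have j2Ey : jump Δ t 2 (g 2) ![2, 1, 2] = 0 := hJ .Ey 2 rfl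
  have j2Fz : jump Δ t 2 (g 2) ![1, 1, 2] = 0 := hJ .Fz 2 rfl
  have j2N : jump Δ t 2 (g 2) ![2, 2, 2] = 0 := hJ .N 2 rfl
  have dEx : nodalDiv Δ g ![1, 2, 2] = 0 := hd .Ex (by decide)
  have dEy : nodalDiv Δ g ![2, 1, 2] = 0 := hd .Ey (by decide)
  have dEz : nodalDiv Δ g ![2, 2, 1] = 0 := hd .Ez (by decide)
  have dFx : nodalDiv Δ g ![2, 1, 1] = 0 := hd .Fx (by decide)
  have dFy : nodalDiv Δ g ![1, 2, 1] = 0 := hd .Fy (by decide)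
  have dFz : nodalDiv Δ g ![1, 1, 2] = 0 := hd .Fz (by decide)
  have dN : nodalDiv Δ g ![2, 2, 2] = 0 := hd .N (by decide)
  -- With the jumps gone, the divergence is quasi-periodic and vanishes at all 26 outer nodes. The
  -- centre enters the second difference with weight `(-2)³`, so it vanishes as well.
  have second := second_difference_nodalDiv Δ g
  rw [sum_loc] at second
  -- Left indices are removed in the order `z`, `y`, `x`. The jumps that arise then have left
  -- indices only in directions preceding their own, which is what `jl10`, `jl20` and `jl21` handle.
  simp only [Fin.sum_univ_three, dl2] at second
  simp only [dl1] at second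
  simp [Fin.prod_univ_three, dl0, jl10, jl20, jl21,
    j0Ey, j0Ez, j0Fx, j0N, j1Ex, j1Ez, j1Fy, j1N, j2Ex, j2Ey, j2Fz, j2N, dEx, dEy, dEz, dFx, dFy, dFz, dN] at second
  have h3 : ∀ j : Fin 3, j = 0 ∨ j = 1 ∨ j = 2 := by decide
  rw [loc_eta r]
  rcases h3 (r 0) with h0 | h0 | h0 <;> rcases h3 (r 1) with h1 | h1 | h1 <;>
    rcases h3 (r 2) with h2 | h2 | h2 <;> rw [h0, h1, h2] <;>
    (try rw [dl2]) <;> (try rw [dl1]) <;> simp [dl0, jl10, jl20, jl21, second,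
      j0Ey, j0Ez, j0Fx, j0N, j1Ex, j1Ez, j1Fy, j1N, j2Ex, j2Ey, j2Fz, j2N, dEx, dEy, dEz, dFx, dFy, dFz, dN]

end QP

/-! ### Kernel elements as divergence-free data with zero pressure -/

theorem rightDeriv_eq (Δ k : Fin 3 → ℝ) (a : Fin 3) (f : Loc → ℂ) (r : Loc) :
    rightDeriv Δ k a f r =
      nodalDeriv Δ a f r - if r a = 2 then jump Δ (transl Δ k) a f r else 0 := by
  rw [rightDeriv]
  split_ifs with h
  · rw [jump, ← h, Function.update_eq_self]; ring
  · ring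

/-- A discrete Gauss theorem: the flux differences are Simpson sums over faces, and Simpson's rule
integrates the derivatives of the reconstruction exactly. -/
theorem evolution_average_pressure_eq_mean (c : ℝ) (Δ k : Fin 3 → ℝ) (qhat : Dof × Fin 4 → ℂ) :
    (evolutionMatrix c Δ k).mulVec qhat (.A, 3) =
      c * ∑ r : Loc, ((∏ b, simpson (r b) : ℝ) : ℂ) * nodalDiv Δ (nodalHat Δ k qhat) r := by
  rw [evolution_average_pressure]
  simp only [faceMean, nodalDiv, Finset.mul_sum (s := Finset.univ (α := Fin 3))]
  rw [Finset.sum_comm (s := Finset.univ (α := Loc)), ← Finset.mul_sum]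
  congr 1
  exact Finset.sum_congr rfl fun a _ =>
    (sum_simpson_nodalDeriv Δ (quasiPeriodic_nodalHat Δ k qhat a.castSucc) a).symm

theorem kernel_of_divergence_free (c : ℝ) (Δ k : Fin 3 → ℝ) (hΔ : ∀ a, 0 < Δ a)
    (qhat : Dof × Fin 4 → ℂ) (hp : ∀ X, qhat (X, 3) = 0)
    (hd : ∀ r, nodalDiv Δ (nodalHat Δ k qhat) r = 0) :
    (evolutionMatrix c Δ k).mulVec qhat = 0 := by
  have hq := quasiPeriodic_nodalHat Δ k qhat
  have h3 : nodalHat Δ k qhat 3 = 0 := by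
    funext r
    simp [nodalHat, nodal, hat, hp]
  have hD : ∀ a r, nodalDeriv Δ a (nodalHat Δ k qhat 3) r = 0 := by
    intro a r
    simp [nodalDeriv, h3]
  have hR : ∀ a r, rightDeriv Δ k a (nodalHat Δ k qhat 3) r = 0 := by
    intro a r
    simp [rightDeriv, hD]
  -- The divergence vanishes on both opposite faces, so `nodalDiv_left` leaves only the jump.
  have hJ : ∀ a r, jump Δ (transl Δ k) a (nodalHat Δ k qhat a.castSucc) r = 0 := by
    intro a r
    have h := nodalDiv_left Δ hq (transl_ne_zero Δ k) a r
    rw [hd, hd] at h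
    simpa [transl_ne_zero] using h
  have hS : ∀ a r, rightDeriv Δ k a (nodalHat Δ k qhat a.castSucc) r =
      nodalDeriv Δ a (nodalHat Δ k qhat a.castSucc) r := by
    intro a r
    simp [rightDeriv_eq, hJ]
  have hl : ∀ l : Fin 4, l = 3 ∨ ∃ b : Fin 3, l = b.castSucc := by decide
  funext ⟨X, l⟩
  by_cases hX : X = .A
  · subst hX
    rcases hl l with rfl | ⟨b, rfl⟩
    · rw [evolution_average_pressure_eq_mean]
      simp [hd]
    · rw [evolution_average_velocity]
      simp [faceMean, h3]
  · rcases hl l with rfl | ⟨b, rfl⟩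
    · rw [evolution_point_pressure c Δ k hΔ qhat X hX]
      simp only [hD, hR, hS, add_zero, sub_zero, Finset.sum_add_distrib]
      have := hd X.loc
      rw [nodalDiv] at this
      simp [this]
    · rw [evolution_point_velocity c Δ k hΔ qhat X hX, hD, hR, hS]
      simp

theorem nodalHat_loc (Δ k : Fin 3 → ℝ) (qhat : Dof × Fin 4 → ℂ) (l : Fin 4) (X : Dof)
    (hX : X ≠ .A) : nodalHat Δ k qhat l X.loc = qhat (X, l) := by
  have h : X.loc ≠ centre := fun h => hX (by rw [← kind_loc X, h]; decide)
  simp [nodalHat, nodal, h, hat, shift_loc, kind_loc]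
theorem kind_ne_A : ∀ r, r ≠ centre → kind r ≠ .A := by decide

/-- Point values are nodal values; once they vanish, the central nodal value is `27 / 8` times the
average. -/
theorem eq_zero_of_nodalHat (Δ k : Fin 3 → ℝ) (q : Dof × Fin 4 → ℂ) (l : Fin 4)
    (h : ∀ X : Dof, nodalHat Δ k q l X.loc = 0) (X : Dof) : q (X, l) = 0 := by
  have hX : ∀ X : Dof, X ≠ .A → q (X, l) = 0 := fun X hX => by
    rw [← nodalHat_loc Δ k q l X hX, h]
  by_cases hA : X = .A
  · subst hA
    have hc : Dof.A.loc = centre := by decide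
    have h0 := h .A
    have hz : ∀ r ∈ Finset.univ.erase centre,
        ((∏ b, simpson (r b) : ℝ) : ℂ) * hat Δ k q l r = 0 := by
      intro r hr
      rw [hat, hX _ (kind_ne_A r (Finset.ne_of_mem_erase hr)), mul_zero, mul_zero]
    rw [hc, nodalHat, nodal, if_pos rfl, Finset.sum_eq_zero hz] at h0
    simpa [hat, shift, kind, centre] using h0
  · exact hX X hA

/-- The upwind terms couple pressure and velocity, so vanishing divergence cannot be read off
directly. The pressure is eliminated node by node until a single central value `m` is left, which
the divergence equations exclude. -/
theorem divergence_free_of_kernel (c : ℝ) (hc : 0 < c) (Δ k : Fin 3 → ℝ) (hΔ : ∀ a, 0 < Δ a)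
    (ht : ∀ a, transl Δ k a ≠ 1) (qhat : Dof × Fin 4 → ℂ)
    (hE : (evolutionMatrix c Δ k).mulVec qhat = 0) :
    (∀ X, qhat (X, 3) = 0) ∧ ∀ r, nodalDiv Δ (nodalHat Δ k qhat) r = 0 := by
  have hq := quasiPeriodic_nodalHat Δ k qhat
  have t0 := transl_ne_zero Δ k
  have hc' : (c : ℂ) ≠ 0 := by exact_mod_cast hc.ne'
  have hΔ' : ∀ a, (Δ a : ℂ) ≠ 0 := fun a => by exact_mod_cast (hΔ a).ne'
  have ht' : ∀ a, 1 - (transl Δ k a)⁻¹ ≠ 0 := fun a h => ht a (by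
    have := sub_eq_zero.mp h
    rw [eq_comm, inv_eq_one] at this
    exact this)
  -- At a midpoint in direction `b` both one-sided derivatives agree: the velocity terms cancel and
  -- the row reduces to a central difference of the pressure, with nonzero factor `1 - t_b⁻¹`. The
  -- choices of `X` and `b` below reach all edge midpoints and the corner.
  have hV : ∀ (X : Dof) (b : Fin 3), X ≠ .A → X.loc b = 1 →
      nodalHat Δ k qhat 3 (Function.update X.loc b 2) = 0 := by
    intro X b hX hb
    have h := congrFun hE (X, b.castSucc)
    rw [evolution_point_velocity c Δ k hΔ qhat X hX] at h
    simp only [rightDeriv, hb, Pi.zero_apply] at h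
    rw [nodalDeriv_middle Δ (hq 3) b X.loc hb] at h
    have h2 : (c : ℂ) * ((Δ b : ℂ)⁻¹ * ((1 - (transl Δ k b)⁻¹) *
      nodalHat Δ k qhat 3 (Function.update X.loc b 2))) = 0 := by
      rw [← h]
      simp
      ring
    simpa [hc', hΔ', ht'] using h2
  have pEz : qhat (.Ez, 3) = 0 := by
    rw [← nodalHat_loc Δ k qhat 3 .Ez (by decide), ← hV .Fx 1 (by decide) rfl]; rfl
  have pEy : qhat (.Ey, 3) = 0 := by
    rw [← nodalHat_loc Δ k qhat 3 .Ey (by decide), ← hV .Fx 2 (by decide) rfl]; rfl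
  have pEx : qhat (.Ex, 3) = 0 := by
    rw [← nodalHat_loc Δ k qhat 3 .Ex (by decide), ← hV .Fy 2 (by decide) rfl]; rfl
  have pN : qhat (.N, 3) = 0 := by
    rw [← nodalHat_loc Δ k qhat 3 .N (by decide), ← hV .Ex 0 (by decide) rfl]; rfl
  have hat_eq : ∀ r : Loc, r ≠ centre → kind r ≠ .Fx → kind r ≠ .Fy → kind r ≠ .Fz →
      nodalHat Δ k qhat 3 r = 0 := by
    intro r hr h1 h2 h3
    have hA := kind_ne_A r hr
    have : qhat (kind r, 3) = 0 := by
      cases h : kind r <;> simp_all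
    simp [nodalHat, nodal, hr, hat, this]
  -- The velocity averages control the face means of the pressure. Edges and corners no longer
  -- contribute, so each mean is a multiple of one face midpoint value.
  have hF : ∀ a, faceMean Δ k qhat a 3 = 0 := by
    intro a
    have h := congrFun hE (.A, a.castSucc)
    rw [evolution_average_velocity] at h
    simpa [hc', hΔ', ht'] using h
  have pFx : qhat (.Fx, 3) = 0 := by
    have h := hF 0
    rw [faceMean, Finset.sum_eq_single ![2, 1, 1]] at h
    · rw [← nodalHat_loc Δ k qhat 3 .Fx (by decide), Dof.loc]
      have e : Finset.univ.erase (0 : Fin 3) = {1, 2} := by decide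
      simpa [e, simpson] using h
    · intro r hr hne
      rw [hat_eq r, mul_zero] <;> revert hr hne <;> revert r <;> decide
    · simp
  have pFy : qhat (.Fy, 3) = 0 := by
    have h := hF 1
    rw [faceMean, Finset.sum_eq_single ![1, 2, 1]] at h
    · rw [← nodalHat_loc Δ k qhat 3 .Fy (by decide), Dof.loc]
      have e : Finset.univ.erase (1 : Fin 3) = {0, 2} := by decide
      simpa [e, simpson] using h
    · intro r hr hne
      rw [hat_eq r, mul_zero] <;> revert hr hne <;> revert r <;> decide
    · simp
  have pFz : qhat (.Fz, 3) = 0 := by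
    have h := hF 2
    rw [faceMean, Finset.sum_eq_single ![1, 1, 2]] at h
    · rw [← nodalHat_loc Δ k qhat 3 .Fz (by decide), Dof.loc]
      have e : Finset.univ.erase (2 : Fin 3) = {0, 1} := by decide
      simpa [e, simpson] using h
    · intro r hr hne
      rw [hat_eq r, mul_zero] <;> revert hr hne <;> revert r <;> decide
    · simp
  have hp : ∀ X, X ≠ .A → qhat (X, 3) = 0 := by
    intro X hX
    cases X <;> simp_all
  -- The pressure reconstruction is now a multiple of the central bubble, whose derivative in
  -- direction `a` can be nonzero only on the line through the centre parallel to `a`.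
  obtain ⟨m, hm⟩ : ∃ m, nodalHat Δ k qhat 3 = Pi.single centre m := by
    refine ⟨nodalHat Δ k qhat 3 centre, ?_⟩
    funext r
    by_cases hr : r = centre
    · subst hr; simp
    · have hA := kind_ne_A r hr
      simp [nodalHat, nodal, hr, hat, hp _ hA]
  have hm0 : ∀ a r, nodalDeriv Δ a (nodalHat Δ k qhat 3) r =
      if Function.update r a 1 = centre then (Δ a : ℂ)⁻¹ * diffMat (r a) 1 * m else 0 := by
    intro a r
    rw [nodalDeriv, hm, Finset.sum_eq_single 1]
    · rw [Pi.single_apply]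
      split_ifs <;> ring
    · intro i _ hi
      rw [Pi.single_eq_of_ne (update_ne_centre r a i hi), mul_zero]
    · simp
  set g := nodalHat Δ k qhat with hg
  set t := transl Δ k with htt
  have hm1 : ∀ a r, r a = 2 → rightDeriv Δ k a (g 3) r =
      if Function.update r a 1 = centre then 4 * t a * (Δ a : ℂ)⁻¹ * m else 0 := by
    intro a r hr
    rw [rightDeriv, if_pos hr, hm0, Function.update_idem, Function.update_self]
    split_ifs
    · simp [diffMat]; ring
    · simp
  -- At a face midpoint the bubble has slopes `-4m/Δ_a` on the left and `4 t_a m/Δ_a` on the right;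
  -- the jump of the normal velocity derivative must balance their sum.
  have hJ : ∀ (X : Dof) (a : Fin 3), X ≠ .A → X.loc a = 2 → jump Δ t a (g a.castSucc) X.loc =
      if Function.update X.loc a 1 = centre then 4 * (1 - t a) * (Δ a : ℂ)⁻¹ * m else 0 := by
    intro X a hX ha
    have h := congrFun hE (X, a.castSucc)
    rw [evolution_point_velocity c Δ k hΔ qhat X hX, ← hg, hm1 a _ ha, hm0 a, rightDeriv_eq,
      if_pos ha] at h
    have h2 : jump Δ t a (g a.castSucc) X.loc =
      - ((if Function.update X.loc a 1 = centre then (Δ a : ℂ)⁻¹ * diffMat (X.loc a) 1 * m else 0) +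
        if Function.update X.loc a 1 = centre then 4 * t a * (Δ a : ℂ)⁻¹ * m else 0) := by
      have h1 : (c : ℂ) / 2 ≠ 0 := by simpa using hc'
      have := (mul_eq_zero.mp h).resolve_left h1
      linear_combination this
    rw [h2, ha]
    split_ifs
    · simp [diffMat]; ring
    · simp
  have hd : ∀ X : Dof, X ≠ .A → nodalDiv Δ g X.loc =
      ∑ a, if Function.update X.loc a 1 = centre then 4 * (Δ a : ℂ)⁻¹ * m else 0 := by
    intro X hX
    have h := congrFun hE (X, 3)
    have h1 : (c : ℂ) / 2 ≠ 0 := by simpa using hc'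
    rw [evolution_point_pressure c Δ k hΔ qhat X hX, ← hg] at h
    have h2 := (mul_eq_zero.mp h).resolve_left h1
    have h3 : ∀ a : Fin 3, nodalDeriv Δ a (g a.castSucc) X.loc + nodalDeriv Δ a (g 3) X.loc +
        (rightDeriv Δ k a (g a.castSucc) X.loc - rightDeriv Δ k a (g 3) X.loc) =
        2 * nodalDeriv Δ a (g a.castSucc) X.loc -
          2 * if Function.update X.loc a 1 = centre then 4 * (Δ a : ℂ)⁻¹ * m else 0 := by
      intro a
      by_cases ha : X.loc a = 2
      · rw [hm1 a _ ha, rightDeriv_eq, if_pos ha, hJ X a hX ha, hm0, ha]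
        split_ifs
        · simp [diffMat]; ring
        · ring
      -- Degrees of freedom of the cell have coordinates 1 or 2 only. If the coordinate is already
      -- 1, the update changes nothing, and only the average sits at the centre.
      · have hne : Function.update X.loc a 1 ≠ centre := by
          clear h h2
          revert ha hX
          revert a X
          decide
        have e : ∀ f, rightDeriv Δ k a f X.loc = nodalDeriv Δ a f X.loc := fun f => by
          rw [rightDeriv, if_neg ha]
        rw [e, e, if_neg hne]
        ring
    rw [Finset.sum_congr rfl fun a _ => h3 a, Finset.sum_sub_distrib, ← Finset.mul_sum,
      ← Finset.mul_sum, ← mul_sub] at h2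
    have h4 := (mul_eq_zero.mp h2).resolve_left two_ne_zero
    rw [nodalDiv]
    exact sub_eq_zero.mp h4
  have dmean : ∑ r : Loc, ((∏ b, simpson (r b) : ℝ) : ℂ) * nodalDiv Δ g r = 0 := by
    have h := congrFun hE (.A, 3)
    rw [evolution_average_pressure_eq_mean] at h
    exact (mul_eq_zero.mp h).resolve_left hc'
  have dl0 := nodalDiv_left_zero Δ hq t0
  have dl1 := nodalDiv_left_one Δ hq t0
  have dl2 := nodalDiv_left_two Δ hq t0
  have jl10 := (hq 1).jump_one_zero Δ
  have jl20 := (hq 2).jump_two_zero Δ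
  have jl21 := (hq 2).jump_two_one Δ
  have j0Ey : jump Δ t 0 (g 0) ![2, 1, 2] = 0 :=
    (hJ .Ey 0 (by decide) rfl).trans (if_neg (by decide))
  have j0Ez : jump Δ t 0 (g 0) ![2, 2, 1] = 0 :=
    (hJ .Ez 0 (by decide) rfl).trans (if_neg (by decide))
  have j0Fx : jump Δ t 0 (g 0) ![2, 1, 1] = 4 * (1 - t 0) * (Δ 0 : ℂ)⁻¹ * m :=
    (hJ .Fx 0 (by decide) rfl).trans (if_pos (by decide))
  have j0N : jump Δ t 0 (g 0) ![2, 2, 2] = 0 :=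
    (hJ .N 0 (by decide) rfl).trans (if_neg (by decide))
  have j1Ex : jump Δ t 1 (g 1) ![1, 2, 2] = 0 :=
    (hJ .Ex 1 (by decide) rfl).trans (if_neg (by decide))
  have j1Ez : jump Δ t 1 (g 1) ![2, 2, 1] = 0 :=
    (hJ .Ez 1 (by decide) rfl).trans (if_neg (by decide))
  have j1Fy : jump Δ t 1 (g 1) ![1, 2, 1] = 4 * (1 - t 1) * (Δ 1 : ℂ)⁻¹ * m :=
    (hJ .Fy 1 (by decide) rfl).trans (if_pos (by decide))
  have j1N : jump Δ t 1 (g 1) ![2, 2, 2] = 0 :=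
    (hJ .N 1 (by decide) rfl).trans (if_neg (by decide))
  have j2Ex : jump Δ t 2 (g 2) ![1, 2, 2] = 0 :=
    (hJ .Ex 2 (by decide) rfl).trans (if_neg (by decide))
  have j2Ey : jump Δ t 2 (g 2) ![2, 1, 2] = 0 :=
    (hJ .Ey 2 (by decide) rfl).trans (if_neg (by decide))
  have j2Fz : jump Δ t 2 (g 2) ![1, 1, 2] = 4 * (1 - t 2) * (Δ 2 : ℂ)⁻¹ * m :=
    (hJ .Fz 2 (by decide) rfl).trans (if_pos (by decide))
  have j2N : jump Δ t 2 (g 2) ![2, 2, 2] = 0 :=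
    (hJ .N 2 (by decide) rfl).trans (if_neg (by decide))
  have dEx : nodalDiv Δ g ![1, 2, 2] = 0 := by
    have h := hd .Ex (by decide)
    rw [Fin.sum_univ_three, if_neg (show ¬ Function.update Dof.Ex.loc 0 1 = centre by decide), if_neg (show ¬ Function.update Dof.Ex.loc 1 1 = centre by decide), if_neg (show ¬ Function.update Dof.Ex.loc 2 1 = centre by decide)] at h
    simpa [Dof.loc] using h
  have dEy : nodalDiv Δ g ![2, 1, 2] = 0 := by
    have h := hd .Ey (by decide)
    rw [Fin.sum_univ_three, if_neg (show ¬ Function.update Dof.Ey.loc 0 1 = centre by decide), if_neg (show ¬ Function.update Dof.Ey.loc 1 1 = centre by decide), if_neg (show ¬ Function.update Dof.Ey.loc 2 1 = centre by decide)] at h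
    simpa [Dof.loc] using h
  have dEz : nodalDiv Δ g ![2, 2, 1] = 0 := by
    have h := hd .Ez (by decide)
    rw [Fin.sum_univ_three, if_neg (show ¬ Function.update Dof.Ez.loc 0 1 = centre by decide), if_neg (show ¬ Function.update Dof.Ez.loc 1 1 = centre by decide), if_neg (show ¬ Function.update Dof.Ez.loc 2 1 = centre by decide)] at h
    simpa [Dof.loc] using h
  have dFx : nodalDiv Δ g ![2, 1, 1] = 4 * (Δ 0 : ℂ)⁻¹ * m := by
    have h := hd .Fx (by decide)
    rw [Fin.sum_univ_three, if_pos (show Function.update Dof.Fx.loc 0 1 = centre by decide), if_neg (show ¬ Function.update Dof.Fx.loc 1 1 = centre by decide), if_neg (show ¬ Function.update Dof.Fx.loc 2 1 = centre by decide)] at h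
    simpa [Dof.loc] using h
  have dFy : nodalDiv Δ g ![1, 2, 1] = 4 * (Δ 1 : ℂ)⁻¹ * m := by
    have h := hd .Fy (by decide)
    rw [Fin.sum_univ_three, if_neg (show ¬ Function.update Dof.Fy.loc 0 1 = centre by decide), if_pos (show Function.update Dof.Fy.loc 1 1 = centre by decide), if_neg (show ¬ Function.update Dof.Fy.loc 2 1 = centre by decide)] at h
    simpa [Dof.loc] using h
  have dFz : nodalDiv Δ g ![1, 1, 2] = 4 * (Δ 2 : ℂ)⁻¹ * m := by
    have h := hd .Fz (by decide)
    rw [Fin.sum_univ_three, if_neg (show ¬ Function.update Dof.Fz.loc 0 1 = centre by decide), if_neg (show ¬ Function.update Dof.Fz.loc 1 1 = centre by decide), if_pos (show Function.update Dof.Fz.loc 2 1 = centre by decide)] at h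
    simpa [Dof.loc] using h
  have dN : nodalDiv Δ g ![2, 2, 2] = 0 := by
    have h := hd .N (by decide)
    rw [Fin.sum_univ_three, if_neg (show ¬ Function.update Dof.N.loc 0 1 = centre by decide), if_neg (show ¬ Function.update Dof.N.loc 1 1 = centre by decide), if_neg (show ¬ Function.update Dof.N.loc 2 1 = centre by decide)] at h
    simpa [Dof.loc] using h
  -- Subtracting the jump `4(1 - t)m/Δ` leaves `4tm/Δ`; division by `t` makes the divergence equal
  -- on opposite face midpoints.
  have lFx : nodalDiv Δ g ![0, 1, 1] = 4 * (Δ 0 : ℂ)⁻¹ * m := by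
    rw [dl0, dFx, j0Fx]
    have := t0 0
    field_simp
    ring
  have lFy : nodalDiv Δ g ![1, 0, 1] = 4 * (Δ 1 : ℂ)⁻¹ * m := by
    rw [dl1, dFy, j1Fy]
    have := t0 1
    field_simp
    ring
  have lFz : nodalDiv Δ g ![1, 1, 0] = 4 * (Δ 2 : ℂ)⁻¹ * m := by
    rw [dl2, dFz, j2Fz]
    have := t0 2
    field_simp
    ring
  have second := second_difference_nodalDiv Δ g
  rw [sum_loc] at second dmean
  simp only [Fin.sum_univ_three, lFx, lFy, lFz] at second dmean
  simp only [dl2] at second dmean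
  simp only [dl1] at second dmean
  simp [Fin.prod_univ_three, simpson, dEx, dEy, dEz, dFx, dFy,
    dFz, dN, dl0, jl10, jl20, jl21, j0Ey, j0Ez, j0N, j1Ex, j1Ez, j1N, j2Ex, j2Ey, j2N] at second dmean
  have hsum : (Δ 0 : ℂ)⁻¹ + (Δ 1 : ℂ)⁻¹ + (Δ 2 : ℂ)⁻¹ ≠ 0 := by
    have h : 0 < (Δ 0)⁻¹ + (Δ 1)⁻¹ + (Δ 2)⁻¹ := by
      have := fun a => inv_pos.mpr (hΔ a)
      have h0 := this 0
      have h1 := this 1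
      have h2 := this 2
      positivity
    exact_mod_cast h.ne'
  -- Put `S = ∑ Δ_a⁻¹` and let `D` be the central divergence. The second difference gives `32mS - 8D
  -- = 0` and the mean gives `(16mS + 8D)/27 = 0`. The chosen weights cancel `D` and leave `mS = 0`.
  have hmz : m = 0 := by
    refine (mul_eq_zero.mp ?_).resolve_left hsum
    linear_combination (1 / 48) * second + (27 / 48) * dmean
  subst hmz
  constructor
  · exact eq_zero_of_nodalHat Δ k qhat 3 fun X => by rw [← hg, hm]; simp
  · refine nodalDiv_eq_zero Δ hq t0 (fun X hX => ?_) fun X a ha => ?_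
    · rw [hd X hX]; simp
    · rw [hJ X a (by rintro rfl; revert ha; revert a; decide) ha]; simp

/-! ### The dimension of the kernel -/

/-- The nodal value `r` of the component `l` as a linear functional of the amplitudes. -/
def nodalHatLin (Δ k : Fin 3 → ℝ) (l : Fin 4) (r : Loc) : (Dof × Fin 4 → ℂ) →ₗ[ℂ] ℂ where
  toFun q := nodalHat Δ k q l r
  map_add' q q' := by
    simp only [nodalHat, nodal, hat, Pi.add_apply, mul_add, Finset.sum_add_distrib]
    split_ifs <;> ring
  map_smul' s q := by
    simp only [nodalHat, nodal, hat, Pi.smul_apply, smul_eq_mul, RingHom.id_apply, mul_left_comm _ s,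
      ← Finset.mul_sum]
    split_ifs <;> ring

/-- The derivative in direction `a` at the node `r` of the component `l`. -/
def nodalDerivLin (Δ k : Fin 3 → ℝ) (a : Fin 3) (l : Fin 4) (r : Loc) :
    (Dof × Fin 4 → ℂ) →ₗ[ℂ] ℂ :=
  (Δ a : ℂ)⁻¹ • ∑ i, diffMat (r a) i • nodalHatLin Δ k l (Function.update r a i)

theorem nodalDerivLin_apply (Δ k : Fin 3 → ℝ) (a : Fin 3) (l : Fin 4) (r : Loc)
    (q : Dof × Fin 4 → ℂ) :
    nodalDerivLin Δ k a l r q = nodalDeriv Δ a (nodalHat Δ k q l) r := by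
  simp [nodalDerivLin, nodalDeriv, nodalHatLin]

/-- Vanishing pressure, divergence and jumps at the degrees of freedom of the cell. -/
def kernelConditions (Δ k : Fin 3 → ℝ) : (Dof × Fin 4 → ℂ) →ₗ[ℂ]
    (Dof ⊕ {X : Dof // X ≠ .A} ⊕ {p : Dof × Fin 3 // p.1.loc p.2 = 2} → ℂ) :=
  LinearMap.pi fun i => match i with
    | .inl X => LinearMap.proj (X, 3)
    | .inr (.inl X) => ∑ a : Fin 3, nodalDerivLin Δ k a a.castSucc X.1.loc
    | .inr (.inr p) => nodalDerivLin Δ k p.1.2 p.1.2.castSucc (Function.update p.1.1.loc p.1.2 2) -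
        transl Δ k p.1.2 •
          nodalDerivLin Δ k p.1.2 p.1.2.castSucc (Function.update p.1.1.loc p.1.2 0)

/-- Finitely many conditions at the nodes belonging to the cell suffice, by `nodalDiv_eq_zero`; no
assumption on the translation factors enters, so the resulting lower bound covers `t_a = 1` too. -/
theorem mem_ker_kernelConditions (Δ k : Fin 3 → ℝ) (q : Dof × Fin 4 → ℂ)
    (hq : q ∈ LinearMap.ker (kernelConditions Δ k)) :
    (∀ X, q (X, 3) = 0) ∧ ∀ r, nodalDiv Δ (nodalHat Δ k q) r = 0 := by
  rw [LinearMap.mem_ker] at hq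
  refine ⟨fun X => congrFun hq (.inl X),
    nodalDiv_eq_zero Δ (quasiPeriodic_nodalHat Δ k q) (transl_ne_zero Δ k) (fun X hX => ?_)
      fun X a ha => ?_⟩
  · have h := congrFun hq (.inr (.inl ⟨X, hX⟩))
    simpa [kernelConditions, nodalDerivLin_apply, nodalDiv] using h
  · have h := congrFun hq (.inr (.inr ⟨(X, a), ha⟩))
    simpa [kernelConditions, nodalDerivLin_apply, jump] using h

theorem five_le_kerDim (c : ℝ) (Δ k : Fin 3 → ℝ) (hΔ : ∀ a, 0 < Δ a) :
    5 ≤ kerDim (evolutionMatrix c Δ k) := by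
  have h1 : LinearMap.ker (kernelConditions Δ k) ≤
      LinearMap.ker (Matrix.toLin' (evolutionMatrix c Δ k)) := by
    intro q hq
    obtain ⟨hp, hd⟩ := mem_ker_kernelConditions Δ k q hq
    rw [LinearMap.mem_ker, Matrix.toLin'_apply]
    exact kernel_of_divergence_free c Δ k hΔ q hp hd
  refine le_trans ?_ (Submodule.finrank_mono h1)
  have h2 := LinearMap.finrank_range_add_finrank_ker (kernelConditions Δ k)
  have h3 := Submodule.finrank_le (LinearMap.range (kernelConditions Δ k))
  rw [Module.finrank_fintype_fun_eq_card] at h2 h3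
  have e1 : Fintype.card (Dof × Fin 4) = 32 := by decide
  -- Eight pressures, seven point divergences, and jumps: three at the corner, two on each of three
  -- edges, one on each of three faces.
  have e2 : Fintype.card
      (Dof ⊕ {X : Dof // X ≠ .A} ⊕ {p : Dof × Fin 3 // p.1.loc p.2 = 2}) = 27 := by decide
  omega

theorem mem_ker_evolution_iff (c : ℝ) (hc : 0 < c) (Δ k : Fin 3 → ℝ) (hΔ : ∀ a, 0 < Δ a)
    (ht : ∀ a, transl Δ k a ≠ 1) (q : Dof × Fin 4 → ℂ) :
    q ∈ LinearMap.ker (Matrix.toLin' (evolutionMatrix c Δ k)) ↔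
      (∀ X, q (X, 3) = 0) ∧ ∀ r, nodalDiv Δ (nodalHat Δ k q) r = 0 := by
  rw [LinearMap.mem_ker, Matrix.toLin'_apply]
  exact ⟨divergence_free_of_kernel c hc Δ k hΔ ht q,
    fun h => kernel_of_divergence_free c Δ k hΔ q h.1 h.2⟩

section QP

variable {t : Fin 3 → ℂ} {f : Loc → ℂ}

/-- Without a jump, the derivatives at the two ends are proportional. The derivative of a quadratic
is affine, so its midpoint value is the mean of its end values. -/
theorem nodalDeriv_midpoint (Δ : Fin 3 → ℝ) (a : Fin 3) (ht : t a ≠ 0) (r : Loc)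
    (hJ : jump Δ t a f r = 0) (hD : nodalDeriv Δ a f (Function.update r a 2) = 0) :
    nodalDeriv Δ a f (Function.update r a 0) = 0 ∧
      nodalDeriv Δ a f (Function.update r a 1) = 0 := by
  have h0 : nodalDeriv Δ a f (Function.update r a 0) = 0 := by
    rw [jump, hD, zero_sub, neg_eq_zero] at hJ
    exact (mul_eq_zero.mp hJ).resolve_left ht
  refine ⟨h0, ?_⟩
  simp [nodalDeriv, diffMat, Fin.sum_univ_three] at h0 hD ⊢
  rcases h0 with h0 | h0
  · exact Or.inl h0
  · rcases hD with hD | hD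
    · exact Or.inl hD
    · right
      linear_combination (1 / 2) * h0 + (1 / 2) * hD

/-- The derivative vanishes along the whole line, so the quadratic is constant there;
quasi-periodicity with `t_a ≠ 1` makes that constant zero. -/
theorem QuasiPeriodic.eq_zero_of_nodalDeriv (Δ : Fin 3 → ℝ) (hΔ : ∀ a, 0 < Δ a)
    (h : QuasiPeriodic t f) (a : Fin 3) (ht : t a ≠ 0) (ht1 : t a ≠ 1) (r : Loc)
    (hJ : jump Δ t a f r = 0) (hD : nodalDeriv Δ a f (Function.update r a 2) = 0) :
    f (Function.update r a 1) = 0 ∧ f (Function.update r a 2) = 0 := by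
  have hΔ' : (Δ a : ℂ) ≠ 0 := by exact_mod_cast (hΔ a).ne'
  obtain ⟨h0, h1⟩ := nodalDeriv_midpoint Δ a ht r hJ hD
  have hs : (t a)⁻¹ ≠ 1 := by simpa using ht1
  simp [nodalDeriv, diffMat, Fin.sum_univ_three, hΔ', h a r] at h0 h1
  have h2 : f (Function.update r a 2) = 0 := by
    refine (mul_eq_zero.mp ?_).resolve_left (sub_ne_zero.mpr hs)
    linear_combination -h1
  refine ⟨?_, h2⟩
  rw [h2] at h0
  simpa using h0

end QP

/-- A set of five linear functionals that determine the elements of the kernel. -/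
def kernelCoordinates (Δ k : Fin 3 → ℝ) : (Dof × Fin 4 → ℂ) →ₗ[ℂ] (Fin 5 → ℂ) :=
  LinearMap.pi ![nodalDerivLin Δ k 0 0 ![2, 2, 2], nodalDerivLin Δ k 1 1 ![2, 2, 2],
    nodalDerivLin Δ k 0 0 ![2, 1, 2], nodalDerivLin Δ k 0 0 ![2, 2, 1],
    nodalDerivLin Δ k 1 1 ![1, 2, 2]]

theorem kerDim_le_five (c : ℝ) (hc : 0 < c) (Δ k : Fin 3 → ℝ) (hΔ : ∀ a, 0 < Δ a)
    (ht : ∀ a, transl Δ k a ≠ 1) : kerDim (evolutionMatrix c Δ k) ≤ 5 := by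
  have hinj : Function.Injective ((kernelCoordinates Δ k).domRestrict
      (LinearMap.ker (Matrix.toLin' (evolutionMatrix c Δ k)))) := by
    rw [injective_iff_map_eq_zero]
    rintro ⟨q, hq⟩ h0
    obtain ⟨hp, hd⟩ := (mem_ker_evolution_iff c hc Δ k hΔ ht q).mp hq
    have t0 := transl_ne_zero Δ k
    have hqp := quasiPeriodic_nodalHat Δ k q
    have hJ : ∀ a r, jump Δ (transl Δ k) a (nodalHat Δ k q a.castSucc) r = 0 := by
      intro a r
      have h := nodalDiv_left Δ hqp t0 a r
      rw [hd, hd] at h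
      simpa [t0] using h
    have hm : ∀ a r, nodalDeriv Δ a (nodalHat Δ k q a.castSucc) (Function.update r a 2) = 0 →
        nodalDeriv Δ a (nodalHat Δ k q a.castSucc) (Function.update r a 1) = 0 :=
      fun a r h => (nodalDeriv_midpoint Δ a (t0 a) r (hJ a r) h).2
    have mx : ∀ j l, nodalDeriv Δ 0 (nodalHat Δ k q 0) ![2, j, l] = 0 →
        nodalDeriv Δ 0 (nodalHat Δ k q 0) ![1, j, l] = 0 := fun j l h => by
      have := hm 0 ![2, j, l]
      simp only [update_vec_zero] at this
      exact this h
    have my : ∀ i l, nodalDeriv Δ 1 (nodalHat Δ k q 1) ![i, 2, l] = 0 →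
        nodalDeriv Δ 1 (nodalHat Δ k q 1) ![i, 1, l] = 0 := fun i l h => by
      have := hm 1 ![i, 2, l]
      simp only [update_vec_one] at this
      exact this h
    have mz : ∀ i j, nodalDeriv Δ 2 (nodalHat Δ k q 2) ![i, j, 2] = 0 →
        nodalDeriv Δ 2 (nodalHat Δ k q 2) ![i, j, 1] = 0 := fun i j h => by
      have := hm 2 ![i, j, 2]
      simp only [update_vec_two] at this
      exact this h
    have hdiv : ∀ r, nodalDeriv Δ 0 (nodalHat Δ k q 0) r + nodalDeriv Δ 1 (nodalHat Δ k q 1) r +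
        nodalDeriv Δ 2 (nodalHat Δ k q 2) r = 0 := fun r => by
      have := hd r
      rw [nodalDiv, Fin.sum_univ_three] at this
      exact this
    have c0 : ∀ i, kernelCoordinates Δ k q i = 0 := fun i => congrFun h0 i
    have x22 : nodalDeriv Δ 0 (nodalHat Δ k q 0) ![2, 2, 2] = 0 := by
      rw [← nodalDerivLin_apply]; exact c0 0
    have y22 : nodalDeriv Δ 1 (nodalHat Δ k q 1) ![2, 2, 2] = 0 := by
      rw [← nodalDerivLin_apply]; exact c0 1
    have x12 : nodalDeriv Δ 0 (nodalHat Δ k q 0) ![2, 1, 2] = 0 := by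
      rw [← nodalDerivLin_apply]; exact c0 2
    have x21 : nodalDeriv Δ 0 (nodalHat Δ k q 0) ![2, 2, 1] = 0 := by
      rw [← nodalDerivLin_apply]; exact c0 3
    have y12 : nodalDeriv Δ 1 (nodalHat Δ k q 1) ![1, 2, 2] = 0 := by
      rw [← nodalDerivLin_apply]; exact c0 4
    -- Propagation from the corner to the edges and then to the face midpoints: at each node two of
    -- the three derivatives are already known to vanish, either as coordinates or as midpoint
    -- values of lines treated before, and the divergence gives the third.
    have z22 := hdiv ![2, 2, 2]
    rw [x22, y22, zero_add, zero_add] at z22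
    have z21 := hdiv ![2, 1, 2]
    rw [x12, my _ _ y22, zero_add, zero_add] at z21
    have y21 := hdiv ![2, 2, 1]
    rw [x21, mz _ _ z22, zero_add, add_zero] at y21
    have z12 := hdiv ![1, 2, 2]
    rw [mx _ _ x22, y12, zero_add, zero_add] at z12
    have x11 := hdiv ![2, 1, 1]
    rw [my _ _ y21, mz _ _ z21, add_zero, add_zero] at x11
    have y11 := hdiv ![1, 2, 1]
    rw [mx _ _ x21, mz _ _ z12, zero_add, add_zero] at y11
    have z11 := hdiv ![1, 1, 2]
    rw [mx _ _ x12, my _ _ y12, zero_add, zero_add] at z11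
    -- All twelve normal derivatives at right ends now vanish, so the velocity components vanish on
    -- all twelve corresponding lines. These lines contain every node of the cell's own degrees of
    -- freedom, including the centre.
    have hz := fun a r => (hqp (Fin.castSucc a)).eq_zero_of_nodalDeriv Δ hΔ a (t0 a) (ht a) r (hJ a r)
    have zx : ∀ j l, nodalDeriv Δ 0 (nodalHat Δ k q 0) ![2, j, l] = 0 →
        nodalHat Δ k q 0 ![1, j, l] = 0 ∧ nodalHat Δ k q 0 ![2, j, l] = 0 := fun j l h => by
      have := hz 0 ![2, j, l]
      simp only [update_vec_zero] at this
      exact this h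
    have zy : ∀ i l, nodalDeriv Δ 1 (nodalHat Δ k q 1) ![i, 2, l] = 0 →
        nodalHat Δ k q 1 ![i, 1, l] = 0 ∧ nodalHat Δ k q 1 ![i, 2, l] = 0 := fun i l h => by
      have := hz 1 ![i, 2, l]
      simp only [update_vec_one] at this
      exact this h
    have zz : ∀ i j, nodalDeriv Δ 2 (nodalHat Δ k q 2) ![i, j, 2] = 0 →
        nodalHat Δ k q 2 ![i, j, 1] = 0 ∧ nodalHat Δ k q 2 ![i, j, 2] = 0 := fun i j h => by
      have := hz 2 ![i, j, 2]
      simp only [update_vec_two] at this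
      exact this h
    have u := eq_zero_of_nodalHat Δ k q 0 (fun X => by
      cases X
      exacts [(zx _ _ x11).1, (zx _ _ x22).1, (zx _ _ x12).2, (zx _ _ x21).2, (zx _ _ x11).2,
        (zx _ _ x21).1, (zx _ _ x12).1, (zx _ _ x22).2])
    have v := eq_zero_of_nodalHat Δ k q 1 (fun X => by
      cases X
      exacts [(zy _ _ y11).1, (zy _ _ y12).2, (zy _ _ y22).1, (zy _ _ y21).2, (zy _ _ y21).1,
        (zy _ _ y11).2, (zy _ _ y12).1, (zy _ _ y22).2])
    have w := eq_zero_of_nodalHat Δ k q 2 (fun X => by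
      cases X
      exacts [(zz _ _ z11).1, (zz _ _ z12).2, (zz _ _ z21).2, (zz _ _ z22).1, (zz _ _ z21).1,
        (zz _ _ z12).1, (zz _ _ z11).2, (zz _ _ z22).2])
    ext ⟨X, l⟩
    fin_cases l
    exacts [u X, v X, w X, hp X]
  have h := LinearMap.finrank_le_finrank_of_injective hinj
  rwa [Module.finrank_fin_fun] at h

theorem kerDim_eq_five (c : ℝ) (hc : 0 < c) (Δ k : Fin 3 → ℝ) (hΔ : ∀ a, 0 < Δ a)
    (ht : ∀ a, transl Δ k a ≠ 1) : kerDim (evolutionMatrix c Δ k) = 5 :=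
  le_antisymm (kerDim_le_five c hc Δ k hΔ ht) (five_le_kerDim c Δ k hΔ)

/-! ### Stationarity preservation -/

theorem exists_transl_ne_one (Δ : Fin 3 → ℝ) (hΔ : ∀ a, 0 < Δ a) :
    ∃ k, ∀ a, transl Δ k a ≠ 1 := by
  -- The highest grid frequency: all translation factors equal `-1`.
  refine ⟨fun a => Real.pi / Δ a, fun a => ?_⟩
  rw [transl, div_mul_cancel₀ _ (hΔ a).ne', mul_comm, Complex.exp_pi_mul_I]
  norm_num

theorem one_le_kerDim_acousticSymbol (c : ℝ) (k : Fin 3 → ℝ) :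
    1 ≤ kerDim (acousticSymbol c k) := by
  have h : (acousticSymbol c k).det = 0 := by
    rw [acousticSymbol, Matrix.det_succ_row_zero]
    simp [Fin.sum_univ_succ, Matrix.det_fin_three, jac, Fin.succAbove]
  obtain ⟨v, hv, h0⟩ := Matrix.exists_mulVec_eq_zero_iff.mpr h
  rw [kerDim, Nat.one_le_iff_ne_zero, ← Nat.pos_iff_ne_zero, Module.finrank_pos_iff_exists_ne_zero]
  exact ⟨⟨v, by simpa using h0⟩, fun h => hv (congrArg Subtype.val h)⟩

theorem kerDim_acousticSymbol_le (c : ℝ) (hc : 0 < c) :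
    kerDim (acousticSymbol c (Pi.single 0 1)) ≤ 2 := by
  have hc' : (c : ℂ) ≠ 0 := by exact_mod_cast hc.ne'
  let L : (Fin 4 → ℂ) →ₗ[ℂ] (Fin 2 → ℂ) := LinearMap.pi ![LinearMap.proj 1, LinearMap.proj 2]
  have hinj : Function.Injective
      (L.domRestrict (LinearMap.ker (Matrix.toLin' (acousticSymbol c (Pi.single 0 1))))) := by
    rw [injective_iff_map_eq_zero]
    rintro ⟨q, hq⟩ h0
    rw [LinearMap.mem_ker, Matrix.toLin'_apply] at hq
    have h1 : q 1 = 0 := congrFun h0 0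
    have h2 : q 2 = 0 := congrFun h0 1
    have e0 := congrFun hq 0
    have e3 := congrFun hq 3
    simp [acousticSymbol, Matrix.mulVec, dotProduct, Fin.sum_univ_succ, jac, hc'] at e0 e3
    ext l
    fin_cases l
    · simpa using e3
    · exact h1
    · exact h2
    · simpa using e0
  have h := LinearMap.finrank_le_finrank_of_injective hinj
  rwa [Module.finrank_fin_fun] at h

/-- The minimal kernel dimension of the method is exactly 5, and the bounds `1 ≤ S ≤ 2` already give
`S ≤ 5 ≤ 8S`. -/
theorem stationarityPreserving (c : ℝ) (hc : 0 < c) (Δ : Fin 3 → ℝ) (hΔ : ∀ a, 0 < Δ a) :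
    StationarityPreserving (acousticSymbol c) (evolutionMatrix c Δ) := by
  obtain ⟨k, hk⟩ := exists_transl_ne_one Δ hΔ
  have hJ : (⨅ k, kerDim (acousticSymbol c k)) ≤ 2 :=
    (ciInf_le (OrderBot.bddBelow _) (Pi.single 0 1)).trans (kerDim_acousticSymbol_le c hc)
  have hJ' : 1 ≤ ⨅ k, kerDim (acousticSymbol c k) :=
    le_ciInf fun k => one_le_kerDim_acousticSymbol c k
  have hE : (⨅ k, kerDim (evolutionMatrix c Δ k)) ≤ 5 :=
    (ciInf_le (OrderBot.bddBelow _) k).trans (kerDim_le_five c hc Δ k hΔ hk)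
  have hE' : 5 ≤ ⨅ k, kerDim (evolutionMatrix c Δ k) :=
    le_ciInf fun k => five_le_kerDim c Δ k hΔ
  have hcard : Fintype.card Dof = 8 := by decide
  refine ⟨by omega, ?_⟩
  rw [hcard]
  omega

/-! ### Almost all wave vectors are general -/

/-- Any two solutions differ by an integer multiple of `2π/Δ`. -/
theorem countable_transl_eq (Δ : ℝ) (hΔ : 0 < Δ) (z : ℂ) :
    {x : ℝ | Complex.exp (Complex.I * (x * Δ : ℝ)) = z}.Countable := by
  have hΔ' : (Δ : ℂ) ≠ 0 := by exact_mod_cast hΔ.ne'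
  by_cases h : ∃ x0 : ℝ, Complex.exp (Complex.I * (x0 * Δ : ℝ)) = z
  · obtain ⟨x0, rfl⟩ := h
    refine (Set.countable_range fun n : ℤ => x0 + n * (2 * Real.pi) / Δ).mono ?_
    intro x hx
    obtain ⟨n, hn⟩ := Complex.exp_eq_exp_iff_exists_int.mp hx
    refine ⟨n, ?_⟩
    have h1 : ((x * Δ : ℝ) : ℂ) = ((x0 * Δ + n * (2 * Real.pi) : ℝ) : ℂ) := by
      apply mul_left_cancel₀ Complex.I_ne_zero
      rw [hn]
      push_cast
      ring
    have h2 : x * Δ = x0 * Δ + n * (2 * Real.pi) := by exact_mod_cast h1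
    simp only
    field_simp
    linarith
  · convert Set.countable_empty (α := ℝ)
    ext x
    simp only [Set.mem_ofPred_eq, Set.mem_empty_iff_false, iff_false]
    exact fun hx => h ⟨x, hx⟩

/-- A measurable set all whose lines in direction `a` are countable is a null set. -/
theorem ae_of_countable_lines {n : ℕ} (a : Fin (n + 1)) (p : (Fin (n + 1) → ℝ) → Prop)
    (hm : MeasurableSet {k | p k})
    (hc : ∀ k : Fin n → ℝ, {x : ℝ | ¬ p (a.insertNth x k)}.Countable) : ∀ᵐ k, p k := by
  have hmp := MeasureTheory.volume_preserving_piFinSuccAbove (fun _ : Fin (n + 1) => ℝ) a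
  have hs := hmp.symm
  have hm' : MeasurableSet {z : ℝ × (Fin n → ℝ) | p (a.insertNth z.1 z.2)} := hs.measurable hm
  rw [← hs.map_eq, MeasureTheory.ae_map_iff hs.measurable.aemeasurable hm,
    MeasureTheory.Measure.volume_eq_prod]
  -- Fubini, with the order exchanged so that the coordinate `a` varies innermost.
  refine (MeasureTheory.Measure.ae_prod_iff_ae_ae hm').mpr
    ((MeasureTheory.Measure.ae_ae_comm (p := fun x k => p (a.insertNth x k)) hm').mpr ?_)
  exact Filter.Eventually.of_forall fun k =>
    MeasureTheory.ae_iff.mpr ((hc k).measure_zero MeasureTheory.volume)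

theorem measurable_transl (Δ : Fin 3 → ℝ) (a : Fin 3) : Measurable fun k => transl Δ k a := by
  unfold transl
  fun_prop

theorem ae_transl_ne (Δ : Fin 3 → ℝ) (hΔ : ∀ a, 0 < Δ a) (a : Fin 3) (z : ℂ) :
    ∀ᵐ k : Fin 3 → ℝ, transl Δ k a ≠ z := by
  refine ae_of_countable_lines a _ ?_ fun k => ?_
  · exact (measurableSet_eq_fun (measurable_transl Δ a) measurable_const).compl
  · simpa [transl] using countable_transl_eq (Δ a) (hΔ a) z

theorem ae_factor_ne_zero (Δ : Fin 3 → ℝ) (hΔ : ∀ a, 0 < Δ a) : ∀ᵐ k : Fin 3 → ℝ,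
    (transl Δ k 2) ^ 2 + 4 * transl Δ k 0 * (transl Δ k 2) ^ 2 +
      (transl Δ k 0) ^ 2 * (2 + transl Δ k 2 * (8 + 3 * transl Δ k 2)) ≠ 0 := by
  have h0 := measurable_transl Δ 0
  have h2 := measurable_transl Δ 2
  refine ae_of_countable_lines 0 _ ?_ fun k => ?_
  · exact (measurableSet_eq_fun (by fun_prop) measurable_const).compl
  · set z : ℂ := Complex.exp (Complex.I * (k 1 * Δ 2 : ℝ)) with hz
    have hz0 : z ≠ 0 := Complex.exp_ne_zero _
    let P : Polynomial ℂ := Polynomial.C (z ^ 2) + Polynomial.C (4 * z ^ 2) * Polynomial.X +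
      Polynomial.C (2 + z * (8 + 3 * z)) * Polynomial.X ^ 2
    -- For fixed `t_z` the factor is a polynomial in `t_x` with constant term `t_z² ≠ 0`, hence has
    -- finitely many roots, each attained for countably many `k_x`.
    have hP : P ≠ 0 := fun h => by
      have := congrArg (Polynomial.eval 0) h
      simp [P, hz0] at this
    have hcount : (⋃ w ∈ P.roots.toFinset,
        {x : ℝ | Complex.exp (Complex.I * (x * Δ 0 : ℝ)) = w}).Countable :=
      (Finset.countable_toSet _).biUnion fun w _ => countable_transl_eq (Δ 0) (hΔ 0) w
    refine hcount.mono fun x hx => ?_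
    simp only [Set.mem_iUnion, Set.mem_ofPred_eq, Multiset.mem_toFinset]
    refine ⟨_, ?_, rfl⟩
    rw [Polynomial.mem_roots hP]
    have hx' : transl Δ (Fin.insertNth 0 x k) 0 = Complex.exp (Complex.I * (x * Δ 0 : ℝ)) := by
      simp [transl]
    have hx2 : transl Δ (Fin.insertNth 0 x k) 2 = z := rfl
    simp only [Set.mem_ofPred_eq, not_not] at hx
    rw [hx2, hx'] at hx
    simp only [Polynomial.IsRoot, P, Polynomial.eval_add, Polynomial.eval_mul, Polynomial.eval_C,
      Polynomial.eval_X, Polynomial.eval_pow]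
    rw [← hx]
    ring

theorem ae_general (Δ : Fin 3 → ℝ) (hΔ : ∀ a, 0 < Δ a) : ∀ᵐ k : Fin 3 → ℝ, General Δ k := by
  have h : ∀ᵐ k : Fin 3 → ℝ, ∀ a, transl Δ k a ≠ 1 ∧ transl Δ k a ≠ -1 :=
    MeasureTheory.ae_all_iff.mpr fun a => (ae_transl_ne Δ hΔ a 1).and (ae_transl_ne Δ hΔ a (-1))
  filter_upwards [h, ae_factor_ne_zero Δ hΔ] with k h1 h2 using ⟨h1, h2⟩

/-! ### The explicit vectors -/

/-- The relations that characterise divergence-free reconstructions if no translation factor is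
`1` or `-1`. -/
structure DivergenceFreeRelations (dx dy dz x y z : ℂ) (q : Dof → Fin 4 → ℂ) : Prop where
  xN : q .Ex 0 = (1 + 6 * x + x ^ 2) / (4 * x * (1 + x)) * q .N 0
  xEy : q .Fz 0 = (1 + 6 * x + x ^ 2) / (4 * x * (1 + x)) * q .Ey 0
  xEz : q .Fy 0 = (1 + 6 * x + x ^ 2) / (4 * x * (1 + x)) * q .Ez 0
  xA : q .A 0 = (1 + 4 * x + x ^ 2) / (108 * x * (1 + x)) * ((1 + y⁻¹) * (1 + z⁻¹) * q .N 0 +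
    4 * (1 + y⁻¹) * q .Ez 0 + 4 * (1 + z⁻¹) * q .Ey 0 + 16 * q .Fx 0)
  yN : q .Ey 1 = (1 + 6 * y + y ^ 2) / (4 * y * (1 + y)) * q .N 1
  yEx : q .Fz 1 = (1 + 6 * y + y ^ 2) / (4 * y * (1 + y)) * q .Ex 1
  yEz : q .Fx 1 = (1 + 6 * y + y ^ 2) / (4 * y * (1 + y)) * q .Ez 1
  yA : q .A 1 = (1 + 4 * y + y ^ 2) / (108 * y * (1 + y)) * ((1 + x⁻¹) * (1 + z⁻¹) * q .N 1 +
    4 * (1 + x⁻¹) * q .Ez 1 + 4 * (1 + z⁻¹) * q .Ex 1 + 16 * q .Fy 1)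
  zN : q .Ez 2 = (1 + 6 * z + z ^ 2) / (4 * z * (1 + z)) * q .N 2
  zEx : q .Fy 2 = (1 + 6 * z + z ^ 2) / (4 * z * (1 + z)) * q .Ex 2
  zEy : q .Fx 2 = (1 + 6 * z + z ^ 2) / (4 * z * (1 + z)) * q .Ey 2
  zA : q .A 2 = (1 + 4 * z + z ^ 2) / (108 * z * (1 + z)) * ((1 + x⁻¹) * (1 + y⁻¹) * q .N 2 +
    4 * (1 + x⁻¹) * q .Ey 2 + 4 * (1 + y⁻¹) * q .Ex 2 + 16 * q .Fz 2)
  divN : 2 * (x - 1) / (dx * (1 + x)) * q .N 0 + 2 * (y - 1) / (dy * (1 + y)) * q .N 1 +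
    2 * (z - 1) / (dz * (1 + z)) * q .N 2 = 0
  divEx : (x - 1) / (dx * x) * q .N 0 + 2 * (y - 1) / (dy * (1 + y)) * q .Ex 1 +
    2 * (z - 1) / (dz * (1 + z)) * q .Ex 2 = 0
  divEy : 2 * (x - 1) / (dx * (1 + x)) * q .Ey 0 + (y - 1) / (dy * y) * q .N 1 +
    2 * (z - 1) / (dz * (1 + z)) * q .Ey 2 = 0
  divEz : 2 * (x - 1) / (dx * (1 + x)) * q .Ez 0 + 2 * (y - 1) / (dy * (1 + y)) * q .Ez 1 +
    (z - 1) / (dz * z) * q .N 2 = 0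
  divFx : 2 * (x - 1) / (dx * (1 + x)) * q .Fx 0 + (y - 1) / (dy * y) * q .Ez 1 +
    (z - 1) / (dz * z) * q .Ey 2 = 0
  divFy : (x - 1) / (dx * x) * q .Ez 0 + 2 * (y - 1) / (dy * (1 + y)) * q .Fy 1 +
    (z - 1) / (dz * z) * q .Ex 2 = 0
  divFz : (x - 1) / (dx * x) * q .Ey 0 + (y - 1) / (dy * y) * q .Ex 1 +
    2 * (z - 1) / (dz * (1 + z)) * q .Fz 2 = 0

theorem hat_loc (Δ k : Fin 3 → ℝ) (q : Dof × Fin 4 → ℂ) (l : Fin 4) (X : Dof) :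
    hat Δ k q l X.loc = q (X, l) := by
  simp [hat, shift_loc, kind_loc]

/-- The average determines the value at the centre. -/
theorem nodalHat_centre (Δ k : Fin 3 → ℝ) (q : Dof × Fin 4 → ℂ) (l : Fin 4) :
    nodalHat Δ k q l centre = 27 / 8 * (q (.A, l) - (1 / 216) *
      ((1 + (transl Δ k 0)⁻¹) * (1 + (transl Δ k 1)⁻¹) * (1 + (transl Δ k 2)⁻¹) * q (.N, l) +
        4 * (1 + (transl Δ k 1)⁻¹) * (1 + (transl Δ k 2)⁻¹) * q (.Ex, l) +
        4 * (1 + (transl Δ k 0)⁻¹) * (1 + (transl Δ k 2)⁻¹) * q (.Ey, l) +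
        4 * (1 + (transl Δ k 0)⁻¹) * (1 + (transl Δ k 1)⁻¹) * q (.Ez, l) +
        16 * (1 + (transl Δ k 0)⁻¹) * q (.Fx, l) + 16 * (1 + (transl Δ k 1)⁻¹) * q (.Fy, l) +
        16 * (1 + (transl Δ k 2)⁻¹) * q (.Fz, l))) := by
  have h : QuasiPeriodic (transl Δ k) (hat Δ k q l) := fun a r => hat_update Δ k q l a r
  have hl := hat_loc Δ k q l
  have hA : hat Δ k q l ![1, 1, 1] = q (.A, l) := hl .A
  have hEx : hat Δ k q l ![1, 2, 2] = q (.Ex, l) := hl .Ex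
  have hEy : hat Δ k q l ![2, 1, 2] = q (.Ey, l) := hl .Ey
  have hEz : hat Δ k q l ![2, 2, 1] = q (.Ez, l) := hl .Ez
  have hFx : hat Δ k q l ![2, 1, 1] = q (.Fx, l) := hl .Fx
  have hFy : hat Δ k q l ![1, 2, 1] = q (.Fy, l) := hl .Fy
  have hFz : hat Δ k q l ![1, 1, 2] = q (.Fz, l) := hl .Fz
  have hN : hat Δ k q l ![2, 2, 2] = q (.N, l) := hl .N
  have hc : centre = ![1, 1, 1] := loc_eta centre
  rw [nodalHat, nodal, if_pos rfl, Finset.sum_erase_eq_sub (Finset.mem_univ _), sum_loc, hc, hA]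
  simp [Fin.sum_univ_three, Fin.prod_univ_three, simpson, h.left_zero, h.left_one, h.left_two,
    hA, hEx, hEy, hEz, hFx, hFy, hFz, hN]
  ring

section QP

variable {t : Fin 3 → ℂ} {f : Loc → ℂ}

/-- The prescribed ratio of middle to right value is the solution of the zero-jump equation when
`t_a ≠ -1`. It turns derivatives at right ends into multiples of right values, which yields the
coefficients in the divergence relations. -/
theorem nodalDeriv_right (Δ : Fin 3 → ℝ) (h : QuasiPeriodic t f) (a : Fin 3) (ht : t a ≠ 0)
    (ht1 : 1 + t a ≠ 0) (r : Loc) (hf : f (Function.update r a 1) =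
      (1 + 6 * t a + t a ^ 2) / (4 * t a * (1 + t a)) * f (Function.update r a 2)) :
    nodalDeriv Δ a f (Function.update r a 2) =
        2 * (t a - 1) / (Δ a * (1 + t a)) * f (Function.update r a 2) ∧
      jump Δ t a f r = 0 := by
  simp only [jump, nodalDeriv, diffMat, Fin.sum_univ_three, Function.update_self,
    Function.update_idem, h a r, hf, Matrix.cons_val_zero, Matrix.cons_val_one, Matrix.cons_val]
  -- The spacing is not assumed positive here; if it is zero, both sides vanish because division by
  -- zero gives zero.
  by_cases hΔ : (Δ a : ℂ) = 0
  · simp [hΔ]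
  constructor <;> field_simp <;> ring

end QP

theorem DivergenceFreeRelations.nodalDiv_eq_zero (Δ k : Fin 3 → ℝ) (hΔ : ∀ a, 0 < Δ a)
    (ht : ∀ a, transl Δ k a ≠ -1) (q : Dof × Fin 4 → ℂ)
    (hq : DivergenceFreeRelations (Δ 0) (Δ 1) (Δ 2) (transl Δ k 0) (transl Δ k 1) (transl Δ k 2)
      fun X l => q (X, l)) (r : Loc) : nodalDiv Δ (nodalHat Δ k q) r = 0 := by
  have hΔ' : ∀ a, (Δ a : ℂ) ≠ 0 := fun a => by exact_mod_cast (hΔ a).ne'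
  have t0 := transl_ne_zero Δ k
  have t1 : ∀ a, 1 + transl Δ k a ≠ 0 := fun a h => ht a (by linear_combination h)
  have hp := quasiPeriodic_nodalHat Δ k q
  have hl := fun l X hX => nodalHat_loc Δ k q l X hX
  have hEx : ∀ l, nodalHat Δ k q l ![1, 2, 2] = q (.Ex, l) := fun l => hl l .Ex (by decide)
  have hEy : ∀ l, nodalHat Δ k q l ![2, 1, 2] = q (.Ey, l) := fun l => hl l .Ey (by decide)
  have hEz : ∀ l, nodalHat Δ k q l ![2, 2, 1] = q (.Ez, l) := fun l => hl l .Ez (by decide)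
  have hFx : ∀ l, nodalHat Δ k q l ![2, 1, 1] = q (.Fx, l) := fun l => hl l .Fx (by decide)
  have hFy : ∀ l, nodalHat Δ k q l ![1, 2, 1] = q (.Fy, l) := fun l => hl l .Fy (by decide)
  have hFz : ∀ l, nodalHat Δ k q l ![1, 1, 2] = q (.Fz, l) := fun l => hl l .Fz (by decide)
  have hN : ∀ l, nodalHat Δ k q l ![2, 2, 2] = q (.N, l) := fun l => hl l .N (by decide)
  have hc : ![1, 1, 1] = centre := (loc_eta centre).symm
  obtain ⟨xN, xEy, xEz, xA, yN, yEx, yEz, yA, zN, zEx, zEy, zA, dN, dEx, dEy, dEz, dFx, dFy, dFz⟩ :=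
    hq
  have s0 := t0 0
  have s1 := t0 1
  have s2 := t0 2
  have r0 := t1 0
  have r1 := t1 1
  have r2 := t1 2
  have d0 := hΔ' 0
  have d1 := hΔ' 1
  have d2 := hΔ' 2
  -- The relation for the average is the zero-jump ratio on the line through the centre, integrated
  -- by Simpson's rule together with the three other ratios.
  have cx : nodalHat Δ k q 0 ![1, 1, 1] = (1 + 6 * transl Δ k 0 + transl Δ k 0 ^ 2) /
      (4 * transl Δ k 0 * (1 + transl Δ k 0)) * q (.Fx, 0) := by
    rw [hc, nodalHat_centre, xA, xN, xEy, xEz]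
    field_simp
    ring
  have cy : nodalHat Δ k q 1 ![1, 1, 1] = (1 + 6 * transl Δ k 1 + transl Δ k 1 ^ 2) /
      (4 * transl Δ k 1 * (1 + transl Δ k 1)) * q (.Fy, 1) := by
    rw [hc, nodalHat_centre, yA, yN, yEx, yEz]
    field_simp
    ring
  have cz : nodalHat Δ k q 2 ![1, 1, 1] = (1 + 6 * transl Δ k 2 + transl Δ k 2 ^ 2) /
      (4 * transl Δ k 2 * (1 + transl Δ k 2)) * q (.Fz, 2) := by
    rw [hc, nodalHat_centre, zA, zN, zEx, zEy]
    field_simp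
    ring
  have Rx : ∀ j l, nodalHat Δ k q 0 ![1, j, l] = (1 + 6 * transl Δ k 0 + transl Δ k 0 ^ 2) /
      (4 * transl Δ k 0 * (1 + transl Δ k 0)) * nodalHat Δ k q 0 ![2, j, l] →
      nodalDeriv Δ 0 (nodalHat Δ k q 0) ![2, j, l] = 2 * (transl Δ k 0 - 1) /
        (Δ 0 * (1 + transl Δ k 0)) * nodalHat Δ k q 0 ![2, j, l] ∧
      jump Δ (transl Δ k) 0 (nodalHat Δ k q 0) ![2, j, l] = 0 := by
    intro j l h
    have := nodalDeriv_right Δ (hp 0) 0 s0 r0 ![2, j, l]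
    simp only [update_vec_zero] at this
    exact this h
  have Ry : ∀ i l, nodalHat Δ k q 1 ![i, 1, l] = (1 + 6 * transl Δ k 1 + transl Δ k 1 ^ 2) /
      (4 * transl Δ k 1 * (1 + transl Δ k 1)) * nodalHat Δ k q 1 ![i, 2, l] →
      nodalDeriv Δ 1 (nodalHat Δ k q 1) ![i, 2, l] = 2 * (transl Δ k 1 - 1) /
        (Δ 1 * (1 + transl Δ k 1)) * nodalHat Δ k q 1 ![i, 2, l] ∧
      jump Δ (transl Δ k) 1 (nodalHat Δ k q 1) ![i, 2, l] = 0 := by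
    intro i l h
    have := nodalDeriv_right Δ (hp 1) 1 s1 r1 ![i, 2, l]
    simp only [update_vec_one] at this
    exact this h
  have Rz : ∀ i j, nodalHat Δ k q 2 ![i, j, 1] = (1 + 6 * transl Δ k 2 + transl Δ k 2 ^ 2) /
      (4 * transl Δ k 2 * (1 + transl Δ k 2)) * nodalHat Δ k q 2 ![i, j, 2] →
      nodalDeriv Δ 2 (nodalHat Δ k q 2) ![i, j, 2] = 2 * (transl Δ k 2 - 1) /
        (Δ 2 * (1 + transl Δ k 2)) * nodalHat Δ k q 2 ![i, j, 2] ∧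
      jump Δ (transl Δ k) 2 (nodalHat Δ k q 2) ![i, j, 2] = 0 := by
    intro i j h
    have := nodalDeriv_right Δ (hp 2) 2 s2 r2 ![i, j, 2]
    simp only [update_vec_two] at this
    exact this h
  have Mx : ∀ j l, nodalDeriv Δ 0 (nodalHat Δ k q 0) ![1, j, l] =
      (transl Δ k 0 - 1) / (Δ 0 * transl Δ k 0) * nodalHat Δ k q 0 ![2, j, l] := by
    intro j l
    rw [nodalDeriv_middle Δ (hp 0) 0 _ rfl, update_vec_zero]
    field_simp
  have My : ∀ i l, nodalDeriv Δ 1 (nodalHat Δ k q 1) ![i, 1, l] =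
      (transl Δ k 1 - 1) / (Δ 1 * transl Δ k 1) * nodalHat Δ k q 1 ![i, 2, l] := by
    intro i l
    rw [nodalDeriv_middle Δ (hp 1) 1 _ rfl, update_vec_one]
    field_simp
  have Mz : ∀ i j, nodalDeriv Δ 2 (nodalHat Δ k q 2) ![i, j, 1] =
      (transl Δ k 2 - 1) / (Δ 2 * transl Δ k 2) * nodalHat Δ k q 2 ![i, j, 2] := by
    intro i j
    rw [nodalDeriv_middle Δ (hp 2) 2 _ rfl, update_vec_two]
    field_simp
  have x22 := Rx 2 2 (by rw [hEx, hN, xN])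
  have x12 := Rx 1 2 (by rw [hFz, hEy, xEy])
  have x21 := Rx 2 1 (by rw [hFy, hEz, xEz])
  have x11 := Rx 1 1 (by rw [hFx, cx])
  have y22 := Ry 2 2 (by rw [hEy, hN, yN])
  have y12 := Ry 1 2 (by rw [hFz, hEx, yEx])
  have y21 := Ry 2 1 (by rw [hFx, hEz, yEz])
  have y11 := Ry 1 1 (by rw [hFy, cy])
  have z22 := Rz 2 2 (by rw [hEz, hN, zN])
  have z12 := Rz 1 2 (by rw [hFy, hEx, zEx])
  have z21 := Rz 2 1 (by rw [hFx, hEy, zEy])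
  have z11 := Rz 1 1 (by rw [hFz, cz])
  have hdiv : ∀ r, nodalDiv Δ (nodalHat Δ k q) r = nodalDeriv Δ 0 (nodalHat Δ k q 0) r +
      nodalDeriv Δ 1 (nodalHat Δ k q 1) r + nodalDeriv Δ 2 (nodalHat Δ k q 2) r := fun r => by
    rw [nodalDiv, Fin.sum_univ_three]
    rfl
  refine ActiveFlux.nodalDiv_eq_zero Δ hp t0 (fun X hX => ?_) (fun X a ha => ?_) r
  · rw [hdiv]
    cases X
    · exact absurd rfl hX
    · rw [Dof.loc, Mx, y12.1, z12.1, hN, hEx, hEx, dEx]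
    · rw [Dof.loc, x12.1, My, z21.1, hN, hEy, hEy, dEy]
    · rw [Dof.loc, x21.1, y21.1, Mz, hN, hEz, hEz, dEz]
    · rw [Dof.loc, x11.1, My, Mz, hFx, hEz, hEy, dFx]
    · rw [Dof.loc, Mx, y11.1, Mz, hEz, hFy, hEx, dFy]
    · rw [Dof.loc, Mx, My, z11.1, hEy, hEx, hFz, dFz]
    · rw [Dof.loc, x22.1, y22.1, z22.1, hN, hN, hN, dN]
  · have h3 : ∀ j : Fin 3, j = 0 ∨ j = 1 ∨ j = 2 := by decide
    rcases h3 a with rfl | rfl | rfl <;> cases X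
    exacts [absurd ha (by decide), absurd ha (by decide), x12.2, x21.2, x11.2,
      absurd ha (by decide), absurd ha (by decide), x22.2, absurd ha (by decide),
      y12.2, absurd ha (by decide), y21.2, absurd ha (by decide), y11.2,
      absurd ha (by decide), y22.2, absurd ha (by decide), z12.2, z21.2,
      absurd ha (by decide), absurd ha (by decide), absurd ha (by decide), z11.2, z22.2]

/-- All nineteen relations are rational identities; factoring `x ^ 2 - 1` exposes the denominators
known to be nonzero. The same check serves the other four vectors. -/
theorem divergenceFreeRelations_kernelVector1 {dx dy dz x y z : ℂ} (hdx : dx ≠ 0) (hdy : dy ≠ 0)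
    (hdz : dz ≠ 0) (hx : x ≠ 0) (hy : y ≠ 0) (hz : z ≠ 0) (x1 : x - 1 ≠ 0) (y1 : y - 1 ≠ 0)
    (z1 : z - 1 ≠ 0) (x2 : 1 + x ≠ 0) (y2 : 1 + y ≠ 0) (z2 : 1 + z ≠ 0) :
    DivergenceFreeRelations dx dy dz x y z (kernelVector1 dx dy dz x y z) := by
  have x4 : x ^ 2 - 1 = (x - 1) * (1 + x) := by ring
  constructor <;> simp [kernelVector1, x4, -mul_eq_zero, -zero_eq_mul] <;> field_simp <;>
    ring

theorem divergenceFreeRelations_kernelVector2 {dx dy dz x y z : ℂ} (hdx : dx ≠ 0) (hdy : dy ≠ 0)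
    (hdz : dz ≠ 0) (hx : x ≠ 0) (hy : y ≠ 0) (hz : z ≠ 0) (x1 : x - 1 ≠ 0) (y1 : y - 1 ≠ 0)
    (z1 : z - 1 ≠ 0) (x2 : 1 + x ≠ 0) (y2 : 1 + y ≠ 0) (z2 : 1 + z ≠ 0) :
    DivergenceFreeRelations dx dy dz x y z (kernelVector2 dx dy dz x y z) := by
  have x4 : x ^ 2 - 1 = (x - 1) * (1 + x) := by ring
  constructor <;> simp [kernelVector2, x4, -mul_eq_zero, -zero_eq_mul] <;> field_simp <;>
    ring

theorem divergenceFreeRelations_kernelVector3 {dx dy dz x y z : ℂ} (hdx : dx ≠ 0) (hdy : dy ≠ 0)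
    (hdz : dz ≠ 0) (hx : x ≠ 0) (hy : y ≠ 0) (hz : z ≠ 0) (x1 : x - 1 ≠ 0) (y1 : y - 1 ≠ 0)
    (z1 : z - 1 ≠ 0) (x2 : 1 + x ≠ 0) (y2 : 1 + y ≠ 0) (z2 : 1 + z ≠ 0) :
    DivergenceFreeRelations dx dy dz x y z (kernelVector3 dx dy dz x y z) := by
  have x4 : x ^ 2 - 1 = (x - 1) * (1 + x) := by ring
  have y4 : y ^ 2 - 1 = (y - 1) * (1 + y) := by ring
  constructor <;> simp [kernelVector3, x4, y4, -mul_eq_zero, -zero_eq_mul] <;> field_simp <;>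
    ring

theorem divergenceFreeRelations_kernelVector4 {dx dy dz x y z : ℂ} (hdx : dx ≠ 0) (hdy : dy ≠ 0)
    (hdz : dz ≠ 0) (hx : x ≠ 0) (hy : y ≠ 0) (hz : z ≠ 0) (x1 : x - 1 ≠ 0) (y1 : y - 1 ≠ 0)
    (z1 : z - 1 ≠ 0) (x2 : 1 + x ≠ 0) (y2 : 1 + y ≠ 0) (z2 : 1 + z ≠ 0)
    (y3 : 1 + y * (6 + y) ≠ 0) :
    DivergenceFreeRelations dx dy dz x y z (kernelVector4 dx dy dz x y z) := by
  have x4 : x ^ 2 - 1 = (x - 1) * (1 + x) := by ring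
  have y4 : y ^ 2 - 1 = (y - 1) * (1 + y) := by ring
  constructor <;> simp [kernelVector4, x4, y4, -mul_eq_zero, -zero_eq_mul] <;> field_simp <;>
    ring

theorem divergenceFreeRelations_kernelVector5 {dx dy dz x y z : ℂ} (hdx : dx ≠ 0) (hdy : dy ≠ 0)
    (hdz : dz ≠ 0) (hx : x ≠ 0) (hy : y ≠ 0) (hz : z ≠ 0) (x1 : x - 1 ≠ 0) (y1 : y - 1 ≠ 0)
    (z1 : z - 1 ≠ 0) (x2 : 1 + x ≠ 0) (y2 : 1 + y ≠ 0) (z2 : 1 + z ≠ 0)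
    (x3 : 1 + x * (6 + x) ≠ 0) :
    DivergenceFreeRelations dx dy dz x y z (kernelVector5 dx dy dz x y z) := by
  have x4 : x ^ 2 - 1 = (x - 1) * (1 + x) := by ring
  have y4 : y ^ 2 - 1 = (y - 1) * (1 + y) := by ring
  constructor <;> simp [kernelVector5, x4, y4, -mul_eq_zero, -zero_eq_mul] <;> field_simp <;>
    ring

/-! ### Membership, independence and span of the explicit vectors -/

theorem norm_transl (Δ k : Fin 3 → ℝ) (a : Fin 3) : ‖transl Δ k a‖ = 1 := by
  rw [transl, mul_comm, Complex.norm_exp_ofReal_mul_I]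

/-- On the unit circle `|mx| = m > 2 ≥ |1 + x²|`. With `m = 6` this covers the remaining
denominators, with `m = 4` a numerator factor in the elimination. -/
theorem quadratic_ne_zero_of_norm_eq_one {x : ℂ} (hx : ‖x‖ = 1) {m : ℝ} (hm : 2 < m) :
    1 + x * (m + x) ≠ 0 := by
  intro h
  have h1 : x * m = -(1 + x * x) := by linear_combination h
  have h2 : ‖x * m‖ ≤ 2 := by
    rw [h1, norm_neg]
    refine (norm_add_le _ _).trans ?_
    rw [norm_mul, hx, norm_one]
    norm_num
  rw [norm_mul, hx, one_mul, Complex.norm_real, Real.norm_of_nonneg (by linarith)] at h2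
  linarith

theorem General.divergenceFreeRelations {Δ k : Fin 3 → ℝ} (hΔ : ∀ a, 0 < Δ a) (hk : General Δ k)
    (i : Fin 5) : DivergenceFreeRelations (Δ 0) (Δ 1) (Δ 2) (transl Δ k 0) (transl Δ k 1)
      (transl Δ k 2) fun X l => kernelVector Δ k i (X, l) := by
  have hΔ' : ∀ a, (Δ a : ℂ) ≠ 0 := fun a => by exact_mod_cast (hΔ a).ne'
  have t0 := transl_ne_zero Δ k
  have t1 : ∀ a, transl Δ k a - 1 ≠ 0 := fun a => sub_ne_zero.mpr (hk.1 a).1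
  have t2 : ∀ a, 1 + transl Δ k a ≠ 0 := fun a h => (hk.1 a).2 (by linear_combination h)
  have t3 : ∀ a, 1 + transl Δ k a * (6 + transl Δ k a) ≠ 0 := fun a => by
    have := quadratic_ne_zero_of_norm_eq_one (norm_transl Δ k a) (m := 6) (by norm_num)
    exact_mod_cast this
  fin_cases i
  · exact divergenceFreeRelations_kernelVector1 (hΔ' 0) (hΔ' 1) (hΔ' 2) (t0 0) (t0 1) (t0 2)
      (t1 0) (t1 1) (t1 2) (t2 0) (t2 1) (t2 2)
  · exact divergenceFreeRelations_kernelVector2 (hΔ' 0) (hΔ' 1) (hΔ' 2) (t0 0) (t0 1) (t0 2)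
      (t1 0) (t1 1) (t1 2) (t2 0) (t2 1) (t2 2)
  · exact divergenceFreeRelations_kernelVector3 (hΔ' 0) (hΔ' 1) (hΔ' 2) (t0 0) (t0 1) (t0 2)
      (t1 0) (t1 1) (t1 2) (t2 0) (t2 1) (t2 2)
  · exact divergenceFreeRelations_kernelVector4 (hΔ' 0) (hΔ' 1) (hΔ' 2) (t0 0) (t0 1) (t0 2)
      (t1 0) (t1 1) (t1 2) (t2 0) (t2 1) (t2 2) (t3 1)
  · exact divergenceFreeRelations_kernelVector5 (hΔ' 0) (hΔ' 1) (hΔ' 2) (t0 0) (t0 1) (t0 2)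
      (t1 0) (t1 1) (t1 2) (t2 0) (t2 1) (t2 2) (t3 0)

theorem kernelVector_pressure (Δ k : Fin 3 → ℝ) (i : Fin 5) (X : Dof) :
    kernelVector Δ k i (X, 3) = 0 := by
  fin_cases i <;> cases X <;> rfl

theorem General.kernelVector_mem_ker (c : ℝ) (hc : 0 < c) {Δ k : Fin 3 → ℝ} (hΔ : ∀ a, 0 < Δ a)
    (hk : General Δ k) (i : Fin 5) :
    kernelVector Δ k i ∈ LinearMap.ker (Matrix.toLin' (evolutionMatrix c Δ k)) :=
  (mem_ker_evolution_iff c hc Δ k hΔ (fun a => (hk.1 a).1) _).mpr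
    ⟨kernelVector_pressure Δ k i, (hk.divergenceFreeRelations hΔ i).nodalDiv_eq_zero Δ k hΔ
      (fun a => (hk.1 a).2) _⟩

/-- The elimination that shows the linear independence of the explicit vectors, up to the factor
that does not vanish for general wave vectors. -/
theorem kernelVector_elimination {dx dy dz x y z : ℂ} (hdx : dx ≠ 0) (hdy : dy ≠ 0) (hdz : dz ≠ 0)
    (hx : x ≠ 0) (hy : y ≠ 0) (hz : z ≠ 0) (x1 : x - 1 ≠ 0) (y1 : y - 1 ≠ 0) (z1 : z - 1 ≠ 0)
    (x2 : 1 + x ≠ 0) (y2 : 1 + y ≠ 0) (z2 : 1 + z ≠ 0) (x3 : 1 + x * (6 + x) ≠ 0)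
    (y3 : 1 + y * (6 + y) ≠ 0) :
    -kernelVector5 dx dy dz x y z .N 1 * kernelVector1 dx dy dz x y z .A 1 -
      kernelVector5 dx dy dz x y z .N 2 * kernelVector2 dx dy dz x y z .A 1 +
      kernelVector3 dx dy dz x y z .Fz 1 * kernelVector5 dx dy dz x y z .Fz 2 *
        kernelVector4 dx dy dz x y z .A 1 =
    8 * dy * (1 + y * (4 + y)) * (x - 1) / (27 * dx * (1 + x * (6 + x)) * z ^ 2 * x *
      ((y - 1) * (1 + y))) * (z ^ 2 + 4 * x * z ^ 2 + x ^ 2 * (2 + z * (8 + 3 * z))) := by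
  have x4 : x ^ 2 - 1 = (x - 1) * (1 + x) := by ring
  have y4 : y ^ 2 - 1 = (y - 1) * (1 + y) := by ring
  simp [kernelVector1, kernelVector2, kernelVector3, kernelVector4, kernelVector5, x4, y4]
  field_simp
  ring

/-- In the second and third components at `N` and `Fz`, the first four vectors form a triangular
system with unit diagonal. It expresses their coefficients through that of the fifth vector, and the
second component at `A` then decides. -/
theorem General.linearIndependent {Δ k : Fin 3 → ℝ} (hΔ : ∀ a, 0 < Δ a) (hk : General Δ k) :
    LinearIndependent ℂ (kernelVector Δ k) := by
  have hΔ' : ∀ a, (Δ a : ℂ) ≠ 0 := fun a => by exact_mod_cast (hΔ a).ne'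
  have t0 := transl_ne_zero Δ k
  have t1 : ∀ a, transl Δ k a - 1 ≠ 0 := fun a => sub_ne_zero.mpr (hk.1 a).1
  have t2 : ∀ a, 1 + transl Δ k a ≠ 0 := fun a h => (hk.1 a).2 (by linear_combination h)
  have t3 : ∀ a, 1 + transl Δ k a * (6 + transl Δ k a) ≠ 0 := fun a => by
    have := quadratic_ne_zero_of_norm_eq_one (norm_transl Δ k a) (m := 6) (by norm_num)
    exact_mod_cast this
  have t4 : ∀ a, 1 + transl Δ k a * (4 + transl Δ k a) ≠ 0 := fun a => by
    have := quadratic_ne_zero_of_norm_eq_one (norm_transl Δ k a) (m := 4) (by norm_num)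
    exact_mod_cast this
  have helim := kernelVector_elimination (hΔ' 0) (hΔ' 1) (hΔ' 2) (t0 0) (t0 1) (t0 2)
      (t1 0) (t1 1) (t1 2) (t2 0) (t2 1) (t2 2) (t3 0) (t3 1)
  rw [Fintype.linearIndependent_iff]
  intro b hb
  have hb' : ∀ X l, b 0 * kernelVector1 (Δ 0) (Δ 1) (Δ 2) (transl Δ k 0) (transl Δ k 1)
        (transl Δ k 2) X l +
      b 1 * kernelVector2 (Δ 0) (Δ 1) (Δ 2) (transl Δ k 0) (transl Δ k 1) (transl Δ k 2) X l +
      b 2 * kernelVector3 (Δ 0) (Δ 1) (Δ 2) (transl Δ k 0) (transl Δ k 1) (transl Δ k 2) X l +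
      b 3 * kernelVector4 (Δ 0) (Δ 1) (Δ 2) (transl Δ k 0) (transl Δ k 1) (transl Δ k 2) X l +
      b 4 * kernelVector5 (Δ 0) (Δ 1) (Δ 2) (transl Δ k 0) (transl Δ k 1) (transl Δ k 2) X l =
      0 := by
    intro X l
    have h := congrFun hb (X, l)
    simpa [Fin.sum_univ_five, kernelVector] using h
  have eN1 := hb' .N 1
  have eN2 := hb' .N 2
  have eF1 := hb' .Fz 1
  have eF2 := hb' .Fz 2
  have eA := hb' .A 1
  simp only [kernelVector1, kernelVector2, kernelVector3, kernelVector4, Matrix.cons_val_one,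
    Matrix.cons_val_zero, Matrix.cons_val, mul_zero, mul_one, add_zero, zero_add] at eN1 eN2
  rw [show kernelVector1 _ _ _ _ _ _ .Fz 1 = 0 from rfl,
    show kernelVector2 _ _ _ _ _ _ .Fz 1 = 0 from rfl,
    show kernelVector4 _ _ _ _ _ _ .Fz 1 = 1 from rfl,
    show kernelVector5 _ _ _ _ _ _ .Fz 1 = 0 from rfl] at eF1
  rw [show kernelVector1 _ _ _ _ _ _ .Fz 2 = 0 from rfl,
    show kernelVector2 _ _ _ _ _ _ .Fz 2 = 0 from rfl,
    show kernelVector3 _ _ _ _ _ _ .Fz 2 = 1 from rfl,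
    show kernelVector4 _ _ _ _ _ _ .Fz 2 = 0 from rfl] at eF2
  rw [show kernelVector3 _ _ _ _ _ _ .A 1 = 0 from rfl,
    show kernelVector5 _ _ _ _ _ _ .A 1 = 0 from rfl] at eA
  simp only [mul_zero, mul_one, add_zero, zero_add] at eF1 eF2 eA
  have hne := mul_ne_zero (div_ne_zero (mul_ne_zero (mul_ne_zero (mul_ne_zero
    (OfNat.ofNat_ne_zero 8) (hΔ' 1)) (t4 1)) (t1 0)) (mul_ne_zero (mul_ne_zero (mul_ne_zero
    (mul_ne_zero (mul_ne_zero (OfNat.ofNat_ne_zero 27) (hΔ' 0)) (t3 0)) (pow_ne_zero 2 (t0 2)))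
    (t0 0)) (mul_ne_zero (t1 1) (t2 1)))) hk.2
  rw [← helim] at hne
  -- Substituting the four expressions into the equation at `A` gives `b 4` times the left side of
  -- `kernelVector_elimination`, which is nonzero for general `k`.
  have b4 : b 4 = 0 := by
    refine (mul_eq_zero.mp ?_).resolve_right hne
    linear_combination eA - kernelVector1 (Δ 0) (Δ 1) (Δ 2) (transl Δ k 0) (transl Δ k 1)
        (transl Δ k 2) .A 1 * eN1 - kernelVector2 (Δ 0) (Δ 1) (Δ 2) (transl Δ k 0) (transl Δ k 1)
        (transl Δ k 2) .A 1 * eN2 - kernelVector4 (Δ 0) (Δ 1) (Δ 2) (transl Δ k 0) (transl Δ k 1)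
        (transl Δ k 2) .A 1 * (eF1 - kernelVector3 (Δ 0) (Δ 1) (Δ 2) (transl Δ k 0) (transl Δ k 1)
        (transl Δ k 2) .Fz 1 * eF2)
  rw [b4, zero_mul, add_zero] at eN1 eN2 eF2
  rw [eF2, zero_mul, zero_add] at eF1
  intro i
  fin_cases i
  exacts [eN1, eN2, eF2, eF1, b4]

theorem General.span_kernelVector (c : ℝ) (hc : 0 < c) {Δ k : Fin 3 → ℝ} (hΔ : ∀ a, 0 < Δ a)
    (hk : General Δ k) : Submodule.span ℂ (Set.range (kernelVector Δ k)) =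
      LinearMap.ker (Matrix.toLin' (evolutionMatrix c Δ k)) := by
  refine Submodule.eq_of_le_of_finrank_eq ?_ ?_
  · rw [Submodule.span_le]
    rintro _ ⟨i, rfl⟩
    exact hk.kernelVector_mem_ker c hc hΔ i
  · rw [finrank_span_eq_card (hk.linearIndependent hΔ), Fintype.card_fin]
    exact (kerDim_eq_five c hc Δ k hΔ fun a => (hk.1 a).1).symm

end

end ActiveFlux

theorem mainTheorem2 (c : ℝ) (hc : 0 < c) (Δ : Fin 3 → ℝ) (hΔ : ∀ a, 0 < Δ a) :
    -- stationarity preservation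
    ActiveFlux.StationarityPreserving (ActiveFlux.acousticSymbol c)
      (ActiveFlux.evolutionMatrix c Δ) ∧
    -- the kernel is five-dimensional as soon as no translation factor is one
    (∀ k : Fin 3 → ℝ, (∀ a, ActiveFlux.transl Δ k a ≠ 1) →
      ActiveFlux.kerDim (ActiveFlux.evolutionMatrix c Δ k) = 5) ∧
    -- for general wave vectors it is spanned by the explicit vectors
    (∀ k : Fin 3 → ℝ, ActiveFlux.General Δ k →
      Submodule.span ℂ (Set.range (ActiveFlux.kernelVector Δ k)) =
        LinearMap.ker (Matrix.toLin' (ActiveFlux.evolutionMatrix c Δ k))) ∧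
    -- almost all wave vectors are general
    (∀ᵐ k : Fin 3 → ℝ, ActiveFlux.General Δ k) ∧
    -- the kernel consists of the data with vanishing pressure and divergence-free reconstruction
    (∀ k : Fin 3 → ℝ, (∀ a, ActiveFlux.transl Δ k a ≠ 1) → ∀ qhat : ActiveFlux.Dof × Fin 4 → ℂ,
      qhat ∈ LinearMap.ker (Matrix.toLin' (ActiveFlux.evolutionMatrix c Δ k)) ↔
        ActiveFlux.divHat Δ k qhat = 0 ∧ ∀ X, qhat (X, 3) = 0) := by
  refine ⟨ActiveFlux.stationarityPreserving c hc Δ hΔ,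
    fun k hk => ActiveFlux.kerDim_eq_five c hc Δ k hΔ hk,
    fun k hk => hk.span_kernelVector c hc hΔ, ActiveFlux.ae_general Δ hΔ, fun k hk qhat => ?_⟩
  rw [ActiveFlux.mem_ker_evolution_iff c hc Δ k hΔ hk, ActiveFlux.divHat_eq_zero_iff Δ k hΔ,
    and_comm]
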